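/- Let $d$ be a non-negative integer and let $\Phi$ be a probability measure on finite non-negative configurations $\varphi=(\varphi(\mathbf z))_{\mathbf z\in\mathbb Z^d}$, $\varphi(\mathbf z)\in\{0,1,2,\dots\}$, on $\mathbb Z^d$. Write $\|\varphi\|=\sum_{\mathbf z}\varphi(\mathbf z)$, $|\varphi|_r=\sum_{\mathbf z}|\mathbf z|^r\varphi(\mathbf z)$ (with $|\cdot|$ the Euclidean norm), $\lambda=\mathbb E\|\varphi\|$, $\mu(\mathbf x)=\mathbb E[\varphi(\mathbf x)]$ and $\widehat\mu(\mathbf u)=\sum_{\mathbf x}e^{i\mathbf u\cdot\mathbf x}\mu(\mathbf x)$ for $\mathbf u\in\mathbb T^d=(-\pi,\pi]^d$, where $\varphi$ has law $\Phi$. Let $\mathcal X(t)=(X_{\mathbf x}(t))_{\mathbf x\in\mathbb Z^d}$, $t\ge 0$, be the branching random walk started from a single ball at the origin: every ball carries an independent unit-rate Poisson clock starting at its birth; whenever the clock of a ball at $\mathbf z$ rings, the ball stays where it is and new balls are added according to an independent draw from $\Phi$ translated by $\mathbf z$; $X_{\mathbf x}(t)$ is the number of balls at $\mathbf x$ at time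 $t$. Put $\widehat{\mathcal X}_{\mathbf u}(t)=\sum_{\mathbf x}e^{i\mathbf u\cdot\mathbf x}X_{\mathbf x}(t)$ and $M_{\mathbf u}(t)=e^{-\widehat\mu(\mathbf u)t}\,\widehat{\mathcal X}_{\mathbf u}(t)$. Assume that $\mathbb E[\|\varphi\|^2]<\infty$. Then almost surely the number of balls is finite at all times, and there is a function $C$ on $\mathbb T^d$ (depending on $\Phi$), which for every $c>0$ is bounded on $\{\mathbf u\in\mathbb T^d:\operatorname{Re}\widehat\mu(\mathbf u)-\tfrac12\lambda\ge c\}$, such that for every $\mathbf u\in\mathbb T^d$ with $\operatorname{Re}\widehat\mu(\mathbf u)>\tfrac12\lambda$ the following hold. 1. $(M_{\mathbf u}(t))_{t\ge0}$ is a martingale with respect to the filtration generated by $\mathcal X$, and it is bounded in $L^2$. 2. There is a random variable $M^\infty_{\mathbf u}\in L^2$ such that $M_{\mathbf u}(t)\to M^\infty_{\mathbf u}$ almost surely and in $L^2$ as $t\to\infty$, and for all $t\ge0$ $$\mathbb E\big[|M_{\mathbf u}(t)-M^\infty_{\mathbf u}|^2\big]\le C(\mathbf u)\,\mathbb E[\|\varphi\|^2]\,e^{-(2\operatorname{Re}\widehat\mu(\mathbf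 u)-\lambda)t}.$$ 3. If in addition $\mathbb E\big[|\varphi|_1^2\big]<\infty$ and $\mathbb E\big[|\varphi|_2\big]<\infty$, then for all $t\ge0$ $$\mathbb E\big[|M_{\mathbf u}(t)-M_{\mathbf 0}(t)|^2\big]\le C(\mathbf u)\,|\mathbf u|^2.$$ -/

import Mathlib

open MeasureTheory ProbabilityTheory Filter Topology
open scoped NNReal ENNReal

noncomputable section

namespace BranchingWalk

variable {d : ℕ}

/-- Sites of the lattice `ℤ^d`. -/
abbrev Site (d : ℕ) : Type := Fin d → ℤ

/-- Finite non-negative configurations of balls on `ℤ^d`. -/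
abbrev Config (d : ℕ) : Type := Site d →₀ ℕ

/-- The (countable) set of finite configurations carries the discrete sigma-algebra. -/
instance instMeasurableSpaceConfig (d : ℕ) : MeasurableSpace (Config d) := ⊤

/-- `‖φ‖ = ∑ z, φ z`, the total number of balls of a finite configuration. -/
def total (φ : Config d) : ℝ := φ.sum fun _ n => (n : ℝ)

/-- The Euclidean norm of a site. -/
def siteNorm (z : Site d) : ℝ := Real.sqrt (∑ i, (z i : ℝ) ^ 2)

/-- The displacement `∑ z, |z| ^ r * φ z` of a finite configuration. -/
def displacement (r : ℕ) (φ : Config d) : ℝ := φ.sum fun z n => siteNorm z ^ r * (n : ℝ)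

/-- The character `x ↦ exp (i u·x)` of `ℤ^d`. -/
def character (u : EuclideanSpace ℝ (Fin d)) (x : Site d) : ℂ :=
  Complex.exp (Complex.I * ((∑ i, u i * (x i : ℝ) : ℝ) : ℂ))

/-- The torus `𝕋^d`, identified with `(-π, π]^d`. -/
def torus (d : ℕ) : Set (EuclideanSpace ℝ (Fin d)) :=
  {u | ∀ i, u i ∈ Set.Ioc (-Real.pi) Real.pi}

/-- `λ = E ‖φ‖`. -/
def meanTotal (Φ : Measure (Config d)) : ℝ := ∫ φ, total φ ∂Φ

/-- `μ x = E (φ x)`. -/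
def intensity (Φ : Measure (Config d)) (x : Site d) : ℝ := ∫ φ, (φ x : ℝ) ∂Φ

/-- The Fourier transform `∑ x, exp (i u·x) μ x` of the mean offspring configuration. -/
def intensityHat (Φ : Measure (Config d)) (u : EuclideanSpace ℝ (Fin d)) : ℂ :=
  ∑' x : Site d, character u x * (intensity Φ x : ℂ)

/-- Genealogical labels of balls.  The empty list is the initial ball, and `(k, y, m) :: v` is the
ball number `m` among those which the ball `v`, at the ring number `k` of its clock
(`k = 0, 1, 2, …`), places at displacement `y` from its own position. -/
abbrev Ball (d : ℕ) : Type := List (ℕ × Site d × ℕ)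

/-- The randomness that drives the process: every potential ball `v` has its own clock, whose
waiting times `gap v 0`, `gap v 1`, … are exponential of rate one (a unit-rate Poisson clock), and
at the ring number `k` of that clock it uses the draw `offspring v k` from `Φ`.  All waiting times
and all draws are independent. -/
structure Driving (Φ : Measure (Config d)) {Ω : Type*} [MeasurableSpace Ω] (P : Measure Ω) where
  gap : Ball d → ℕ → Ω → ℝ
  offspring : Ball d → ℕ → Ω → Config d
  measurable_gap : ∀ v k, Measurable (gap v k)
  measurable_offspring : ∀ v k, Measurable (offspring v k)
  law : ∀ v k, P.map (fun ω => (gap v k ω, offspring v k ω)) = (expMeasure 1).prod Φ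
  indep : iIndepFun (fun (i : Ball d × ℕ) ω => (gap i.1 i.2 ω, offspring i.1 i.2 ω)) P

/-- The position of a ball; the initial ball is at the origin. -/
def position : Ball d → Site d
  | [] => 0
  | (_, y, _) :: v => position v + y

namespace Driving

variable {Φ : Measure (Config d)} {Ω : Type*} [MeasurableSpace Ω] {P : Measure Ω}

/-- The time between the birth of the ball `v` and the ring number `k` of its clock. -/
def ring (D : Driving Φ P) (v : Ball d) (k : ℕ) (ω : Ω) : ℝ :=
  ∑ j ∈ Finset.range (k + 1), D.gap v j ω

/-- The time at which a ball is born; the initial ball is born at time `0`, any other ball when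
the corresponding ring of the clock of its parent occurs. -/
def birth (D : Driving Φ P) : Ball d → Ω → ℝ
  | [], _ => 0
  | (k, _, _) :: v, ω => D.birth v ω + D.ring v k ω

/-- Whether a label belongs to a ball that is ever born: its parent has to be one, and the
relevant draw of the parent has to contain that many balls. -/
def IsBorn (D : Driving Φ P) : Ball d → Ω → Prop
  | [], _ => True
  | (k, y, m) :: v, ω => D.IsBorn v ω ∧ m < D.offspring v k ω y

/-- The set of all balls present at time `t` (balls never move or die). -/
def population (D : Driving Φ P) (t : ℝ≥0) (ω : Ω) : Set (Ball d) :=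
  {v | D.IsBorn v ω ∧ D.birth v ω ≤ t}

/-- The configuration at time `t` of the process started from a single ball at the origin: the
number `X_x(t)` of balls at each site `x`. -/
def process (D : Driving Φ P) (t : ℝ≥0) (ω : Ω) (x : Site d) : ℕ :=
  {v ∈ D.population t ω | position v = x}.ncard

/-- The Fourier transform `∑ x, exp (i u·x) X_x(t)`. -/
def processHat (D : Driving Φ P) (u : EuclideanSpace ℝ (Fin d)) (t : ℝ≥0) (ω : Ω) : ℂ :=
  ∑' x : Site d, character u x * (D.process t ω x : ℂ)

/-- `M_u(t) = exp (-μ̂(u) t) X̂_u(t)`. -/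
def fourierMartingale (D : Driving Φ P) (u : EuclideanSpace ℝ (Fin d)) (t : ℝ≥0) (ω : Ω) : ℂ :=
  Complex.exp (-(intensityHat Φ u) * ((t : ℝ) : ℂ)) * D.processHat u t ω

theorem measurable_birth (D : Driving Φ P) (v : Ball d) : Measurable (D.birth v) := by
  induction v with
  | nil => exact measurable_const
  | cons a v ih =>
    obtain ⟨k, y, m⟩ := a
    exact ih.add (Finset.measurable_sum _ fun j _ => D.measurable_gap v j)

theorem measurableSet_isBorn (D : Driving Φ P) (v : Ball d) :
    MeasurableSet {ω | D.IsBorn v ω} := by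
  induction v with
  | nil => exact MeasurableSet.univ
  | cons a v ih =>
    obtain ⟨k, y, m⟩ := a
    exact ih.inter (D.measurable_offspring v k (t := {φ | m < φ y}) trivial)

theorem measurable_process (D : Driving Φ P) (t : ℝ≥0) : Measurable (D.process t) := by
  refine measurable_pi_lambda _ fun x => ?_
  have hS : ∀ v : Ball d, MeasurableSet {ω | v ∈ D.population t ω ∧ position v = x} := by
    intro v
    exact ((D.measurableSet_isBorn v).inter
      (measurableSet_le (D.measurable_birth v) measurable_const)).inter (MeasurableSet.const _)
  have hT : ∀ F : Finset (Ball d),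
      MeasurableSet {ω | {v ∈ D.population t ω | position v = x} = (F : Set (Ball d))} := by
    intro F
    have : {ω | {v ∈ D.population t ω | position v = x} = (F : Set (Ball d))} =
        ⋂ v : Ball d, {ω | (v ∈ D.population t ω ∧ position v = x) ↔ v ∈ F} := by
      ext ω
      simp [Set.ext_iff]
    rw [this]
    refine MeasurableSet.iInter fun v => ?_
    by_cases hv : v ∈ F
    · simpa [hv] using hS v
    · simp only [hv, iff_false]
      exact (hS v).compl
  have hN : ∀ n : ℕ, n ≠ 0 → MeasurableSet {ω | D.process t ω x = n} := by
    intro n hn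
    have : {ω | D.process t ω x = n} = ⋃ F : Finset (Ball d), ⋃ _ : F.card = n,
        {ω | {v ∈ D.population t ω | position v = x} = (F : Set (Ball d))} := by
      ext ω
      simp only [Set.mem_ofPred_eq, Set.mem_iUnion, process]
      constructor
      · intro h
        have hf := Set.finite_of_ncard_ne_zero (h.trans_ne hn)
        exact ⟨hf.toFinset, by rw [← h, Set.ncard_eq_toFinset_card _ hf], by simp⟩
      · rintro ⟨F, hF, h⟩
        rw [h, Set.ncard_coe_finset, hF]
    rw [this]
    exact MeasurableSet.iUnion fun F => MeasurableSet.iUnion fun _ => hT F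
  refine measurable_to_countable' fun n => ?_
  rcases eq_or_ne n 0 with rfl | hn
  · have : (fun ω => D.process t ω x) ⁻¹' {0} =
        (⋃ n : ℕ, ⋃ _ : n ≠ 0, {ω | D.process t ω x = n})ᶜ := by
      ext ω
      simp only [Set.mem_preimage, Set.mem_singleton_iff, Set.mem_compl_iff, Set.mem_iUnion,
        Set.mem_ofPred_eq, not_exists]
      exact ⟨fun h i hi h' => hi (h'.symm.trans h), fun h => by_contra fun h' => h _ h' rfl⟩
    rw [this]
    exact (MeasurableSet.iUnion fun n => MeasurableSet.iUnion fun hn => hN n hn).compl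
  · exact hN n hn

/-- The filtration generated by the process `X`. -/
def filtration (D : Driving Φ P) : Filtration ℝ≥0 (inferInstance : MeasurableSpace Ω) :=
  Filtration.natural D.process fun t => (D.measurable_process t).stronglyMeasurable

end Driving

end BranchingWalk

end

noncomputable section

/-! The process is a function of independent marks, one pair (waiting time, draw) for each ring `(v,
k)`, so all expectations can be computed on the product space `Sample d` and pulled back to any
realisation.

The increment of `M_u` over `(s, t]` is a sum over rings of compensated increments
(`hasSum_ringIncrement_fourierKernel`). A ring of a ball at `z` occurring at time `r` in `(s, t]`
makes `M_u` jump by `exp (i u·z) exp (-μ̂(u) r)` times the Fourier transform of its draw. From this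
one subtracts the mean jump rate integrated over the part of `(s, t]` between the preceding ring and
this one. Along one clock these compensators telescope, and they account exactly for the damping of
the ball's own term in `M_u`.

Resampling the single mark `(v, k)` changes neither the birth of `v` nor its earlier rings, and it
gives the increment of that ring mean zero (`integral_increment`). Of two distinct rings, one always
has an increment that ignores the mark of the other, so the increments are pairwise orthogonal. An
event of the past up to `s` can feel the mark only if the ring has already occurred by time `s`, and
then the increment over `(s, t]` vanishes. Hence `M_u` is a martingale
(`setIntegral_ringIncrement`). Its mean square increment is at most the energy `∑ v, ∫ E|jump|² P(v
present at r) dr` (`lintegral_enorm_sq_le_energy`).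

With `ρ = Re μ̂(u)` and `δ = 2ρ - λ`, the squared jump has mean at most `exp (-2ρr) E‖φ‖²`, and the
expected number of balls is at most `exp (λr)`. The energy after `s` is therefore at most `E‖φ‖² exp
(-δs) / δ`. For the comparison with `M_0`, both martingales start at `1`, and their difference is
again a sum of compensated increments. Its jumps are of order `|u|` times the distance travelled, up
to factors in time, so the balls are counted with a quadratic weight in the length of their
ancestral path (`tsum_weight_presence_le`).

Almost sure convergence in continuous time follows from Doob's maximal inequality on dyadic grids
together with right continuity of the paths; Fatou's lemma carries the mean square bound to the
limit. -/

/-! ### Resampling one coordinate of a product measure -/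

theorem MeasureTheory.Measure.measurePreserving_update_infinitePi {ι : Type*} [DecidableEq ι]
    {X : ι → Type*} [∀ i, MeasurableSpace (X i)] (μ : ∀ i, Measure (X i))
    [∀ i, IsProbabilityMeasure (μ i)] (i : ι) :
    MeasurePreserving (fun p : (∀ j, X j) × X i => Function.update p.1 i p.2)
      ((Measure.infinitePi μ).prod (μ i)) (Measure.infinitePi μ) := by
  have hm : Measurable (fun p : (∀ j, X j) × X i => Function.update p.1 i p.2) := by
    refine measurable_pi_lambda _ fun j => ?_
    rcases eq_or_ne j i with rfl | h
    · simpa using measurable_snd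
    · simpa [Function.update_of_ne h, Function.comp_def] using
        (measurable_pi_apply j).comp (measurable_fst (α := ∀ j, X j) (β := X i))
  refine ⟨hm, Measure.eq_infinitePi _ fun s t ht => ?_⟩
  rw [Measure.map_apply hm (.pi s.countable_toSet fun j _ => ht j)]
  by_cases hi : i ∈ s
  · have : (fun p : (∀ j, X j) × X i => Function.update p.1 i p.2) ⁻¹' (Set.pi s t) =
        (Set.pi (s.erase i) t) ×ˢ t i := by
      ext ⟨x, y⟩
      simp only [Set.mem_preimage, Set.mem_pi, Finset.mem_coe, Set.mem_prod, Finset.mem_erase]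
      constructor
      · intro h
        exact ⟨fun j hj => by simpa [Function.update_of_ne hj.1] using h j hj.2,
          by simpa using h i hi⟩
      · rintro ⟨h1, h2⟩ j hj
        rcases eq_or_ne j i with rfl | hne
        · simpa using h2
        · simpa [Function.update_of_ne hne] using h1 j ⟨hne, hj⟩
    rw [this, Measure.prod_prod, Measure.infinitePi_pi _ (fun j _ => ht j), mul_comm,
      Finset.mul_prod_erase s (fun j => μ j (t j)) hi]
  · have : (fun p : (∀ j, X j) × X i => Function.update p.1 i p.2) ⁻¹' (Set.pi s t) =
        (Set.pi s t) ×ˢ Set.univ := by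
      ext ⟨x, y⟩
      simp only [Set.mem_preimage, Set.mem_pi, Finset.mem_coe, Set.mem_prod, Set.mem_univ, and_true]
      refine forall₂_congr fun j hj => ?_
      rw [Function.update_of_ne (fun h : j = i => hi (h ▸ hj))]
    rw [this, Measure.prod_prod, Measure.infinitePi_pi _ (fun j _ => ht j), measure_univ, mul_one]

/-! ### The exponential law of rate one -/

instance : IsProbabilityMeasure (expMeasure 1) := isProbabilityMeasure_expMeasure one_pos

theorem lintegral_expMeasure_one {f : ℝ → ℝ≥0∞} (hf : Measurable f) :
    ∫⁻ e, f e ∂expMeasure 1 = ∫⁻ e in Set.Ici 0, ENNReal.ofReal (Real.exp (-e)) * f e := by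
  have h : expMeasure 1 = volume.withDensity (exponentialPDF 1) := rfl
  have hp : Measurable (exponentialPDF 1) := (measurable_exponentialPDFReal 1).ennreal_ofReal
  rw [h, lintegral_withDensity_eq_lintegral_mul _ hp hf, ← lintegral_indicator measurableSet_Ici]
  refine lintegral_congr fun e => ?_
  by_cases he : 0 ≤ e
  · simp [he, exponentialPDF_of_nonneg he]
  · simp [he, exponentialPDF_of_neg (not_le.1 he)]

theorem integral_expMeasure_one {F : Type*} [NormedAddCommGroup F] [NormedSpace ℝ F]
    (f : ℝ → F) :
    ∫ e, f e ∂expMeasure 1 = ∫ e in Set.Ioi 0, Real.exp (-e) • f e := by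
  have h : expMeasure 1 = volume.withDensity (exponentialPDF 1) := rfl
  have hp : Measurable (exponentialPDF 1) := (measurable_exponentialPDFReal 1).ennreal_ofReal
  rw [h, integral_withDensity_eq_integral_toReal_smul hp (by simp [exponentialPDF]),
    ← integral_Ici_eq_integral_Ioi, ← integral_indicator measurableSet_Ici]
  refine integral_congr_ae (.of_forall fun e => ?_)
  by_cases he : 0 ≤ e
  · simp [he, exponentialPDF_of_nonneg he, ENNReal.toReal_ofReal (Real.exp_nonneg _)]
  · simp [he, exponentialPDF_of_neg (not_le.1 he)]

theorem ae_pos_expMeasure_one : ∀ᵐ e ∂expMeasure 1, 0 < e := by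
  have h : expMeasure 1 (Set.Iic 0) = 0 := by
    rw [← lintegral_indicator_one measurableSet_Iic,
      lintegral_expMeasure_one (measurable_one.indicator measurableSet_Iic)]
    rw [← Measure.restrict_congr_set Ioi_ae_eq_Ici]
    refine (setLIntegral_congr_fun measurableSet_Ioi fun e he => ?_).trans lintegral_zero
    simp [not_le.2 (Set.mem_Ioi.1 he)]
  filter_upwards [measure_eq_zero_iff_ae_notMem.1 h] with e he
  simpa using he

theorem expMeasure_one_Ioi {c : ℝ} (hc : 0 ≤ c) :
    expMeasure 1 (Set.Ioi c) = ENNReal.ofReal (Real.exp (-c)) := by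
  rw [← lintegral_indicator_one measurableSet_Ioi,
    lintegral_expMeasure_one (measurable_one.indicator measurableSet_Ioi)]
  have h2 : ∀ e : ℝ, ENNReal.ofReal (Real.exp (-e)) * (Set.Ioi c).indicator 1 e =
      (Set.Ioi c).indicator (fun e => ENNReal.ofReal (Real.exp (-e))) e := by
    intro e; by_cases h : c < e <;> simp [h]
  simp_rw [h2]
  rw [lintegral_indicator measurableSet_Ioi, Measure.restrict_restrict measurableSet_Ioi,
    Set.inter_eq_left.2 (show Set.Ioi c ⊆ Set.Ici 0 from
      fun e he => hc.trans (le_of_lt (Set.mem_Ioi.1 he))),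
    ← ofReal_integral_eq_lintegral_ofReal (integrableOn_exp_neg_Ioi c)
      (.of_forall fun _ => (Real.exp_nonneg _)), integral_exp_neg_Ioi]

/-- A point starting at `a` and jumping at rate one is at `r` with intensity one as long as it has
not jumped. -/
theorem lintegral_add_expMeasure_one {f : ℝ → ℝ≥0∞} (hf : Measurable f) (a : ℝ) :
    ∫⁻ e, f (a + e) ∂expMeasure 1 =
      ∫⁻ r, f r * expMeasure 1 {e | a ≤ r ∧ r < a + e} := by
  rw [lintegral_expMeasure_one (f := fun e => f (a + e)) (hf.comp (measurable_const_add a)),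
    ← lintegral_indicator measurableSet_Ici,
    ← lintegral_add_left_eq_self
      (fun r => f r * expMeasure 1 {e | a ≤ r ∧ r < a + e}) a]
  refine lintegral_congr fun e => ?_
  by_cases he : 0 ≤ e
  · have : {e' : ℝ | a ≤ a + e ∧ a + e < a + e'} = Set.Ioi e := by
      ext; simp [he]
    rw [this, expMeasure_one_Ioi he, Set.indicator_of_mem (Set.mem_Ici.2 he), mul_comm]
  · simp [he]

/-! ### The canonical sample space -/

namespace BranchingWalk

variable {d : ℕ}

/-- The values of all waiting times and all draws. -/
abbrev Sample (d : ℕ) : Type := Ball d × ℕ → ℝ × Config d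

/-- The joint law of a waiting time and a draw. -/
def markLaw (Φ : Measure (Config d)) : Measure (ℝ × Config d) := (expMeasure 1).prod Φ

instance (Φ : Measure (Config d)) [IsProbabilityMeasure Φ] : IsProbabilityMeasure (markLaw Φ) := by
  unfold markLaw; infer_instance

/-- The joint law of all waiting times and all draws. -/
def sampleLaw (Φ : Measure (Config d)) [IsProbabilityMeasure Φ] : Measure (Sample d) :=
  Measure.infinitePi fun _ => markLaw Φ

instance (Φ : Measure (Config d)) [IsProbabilityMeasure Φ] :
    IsProbabilityMeasure (sampleLaw Φ) := by
  unfold sampleLaw; infer_instance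

/-- The randomness on the canonical sample space. -/
def canonical (Φ : Measure (Config d)) [IsProbabilityMeasure Φ] : Driving Φ (sampleLaw Φ) where
  gap v k x := (x (v, k)).1
  offspring v k x := (x (v, k)).2
  measurable_gap _ _ := measurable_fst.comp (measurable_pi_apply _)
  measurable_offspring _ _ := measurable_snd.comp (measurable_pi_apply _)
  law v k := Measure.infinitePi_map_eval (fun _ => markLaw Φ) (v, k)
  indep := iIndepFun_infinitePi (P := fun _ : Ball d × ℕ => markLaw Φ)
    (X := fun _ p => p) (fun _ => measurable_id)

theorem ae_pos_markLaw (Φ : Measure (Config d)) : ∀ᵐ y ∂markLaw Φ, 0 < y.1 :=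
  Measure.quasiMeasurePreserving_fst.ae (μb := expMeasure 1) ae_pos_expMeasure_one

variable (Φ : Measure (Config d)) [IsProbabilityMeasure Φ]

theorem measurePreserving_update (i : Ball d × ℕ) :
    MeasurePreserving (fun p : Sample d × (ℝ × Config d) => Function.update p.1 i p.2)
      ((sampleLaw Φ).prod (markLaw Φ)) (sampleLaw Φ) :=
  Measure.measurePreserving_update_infinitePi (fun _ => markLaw Φ) i

/-- Resampling one waiting time and draw does not change an expectation. -/
theorem lintegral_resample (i : Ball d × ℕ) {F : Sample d → ℝ≥0∞} (hF : Measurable F) :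
    ∫⁻ x, F x ∂sampleLaw Φ =
      ∫⁻ x, ∫⁻ y, F (Function.update x i y) ∂markLaw Φ ∂sampleLaw Φ := by
  have h := measurePreserving_update Φ i
  rw [← h.lintegral_comp hF]
  exact lintegral_prod _ (hF.comp h.measurable).aemeasurable

theorem integral_resample {E : Type*} [NormedAddCommGroup E] [NormedSpace ℝ E]
    (i : Ball d × ℕ) {F : Sample d → E} (hF : Integrable F (sampleLaw Φ)) :
    ∫ x, F x ∂sampleLaw Φ =
      ∫ x, ∫ y, F (Function.update x i y) ∂markLaw Φ ∂sampleLaw Φ := by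
  have h := measurePreserving_update Φ i
  have hF' : AEStronglyMeasurable F (Measure.map
      (fun p : Sample d × (ℝ × Config d) => Function.update p.1 i p.2)
      ((sampleLaw Φ).prod (markLaw Φ))) := by rw [h.map_eq]; exact hF.aestronglyMeasurable
  conv_lhs => rw [← h.map_eq]
  rw [integral_map h.measurable.aemeasurable hF', integral_prod]
  exact h.integrable_comp_of_integrable hF

/-- All waiting times are positive. -/
def PosGaps (x : Sample d) : Prop := ∀ i, 0 < (x i).1

theorem ae_posGaps : ∀ᵐ x ∂sampleLaw Φ, PosGaps x := by
  refine ae_all_iff.2 fun i => ?_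
  exact (measurePreserving_eval_infinitePi (fun _ => markLaw Φ) i).quasiMeasurePreserving.ae
    (ae_pos_markLaw Φ)

theorem PosGaps.update {x : Sample d} (hx : PosGaps x) (i : Ball d × ℕ) {y : ℝ × Config d}
    (hy : 0 < y.1) : PosGaps (Function.update x i y) := by
  intro j
  rcases eq_or_ne j i with rfl | h
  · simpa using hy
  · simpa [Function.update_of_ne h] using hx j

end BranchingWalk

/-! ### Dependence of births, rings and configurations on single marks -/

namespace BranchingWalk

variable {d : ℕ}

namespace Driving

variable {Φ : Measure (Config d)} {Ω : Type*} [MeasurableSpace Ω] {P : Measure Ω}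

/-- The time of the `k`-th ring of the clock of the ball `v`, the birth being the ring zero. -/
def ringTime (D : Driving Φ P) (v : Ball d) (k : ℕ) (ω : Ω) : ℝ :=
  D.birth v ω + ∑ j ∈ Finset.range k, D.gap v j ω

theorem ringTime_zero (D : Driving Φ P) (v : Ball d) (ω : Ω) : D.ringTime v 0 ω = D.birth v ω := by
  simp [ringTime]

theorem ringTime_succ (D : Driving Φ P) (v : Ball d) (k : ℕ) (ω : Ω) :
    D.ringTime v (k + 1) ω = D.ringTime v k ω + D.gap v k ω := by
  simp [ringTime, Finset.sum_range_succ, add_assoc]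

theorem birth_cons (D : Driving Φ P) (k : ℕ) (y : Site d) (m : ℕ) (v : Ball d) (ω : Ω) :
    D.birth ((k, y, m) :: v) ω = D.ringTime v (k + 1) ω := rfl

theorem isBorn_cons (D : Driving Φ P) (k : ℕ) (y : Site d) (m : ℕ) (v : Ball d) (ω : Ω) :
    D.IsBorn ((k, y, m) :: v) ω ↔ D.IsBorn v ω ∧ m < D.offspring v k ω y := Iff.rfl

theorem measurable_ringTime (D : Driving Φ P) (v : Ball d) (k : ℕ) :
    Measurable (D.ringTime v k) :=
  (D.measurable_birth v).add (Finset.measurable_fun_sum _ fun j _ => D.measurable_gap v j)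

end Driving

variable (Φ : Measure (Config d)) [IsProbabilityMeasure Φ]

theorem canonical_gap (v : Ball d) (k : ℕ) (x : Sample d) :
    (canonical Φ).gap v k x = (x (v, k)).1 := rfl

theorem canonical_offspring (v : Ball d) (k : ℕ) (x : Sample d) :
    (canonical Φ).offspring v k x = (x (v, k)).2 := rfl

/-- Only the clocks of strict ancestors matter, and these have strictly shorter labels. Thus the
length of the label orders the dependence between marks. -/
theorem birth_congr {x x' : Sample d} {v : Ball d}
    (h : ∀ w l, w.length < v.length → x (w, l) = x' (w, l)) :
    (canonical Φ).birth v x = (canonical Φ).birth v x' := by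
  induction v with
  | nil => rfl
  | cons a v ih =>
    obtain ⟨k, y, m⟩ := a
    simp only [Driving.birth_cons, Driving.ringTime, canonical_gap]
    rw [ih fun w l hw => h w l (hw.trans (by simp))]
    simp_rw [h v _ (by simp)]

theorem isBorn_congr {x x' : Sample d} {v : Ball d}
    (h : ∀ w l, w.length < v.length → x (w, l) = x' (w, l)) :
    (canonical Φ).IsBorn v x ↔ (canonical Φ).IsBorn v x' := by
  induction v with
  | nil => rfl
  | cons a v ih =>
    obtain ⟨k, y, m⟩ := a
    simp only [Driving.isBorn_cons, canonical_offspring]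
    rw [ih fun w l hw => h w l (hw.trans (by simp)), h v _ (by simp)]

theorem birth_update {v w : Ball d} (h : v.length ≤ w.length) (x : Sample d) (l : ℕ)
    (y : ℝ × Config d) :
    (canonical Φ).birth v (Function.update x (w, l) y) = (canonical Φ).birth v x := by
  refine birth_congr Φ fun w' l' h' => Function.update_of_ne ?_ _ _
  rintro ⟨⟩
  omega

theorem isBorn_update {v w : Ball d} (h : v.length ≤ w.length) (x : Sample d) (l : ℕ)
    (y : ℝ × Config d) :
    (canonical Φ).IsBorn v (Function.update x (w, l) y) ↔ (canonical Φ).IsBorn v x := by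
  refine isBorn_congr Φ fun w' l' h' => Function.update_of_ne ?_ _ _
  rintro ⟨⟩
  omega

/-- `ringTime v k` uses the gaps `0, …, k - 1` of the clock of `v`, hence the condition `k ≤ l`
rather than `k < l`: the mark `(v, k)` first enters at `ringTime v (k + 1)`. -/
theorem ringTime_update {v w : Ball d} {k l : ℕ} (h : v.length ≤ w.length)
    (h' : v = w → k ≤ l) (x : Sample d) (y : ℝ × Config d) :
    (canonical Φ).ringTime v k (Function.update x (w, l) y) = (canonical Φ).ringTime v k x := by
  simp only [Driving.ringTime, canonical_gap, birth_update Φ h]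
  congr 1
  refine Finset.sum_congr rfl fun j hj => ?_
  rw [Function.update_of_ne]
  rintro ⟨⟩
  exact absurd (h' rfl) (not_le.2 (Finset.mem_range.1 hj))

theorem ringTime_succ_update (v : Ball d) (k : ℕ) (x : Sample d) (y : ℝ × Config d) :
    (canonical Φ).ringTime v (k + 1) (Function.update x (v, k) y) =
      (canonical Φ).ringTime v k x + y.1 := by
  rw [Driving.ringTime_succ, ringTime_update Φ le_rfl fun _ => le_rfl, canonical_gap,
    Function.update_self]

variable {Φ}

namespace PosGaps

variable {x : Sample d}

theorem ringTime_strictMono (hx : PosGaps x) (v : Ball d) :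
    StrictMono fun k => (canonical Φ).ringTime v k x :=
  strictMono_nat_of_lt_succ fun k => by
    rw [Driving.ringTime_succ]
    exact lt_add_of_pos_right _ (hx (v, k))

theorem birth_le_ringTime (hx : PosGaps x) (v : Ball d) (k : ℕ) :
    (canonical Φ).birth v x ≤ (canonical Φ).ringTime v k x := by
  rw [← Driving.ringTime_zero]
  exact (hx.ringTime_strictMono v).monotone (Nat.zero_le k)

theorem birth_nonneg (hx : PosGaps x) (v : Ball d) : 0 ≤ (canonical Φ).birth v x := by
  induction v with
  | nil => exact le_rfl
  | cons a v ih => exact ih.trans (hx.birth_le_ringTime v _)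

theorem ringTime_nonneg (hx : PosGaps x) (v : Ball d) (k : ℕ) :
    0 ≤ (canonical Φ).ringTime v k x :=
  (hx.birth_nonneg v).trans (hx.birth_le_ringTime v k)

theorem birth_cons_pos (hx : PosGaps x) (a : ℕ × Site d × ℕ) (v : Ball d) :
    0 < (canonical Φ).birth (a :: v) x :=
  (hx.ringTime_nonneg v a.1).trans_lt (hx.ringTime_strictMono v (Nat.lt_succ_self _))

end PosGaps

/-- A ball present before the ring attached to `(v, k)` occurs cannot descend from that ring or from
a later ring of `v`. Its ancestral line therefore never reads the mark that differs. -/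
theorem mem_population_of_agree {x x' : Sample d} (hx : PosGaps x) {v : Ball d} {k : ℕ}
    (h : ∀ j, j ≠ (v, k) → x j = x' j) {r : ℝ}
    (hr : r < (canonical Φ).ringTime v (k + 1) x) (w : Ball d)
    (hw : (canonical Φ).IsBorn w x ∧ (canonical Φ).birth w x ≤ r) :
    (canonical Φ).IsBorn w x' ∧ (canonical Φ).birth w x' = (canonical Φ).birth w x := by
  induction w with
  | nil => exact ⟨trivial, rfl⟩
  | cons a w ih =>
    obtain ⟨l, y, m⟩ := a
    obtain ⟨⟨hb, ho⟩, ht⟩ := hw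
    rw [Driving.birth_cons] at ht
    have ih' := ih ⟨hb, (hx.birth_le_ringTime w _).trans ht⟩
    have hlt : w = v → l < k := fun hwv => by
      subst hwv
      by_contra hl
      exact absurd (hr.trans_le ((hx.ringTime_strictMono w).monotone
        (Nat.succ_le_succ (not_lt.1 hl)))) (not_lt.2 ht)
    have hne : ∀ j, j ≤ l → (w, j) ≠ (v, k) := by
      rintro j hj ⟨⟩
      exact absurd (hlt rfl) (not_lt.2 hj)
    refine ⟨⟨ih'.1, ?_⟩, ?_⟩
    · change m < (x' (w, l)).2 y
      rw [← h _ (hne l le_rfl)]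
      exact ho
    · rw [Driving.birth_cons, Driving.birth_cons, Driving.ringTime, Driving.ringTime, ih'.2]
      congr 1
      refine Finset.sum_congr rfl fun j hj => ?_
      rw [canonical_gap, canonical_gap, h _ (hne j (by simpa [Nat.lt_succ_iff] using hj))]

/-- The configuration at a time before a ring does not depend on the waiting time and the draw
attached to that ring. -/
theorem process_eq_of_agree {x x' : Sample d} (hx : PosGaps x) (hx' : PosGaps x') {v : Ball d}
    {k : ℕ} (h : ∀ j, j ≠ (v, k) → x j = x' j) {r : ℝ≥0}
    (hr : r < (canonical Φ).ringTime v (k + 1) x) (hr' : r < (canonical Φ).ringTime v (k + 1) x') :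
    (canonical Φ).process r x = (canonical Φ).process r x' := by
  have : (canonical Φ).population r x = (canonical Φ).population r x' := by
    ext w
    constructor
    · intro hw
      have := mem_population_of_agree hx h hr w hw
      exact ⟨this.1, this.2.trans_le hw.2⟩
    · intro hw
      have := mem_population_of_agree hx' (fun j hj => (h j hj).symm) hr' w hw
      exact ⟨this.1, this.2.trans_le hw.2⟩
  ext y
  simp only [Driving.process, this]

end BranchingWalk

/-- A list is empty or has a head and a tail. -/
def List.equivSumProd (α : Type*) : Unit ⊕ (List α × α) ≃ List α where
  toFun
    | .inl _ => []
    | .inr (l, a) => a :: l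
  invFun
    | [] => .inl ()
    | a :: l => .inr (l, a)
  left_inv o := by rcases o with _ | ⟨l, a⟩ <;> rfl
  right_inv l := by cases l <;> rfl

theorem tsum_list {α M : Type*} [AddCommMonoid M] [TopologicalSpace M] [ContinuousAdd M]
    [T2Space M] (f : List α → M) (hf : Summable fun p : List α × α => f (p.2 :: p.1)) :
    ∑' l, f l = f [] + ∑' p : List α × α, f (p.2 :: p.1) := by
  rw [← (List.equivSumProd α).tsum_eq f, Summable.tsum_sum _ hf, tsum_fintype]
  · simp [List.equivSumProd]
  · exact (hasSum_fintype _).summable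

theorem ENNReal.tsum_ite_lt (n : ℕ) (c : ℝ≥0∞) : ∑' m : ℕ, (if m < n then c else 0) = n * c := by
  rw [tsum_eq_sum (s := Finset.range n) (fun m hm => if_neg (by simpa using hm)),
    Finset.sum_congr rfl (fun m hm => if_pos (Finset.mem_range.1 hm))]
  simp

theorem expMeasure_one_survival (a r : ℝ) :
    expMeasure 1 {e | a ≤ r ∧ r < a + e} = if a ≤ r then ENNReal.ofReal (Real.exp (a - r)) else 0 := by
  split_ifs with h
  · have : {e | a ≤ r ∧ r < a + e} = Set.Ioi (r - a) := by
      ext e; simp [h, sub_lt_iff_lt_add']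
    rw [this, expMeasure_one_Ioi (sub_nonneg.2 h), neg_sub]
  · simp [h]

theorem lintegral_exp_Iic_le {Λ : ℝ} (hΛ : 0 ≤ Λ) {t : ℝ} (ht : 0 ≤ t) :
    ∫⁻ r in Set.Icc 0 t, ENNReal.ofReal Λ * ENNReal.ofReal (Real.exp (Λ * r)) =
      ENNReal.ofReal (Real.exp (Λ * t) - 1) := by
  simp_rw [← ENNReal.ofReal_mul hΛ]
  have hc : Continuous fun r => Λ * Real.exp (Λ * r) := by fun_prop
  rw [← ofReal_integral_eq_lintegral_ofReal hc.continuousOn.integrableOn_Icc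
    (.of_forall fun r => by positivity), integral_Icc_eq_integral_Ioc,
    ← intervalIntegral.integral_of_le ht,
    intervalIntegral.integral_eq_sub_of_hasDerivAt (f := fun r => Real.exp (Λ * r))]
  · simp
  · intro r _
    simpa [mul_comm] using ((hasDerivAt_id r).const_mul Λ).exp
  · exact hc.intervalIntegrable _ _

/-! ### Expected sums over the balls present at a given time -/

namespace BranchingWalk

variable {d : ℕ}

variable (Φ : Measure (Config d)) [IsProbabilityMeasure Φ]

theorem measurableSet_isBorn (v : Ball d) : MeasurableSet {x | (canonical Φ).IsBorn v x} :=
  (canonical Φ).measurableSet_isBorn v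

theorem measurable_apply_snd (i : Ball d × ℕ) : Measurable fun x : Sample d => (x i).2 :=
  measurable_snd.comp (measurable_pi_apply _)

theorem measurable_ring_mark (v : Ball d) (k : ℕ) :
    Measurable fun x : Sample d => ((canonical Φ).ringTime v (k + 1) x, (x (v, k)).2) :=
  ((canonical Φ).measurable_ringTime v _).prodMk (measurable_apply_snd _)

/-- The birth of `v` and its ring time `k` ignore the mark `(v, k)`, which can thus be integrated
out as a fresh waiting time and draw. The first argument of `f` keeps the preceding ring time
available. -/
theorem setLIntegral_resample (v : Ball d) (k : ℕ) {f : ℝ → ℝ × Config d → ℝ≥0∞}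
    (hf : Measurable (Function.uncurry f)) :
    ∫⁻ x in {x | (canonical Φ).IsBorn v x},
        f ((canonical Φ).ringTime v k x) ((canonical Φ).ringTime v (k + 1) x, (x (v, k)).2)
          ∂sampleLaw Φ =
      ∫⁻ x in {x | (canonical Φ).IsBorn v x}, ∫⁻ e, ∫⁻ φ, f ((canonical Φ).ringTime v k x)
        ((canonical Φ).ringTime v k x + e, φ) ∂Φ ∂expMeasure 1 ∂sampleLaw Φ := by
  have hb := measurableSet_isBorn Φ v
  rw [← lintegral_indicator hb, ← lintegral_indicator hb, lintegral_resample Φ (v, k)]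
  · refine lintegral_congr fun x => ?_
    by_cases hx : (canonical Φ).IsBorn v x
    · rw [Set.indicator_of_mem (s := {x | (canonical Φ).IsBorn v x}) hx]
      have : ∀ y : ℝ × Config d,
          (canonical Φ).IsBorn v (Function.update x (v, k) y) :=
        fun y => (isBorn_update Φ le_rfl x k y).2 hx
      simp_rw [Set.indicator_of_mem (show _ ∈ {x | (canonical Φ).IsBorn v x} from this _),
        ringTime_succ_update, ringTime_update Φ le_rfl (fun _ => le_rfl), Function.update_self]
      rw [markLaw, lintegral_prod]
      exact (hf.comp (measurable_const.prodMk
        ((measurable_const.add measurable_fst).prodMk measurable_snd))).aemeasurable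
    · rw [Set.indicator_of_notMem (s := {x | (canonical Φ).IsBorn v x}) hx]
      refine (lintegral_congr fun y => ?_).trans lintegral_zero
      exact Set.indicator_of_notMem (fun h => hx ((isBorn_update Φ le_rfl x k y).1 h)) _
  · exact (hf.comp (((canonical Φ).measurable_ringTime v k).prodMk
      (measurable_ring_mark Φ v k))).indicator hb

/-- The compensator of the rings of the clock of a ball. -/
theorem setLIntegral_ring (v : Ball d) (k : ℕ) {f : ℝ × Config d → ℝ≥0∞} (hf : Measurable f) :
    ∫⁻ x in {x | (canonical Φ).IsBorn v x},
        f ((canonical Φ).ringTime v (k + 1) x, (x (v, k)).2) ∂sampleLaw Φ =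
      ∫⁻ r, (∫⁻ φ, f (r, φ) ∂Φ) * sampleLaw Φ {x | (canonical Φ).IsBorn v x ∧
        (canonical Φ).ringTime v k x ≤ r ∧ r < (canonical Φ).ringTime v (k + 1) x} := by
  have hb := measurableSet_isBorn Φ v
  have hT := fun k => (canonical Φ).measurable_ringTime v k
  have hg : Measurable fun r => ∫⁻ φ, f (r, φ) ∂Φ := hf.lintegral_prod_right'
  -- The same resampling identity, applied to the indicator that `r` lies between the two rings,
  -- turns this probability into an average of survival probabilities of one waiting time.
  have hsurv : ∀ r, sampleLaw Φ {x | (canonical Φ).IsBorn v x ∧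
        (canonical Φ).ringTime v k x ≤ r ∧ r < (canonical Φ).ringTime v (k + 1) x} =
      ∫⁻ x in {x | (canonical Φ).IsBorn v x},
        expMeasure 1 {e | (canonical Φ).ringTime v k x ≤ r ∧ r < (canonical Φ).ringTime v k x + e}
        ∂sampleLaw Φ := by
    intro r
    have h := setLIntegral_resample Φ v k
      (f := fun a p => {q : ℝ × ℝ | q.1 ≤ r ∧ r < q.2}.indicator 1 (a, p.1)) ?_
    · have hA : MeasurableSet {x | (canonical Φ).ringTime v k x ≤ r ∧
          r < (canonical Φ).ringTime v (k + 1) x} :=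
        (measurableSet_le (hT k) measurable_const).inter
          (measurableSet_lt measurable_const (hT (k + 1)))
      rw [Set.ofPred_and, Set.inter_comm, ← Measure.restrict_apply hA,
        ← lintegral_indicator_one hA]
      refine h.trans (lintegral_congr fun x => ?_)
      simp only [lintegral_const, measure_univ, mul_one]
      have hE : MeasurableSet {e : ℝ | (canonical Φ).ringTime v k x ≤ r ∧
          r < (canonical Φ).ringTime v k x + e} :=
        (MeasurableSet.const _).inter (measurableSet_lt measurable_const (measurable_const_add _))
      exact lintegral_indicator_one hE
    · have : MeasurableSet {q : ℝ × ℝ | q.1 ≤ r ∧ r < q.2} :=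
        (measurableSet_le measurable_fst measurable_const).inter
          (measurableSet_lt measurable_const measurable_snd)
      exact (measurable_one.indicator this).comp
        (measurable_fst.prodMk (measurable_fst.comp measurable_snd))
  simp_rw [hsurv]
  rw [setLIntegral_resample Φ v k (f := fun _ p => f p) (hf.comp measurable_snd)]
  have h1 : ∀ x, ∫⁻ e, ∫⁻ φ, f ((canonical Φ).ringTime v k x + e, φ) ∂Φ ∂expMeasure 1 =
      ∫⁻ r, (∫⁻ φ, f (r, φ) ∂Φ) * expMeasure 1
        {e | (canonical Φ).ringTime v k x ≤ r ∧ r < (canonical Φ).ringTime v k x + e} :=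
    fun x => lintegral_add_expMeasure_one hg _
  simp_rw [h1, expMeasure_one_survival]
  have hm : Measurable fun p : Sample d × ℝ => if (canonical Φ).ringTime v k p.1 ≤ p.2 then
      ENNReal.ofReal (Real.exp ((canonical Φ).ringTime v k p.1 - p.2)) else 0 := by
    refine Measurable.ite (measurableSet_le ((hT k).comp measurable_fst) measurable_snd) ?_
      measurable_const
    exact (Real.measurable_exp.comp (((hT k).comp measurable_fst).sub measurable_snd)).ennreal_ofReal
  rw [lintegral_lintegral_swap]
  · refine lintegral_congr fun r => ?_
    rw [lintegral_const_mul]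
    exact hm.comp (measurable_id.prodMk measurable_const)
  · exact ((hg.comp measurable_snd).mul hm).aemeasurable

/-- The probability that a ball is present at a given time. -/
def presence (v : Ball d) (t : ℝ) : ℝ≥0∞ :=
  sampleLaw Φ {x | (canonical Φ).IsBorn v x ∧ (canonical Φ).birth v x ≤ t}

theorem presence_mono (v : Ball d) : Monotone (presence Φ v) := fun _ _ hst =>
  measure_mono fun _ hx => ⟨hx.1, hx.2.trans hst⟩

theorem measurable_presence (v : Ball d) : Measurable (presence Φ v) := (presence_mono Φ v).measurable

theorem presence_of_neg (v : Ball d) {t : ℝ} (ht : t < 0) : presence Φ v t = 0 := by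
  refine measure_eq_zero_iff_ae_notMem.2 ?_
  filter_upwards [ae_posGaps Φ] with x hx h
  exact absurd (hx.birth_nonneg v) (not_le.2 (h.2.trans_lt ht))

/-- The intervals between consecutive rings are almost surely disjoint and lie after the birth, so
their probabilities at `r` add up to at most the probability of presence. The inequality makes it
unnecessary to know that the rings do not accumulate. -/
theorem tsum_setLIntegral_ring_le (v : Ball d) {f : ℝ × Config d → ℝ≥0∞} (hf : Measurable f) :
    ∑' k, ∫⁻ x in {x | (canonical Φ).IsBorn v x},
        f ((canonical Φ).ringTime v (k + 1) x, (x (v, k)).2) ∂sampleLaw Φ ≤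
      ∫⁻ r, (∫⁻ φ, f (r, φ) ∂Φ) * presence Φ v r := by
  have hg : Measurable fun r => ∫⁻ φ, f (r, φ) ∂Φ := hf.lintegral_prod_right'
  have hT := fun k => (canonical Φ).measurable_ringTime v k
  simp_rw [setLIntegral_ring Φ v _ hf]
  have hm : ∀ k, Measurable fun r => sampleLaw Φ {x | (canonical Φ).IsBorn v x ∧
      (canonical Φ).ringTime v k x ≤ r ∧ r < (canonical Φ).ringTime v (k + 1) x} := by
    intro k
    have : MeasurableSet {p : ℝ × Sample d | (canonical Φ).IsBorn v p.2 ∧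
        (canonical Φ).ringTime v k p.2 ≤ p.1 ∧ p.1 < (canonical Φ).ringTime v (k + 1) p.2} :=
      (measurable_snd (measurableSet_isBorn Φ v)).inter
        ((measurableSet_le ((hT k).comp measurable_snd) measurable_fst).inter
          (measurableSet_lt measurable_fst ((hT (k + 1)).comp measurable_snd)))
    exact measurable_measure_prodMk_left this
  rw [← lintegral_tsum fun k => Measurable.aemeasurable (Measurable.fun_mul hg (hm k))]
  refine lintegral_mono fun r => ?_
  rw [ENNReal.tsum_mul_left]
  gcongr
  set A : ℕ → Set (Sample d) := fun k => {x | (canonical Φ).IsBorn v x ∧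
    (canonical Φ).ringTime v k x ≤ r ∧ r < (canonical Φ).ringTime v (k + 1) x} with hA
  have hAm : ∀ k, MeasurableSet (A k) := fun k => (measurableSet_isBorn Φ v).inter
    ((measurableSet_le (hT k) measurable_const).inter (measurableSet_lt measurable_const (hT _)))
  have hdisj : Pairwise (Function.onFun (AEDisjoint (sampleLaw Φ)) A) := by
    intro k l hkl
    refine measure_eq_zero_iff_ae_notMem.2 ?_
    filter_upwards [ae_posGaps Φ] with x hx h
    have hmono := (hx.ringTime_strictMono (Φ := Φ) v).monotone
    rcases lt_or_gt_of_ne hkl with h' | h'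
    · exact absurd (h.1.2.2.trans_le (hmono (Nat.succ_le_of_lt h'))) (not_lt.2 h.2.2.1)
    · exact absurd (h.2.2.2.trans_le (hmono (Nat.succ_le_of_lt h'))) (not_lt.2 h.1.2.1)
  rw [← measure_iUnion₀ hdisj fun k => (hAm k).nullMeasurableSet]
  refine measure_mono_ae ?_
  filter_upwards [ae_posGaps Φ] with x hx h
  obtain ⟨k, hk⟩ := Set.mem_iUnion.1 h
  exact ⟨hk.1, (hx.birth_le_ringTime v k).trans hk.2.1⟩

/-- The total length of the displacements along the ancestral line of a ball. -/
def pathLength : Ball d → ℝ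
  | [] => 0
  | (_, y, _) :: v => pathLength v + siteNorm y

theorem pathLength_nonneg (v : Ball d) : 0 ≤ pathLength v := by
  induction v with
  | nil => exact le_rfl
  | cons a v ih => exact add_nonneg ih (Real.sqrt_nonneg _)

theorem presence_cons (v : Ball d) (k : ℕ) (y : Site d) (m : ℕ) (t : ℝ) :
    presence Φ ((k, y, m) :: v) t = ∫⁻ x in {x | (canonical Φ).IsBorn v x},
      (if (canonical Φ).ringTime v (k + 1) x ≤ t ∧ m < (x (v, k)).2 y then 1 else 0)
        ∂sampleLaw Φ := by
  have hS : MeasurableSet {x : Sample d |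
      (canonical Φ).ringTime v (k + 1) x ≤ t ∧ m < (x (v, k)).2 y} :=
    (measurableSet_le ((canonical Φ).measurable_ringTime v (k + 1)) measurable_const).inter
      (measurable_apply_snd (v, k) (t := {φ : Config d | m < φ y}) trivial)
  have h := lintegral_indicator_one (μ := (sampleLaw Φ).restrict {x | (canonical Φ).IsBorn v x}) hS
  rw [Measure.restrict_apply hS] at h
  simp only [Set.indicator_apply, Set.mem_ofPred_eq, Pi.one_apply] at h
  rw [h, presence]
  congr 1
  ext x
  simp only [Set.mem_inter_iff, Set.mem_ofPred_eq, Driving.isBorn_cons, Driving.birth_cons,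
    canonical_offspring]
  tauto

/-- The children of `v` born by time `t` are counted ring by ring. Summing over the number `m` of a
child gives the multiplicity `φ y`, and the sum over rings is bounded by the compensator. -/
theorem tsum_presence_cons_le (v : Ball d) (W : ℝ → ℝ≥0∞) (t : ℝ) :
    ∑' a : ℕ × Site d × ℕ, W (pathLength (a :: v)) * presence Φ (a :: v) t ≤
      ∫⁻ r in Set.Iic t, (∫⁻ φ, ∑' y, (φ y : ℝ≥0∞) * W (pathLength v + siteNorm y) ∂Φ) *
        presence Φ v r := by
  set S : Config d → ℝ≥0∞ := fun φ => ∑' y, (φ y : ℝ≥0∞) * W (pathLength v + siteNorm y) with hS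
  have hfm : Measurable fun p : ℝ × Config d => if p.1 ≤ t then S p.2 else 0 :=
    Measurable.ite (measurableSet_le measurable_fst measurable_const)
      ((measurable_of_countable S).comp measurable_snd) measurable_const
  have key := tsum_setLIntegral_ring_le Φ v hfm
  rw [← lintegral_indicator measurableSet_Iic]
  refine le_trans (le_of_eq ?_) (key.trans (le_of_eq ?_))
  · rw [ENNReal.tsum_prod']
    refine tsum_congr fun k => ?_
    have hT := (canonical Φ).measurable_ringTime v (k + 1)
    have hexp : ∀ x, (if (canonical Φ).ringTime v (k + 1) x ≤ t then S (x (v, k)).2 else 0) =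
        ∑' a : Site d × ℕ, W (pathLength v + siteNorm a.1) *
          (if (canonical Φ).ringTime v (k + 1) x ≤ t ∧ a.2 < (x (v, k)).2 a.1 then 1 else 0) := by
      intro x
      rw [ENNReal.tsum_prod']
      by_cases h : (canonical Φ).ringTime v (k + 1) x ≤ t
      · simp only [h, true_and, mul_ite, mul_one, mul_zero, if_true, hS]
        exact tsum_congr fun y => (ENNReal.tsum_ite_lt _ _).symm
      · simp [h]
    have hm : ∀ a : Site d × ℕ, Measurable fun x : Sample d =>
        if (canonical Φ).ringTime v (k + 1) x ≤ t ∧ a.2 < (x (v, k)).2 a.1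
          then (1 : ℝ≥0∞) else 0 := fun a =>
      Measurable.ite ((measurableSet_le hT measurable_const).inter
        (measurable_apply_snd (v, k) (t := {φ : Config d | a.2 < φ a.1}) trivial))
        measurable_const measurable_const
    simp_rw [hexp]
    rw [lintegral_tsum fun a => ((hm a).const_mul _).aemeasurable]
    refine tsum_congr fun a => ?_
    rw [lintegral_const_mul _ (hm a), presence_cons]
    rfl
  · refine lintegral_congr fun r => ?_
    by_cases h : r ≤ t <;> simp [hS, h]

/-- Expected sums over the balls present at a time, of a weight that grows at most by a factor
`Λ` in the mean from a ball to its offspring. -/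
theorem tsum_weight_presence_le {W : ℝ → ℝ≥0∞} {Λ : ℝ} (hΛ : 0 ≤ Λ)
    (hW : ∀ ℓ, 0 ≤ ℓ → ∫⁻ φ, ∑' y, (φ y : ℝ≥0∞) * W (ℓ + siteNorm y) ∂Φ ≤ ENNReal.ofReal Λ * W ℓ)
    (t : ℝ) :
    ∑' v : Ball d, W (pathLength v) * presence Φ v t ≤ W 0 * ENNReal.ofReal (Real.exp (Λ * t)) := by
  -- Truncating at generation `N` replaces Gronwall's lemma, which would need finiteness in advance,
  -- by Picard iteration: `A (N + 1) t ≤ W 0 + ∫ Λ A N`, and the claimed bound reproduces itself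
  -- under this inequality.
  set A : ℕ → ℝ → ℝ≥0∞ := fun N t => ∑' v : Ball d,
    if v.length ≤ N then W (pathLength v) * presence Φ v t else 0 with hA
  have hneg : ∀ N t, t < 0 → A N t = 0 := fun N t ht => by
    simp [hA, presence_of_neg Φ _ ht]
  have hnil : ∀ t, W (pathLength ([] : Ball d)) * presence Φ [] t ≤ W 0 := fun t => by
    change W 0 * _ ≤ _
    exact mul_le_of_le_one_right' prob_le_one
  have hmain : ∀ N t, A N t ≤ W 0 * ENNReal.ofReal (Real.exp (Λ * t)) := by
    intro N
    induction N with
    | zero =>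
      intro t
      rcases lt_or_ge t 0 with ht | ht
      · simp [hneg 0 t ht]
      · refine le_trans ?_ ((hnil t).trans (le_mul_of_one_le_right' ?_))
        · rw [hA]
          simp only [nonpos_iff_eq_zero, List.length_eq_zero_iff]
          rw [tsum_eq_single []]
          · simp
          · intro v hv; simp [hv]
        · rw [ENNReal.one_le_ofReal]
          exact Real.one_le_exp (by positivity)
    | succ N ih =>
      intro t
      rcases lt_or_ge t 0 with ht | ht
      · simp [hneg _ t ht]
      have hstep : ∀ v : Ball d, ∑' a, (if (a :: v).length ≤ N + 1 then
          W (pathLength (a :: v)) * presence Φ (a :: v) t else 0) ≤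
          ∫⁻ r in Set.Iic t, ENNReal.ofReal Λ *
            (if v.length ≤ N then W (pathLength v) * presence Φ v r else 0) := by
        intro v
        by_cases hv : v.length ≤ N
        · simp only [List.length_cons, Nat.add_le_add_iff_right, hv, if_true]
          refine (tsum_presence_cons_le Φ v W t).trans (lintegral_mono fun r => ?_)
          rw [← mul_assoc]
          gcongr
          exact hW _ (pathLength_nonneg v)
        · simp [hv]
      have hmeas : ∀ v : Ball d, Measurable fun r =>
          (if v.length ≤ N then W (pathLength v) * presence Φ v r else 0) := fun v => by
        split_ifs
        · exact (measurable_presence Φ v).const_mul _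
        · exact measurable_const
      have hexp : Measurable fun r => ENNReal.ofReal Λ * ENNReal.ofReal (Real.exp (Λ * r)) :=
        (Real.measurable_exp.comp (measurable_const_mul Λ)).ennreal_ofReal.const_mul _
      calc A (N + 1) t ≤ W 0 + ∑' v : Ball d, ∫⁻ r in Set.Iic t, ENNReal.ofReal Λ *
            (if v.length ≤ N then W (pathLength v) * presence Φ v r else 0) := by
            rw [hA]
            simp only
            rw [tsum_list _ ENNReal.summable, ENNReal.tsum_prod']
            refine add_le_add ?_ (ENNReal.tsum_le_tsum hstep)
            simpa using hnil t
        _ = W 0 + ∫⁻ r in Set.Iic t, ENNReal.ofReal Λ * A N r := by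
            rw [← lintegral_tsum fun v => ((hmeas v).const_mul _).aemeasurable]
            simp_rw [ENNReal.tsum_mul_left, hA]
        _ ≤ W 0 + ∫⁻ r in Set.Icc 0 t, W 0 *
              (ENNReal.ofReal Λ * ENNReal.ofReal (Real.exp (Λ * r))) := by
            refine add_le_add le_rfl ?_
            rw [← lintegral_indicator measurableSet_Iic, ← lintegral_indicator measurableSet_Icc]
            refine lintegral_mono fun r => ?_
            by_cases h1 : r ≤ t
            · rcases lt_or_ge r 0 with h0 | h0
              · simp only [Set.indicator_apply, hneg N r h0, mul_zero, ite_self, zero_le]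
              · rw [Set.indicator_of_mem (Set.mem_Iic.2 h1),
                  Set.indicator_of_mem (Set.mem_Icc.2 ⟨h0, h1⟩),
                  mul_left_comm]
                gcongr
                exact ih r
            · simp [h1]
        _ = W 0 * ENNReal.ofReal (Real.exp (Λ * t)) := by
            rw [lintegral_const_mul _ hexp, lintegral_exp_Iic_le hΛ ht]
            nth_rw 1 [← mul_one (W 0)]
            rw [← mul_add, ← ENNReal.ofReal_one, ← ENNReal.ofReal_add zero_le_one]
            · simp
            · exact sub_nonneg.2 (Real.one_le_exp (by positivity))
  -- Any finite set of labels lies below some generation, so the bound uniform in `N` passes to the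
  -- full sum.
  rw [ENNReal.tsum_eq_iSup_sum]
  refine iSup_le fun s => le_trans ?_ (hmain (s.sup List.length) t)
  refine le_trans (Finset.sum_le_sum fun v hv => ?_) (ENNReal.sum_le_tsum s)
  rw [if_pos (Finset.le_sup hv)]

end BranchingWalk

/-! ### Compensation of a single exponential jump -/

theorem MeasureTheory.integrable_inner_of_memLp {α : Type*} [MeasurableSpace α] {μ : Measure α}
    {f g : α → ℂ} (hf : MemLp f 2 μ) (hg : MemLp g 2 μ) :
    Integrable (fun x => (inner ℝ (f x) (g x) : ℝ)) μ :=
  (hf.norm.integrable_mul hg.norm).mono' (hf.1.inner hg.1)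
    (.of_forall fun _ => norm_inner_le_norm _ _)

/-- The nearest point of `[s, t]`. -/
def clamp (s t r : ℝ) : ℝ := max s (min r t)

theorem continuous_clamp (s t : ℝ) : Continuous (clamp s t) :=
  continuous_const.max (continuous_id.min continuous_const)

theorem clamp_mem {s t : ℝ} (hst : s ≤ t) (r : ℝ) : clamp s t r ∈ Set.Icc s t :=
  ⟨le_max_left _ _, max_le hst (min_le_right _ _)⟩

theorem clamp_of_le {s t r : ℝ} (hst : s ≤ t) (h : r ≤ s) : clamp s t r = s := by
  rw [clamp, min_eq_left (h.trans hst), max_eq_left h]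

theorem clamp_of_ge {s t r : ℝ} (hst : s ≤ t) (h : t ≤ r) : clamp s t r = t := by
  rw [clamp, min_eq_right h, max_eq_right hst]

theorem clamp_of_mem {s t r : ℝ} (h : s ≤ r) (h' : r ≤ t) : clamp s t r = r := by
  rw [clamp, min_eq_left h', max_eq_right h]

/-- A single jump at rate one is compensated by its hazard: the process that jumps by `γ r` at the
jump time `r` and drifts by `-γ` until then has mean zero. -/
theorem integral_jump_sub_drift {F : Type*} [NormedAddCommGroup F] [NormedSpace ℝ F]
    [CompleteSpace F] {γ Γ : ℝ → F} (hγ : Continuous γ) (hΓ : ∀ r, HasDerivAt Γ (γ r) r)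
    {a s t : ℝ} (hst : s ≤ t) (ha : Γ (clamp s t a) = 0) :
    ∫ e, ((if s < a + e ∧ a + e ≤ t then γ (a + e) else 0) - Γ (clamp s t (a + e))) ∂expMeasure 1
      = 0 := by
  rw [integral_expMeasure_one]
  rcases le_or_gt t a with hat | hat
  · rw [clamp_of_ge hst hat] at ha
    refine (setIntegral_congr_fun measurableSet_Ioi fun e he => ?_).trans (integral_zero _ _)
    have he' : 0 < e := he
    rw [if_neg (by intro h; linarith [h.2]), clamp_of_ge hst (by linarith), ha]
    simp
  -- In the clock's own time, the window `(s, t]` is `(p, q]`. Before `p` there is neither jump nor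
  -- drift, on `(p, q]` there are both, and after `q` only the frozen drift `Γ t` remains.
  set p := max 0 (s - a) with hp
  set q := t - a with hq
  have hpq : p ≤ q := max_le (by linarith) (by linarith)
  have hΓp : Γ (a + p) = 0 := by
    rw [← ha, clamp, min_eq_left hat.le, hp]
    congr 1
    rw [← max_add_add_left]
    simp [max_comm]
  have hΓc : Continuous Γ := continuous_iff_continuousAt.2 fun r => (hΓ r).continuousAt
  set h : ℝ → F := fun e => Real.exp (-e) • ((if s < a + e ∧ a + e ≤ t then γ (a + e) else 0) -
    Γ (clamp s t (a + e))) with hh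
  have h1 : Set.EqOn h (fun _ => 0) (Set.Ioc 0 p) := by
    intro e he
    have h0 : 0 < s - a := by
      by_contra hc
      rw [hp, max_eq_left (not_lt.1 hc)] at he
      exact absurd (he.1.trans_le he.2) (lt_irrefl _)
    have hes : a + e ≤ s := by
      have := he.2
      rw [hp, max_eq_right h0.le] at this
      linarith
    rw [clamp_of_le hst (by linarith)] at ha
    simp only [hh]
    rw [if_neg (by intro h; linarith [h.1]), clamp_of_le hst hes, ha]
    simp
  have h2 : Set.EqOn h (fun e => Real.exp (-e) • (γ (a + e) - Γ (a + e))) (Set.Ioc p q) := by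
    intro e he
    have hs : s < a + e := by
      have := (le_max_right 0 (s - a)).trans_lt he.1
      linarith
    have ht : a + e ≤ t := by linarith [he.2]
    simp only [hh]
    rw [if_pos ⟨hs, ht⟩, clamp_of_mem hs.le ht]
  have h3 : Set.EqOn h (fun e => Real.exp (-e) • (-Γ t)) (Set.Ioi q) := by
    intro e he
    have ht : t < a + e := by have := Set.mem_Ioi.1 he; linarith
    simp only [hh]
    rw [if_neg (by intro h; linarith [h.2]), clamp_of_ge hst ht.le, zero_sub]
  have hc2 : Continuous fun e => Real.exp (-e) • (γ (a + e) - Γ (a + e)) := by fun_prop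
  have i1 : IntegrableOn h (Set.Ioc 0 p) :=
    (integrableOn_congr_fun h1 measurableSet_Ioc).2 (integrable_zero _ _ _)
  have i2 : IntegrableOn h (Set.Ioc p q) :=
    (integrableOn_congr_fun h2 measurableSet_Ioc).2
      (hc2.continuousOn.integrableOn_Icc.mono_set Set.Ioc_subset_Icc_self)
  have i3 : IntegrableOn h (Set.Ioi q) :=
    (integrableOn_congr_fun h3 measurableSet_Ioi).2 ((integrableOn_exp_neg_Ioi q).smul_const _)
  have i23 : IntegrableOn h (Set.Ioi p) := by
    rw [← Set.Ioc_union_Ioi_eq_Ioi hpq]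
    exact i2.union i3
  rw [← Set.Ioc_union_Ioi_eq_Ioi (le_max_left 0 (s - a)),
    setIntegral_union (Set.Ioc_disjoint_Ioi le_rfl) measurableSet_Ioi i1 i23,
    ← Set.Ioc_union_Ioi_eq_Ioi hpq,
    setIntegral_union (Set.Ioc_disjoint_Ioi le_rfl) measurableSet_Ioi i2 i3,
    setIntegral_congr_fun measurableSet_Ioc h1, setIntegral_congr_fun measurableSet_Ioc h2,
    setIntegral_congr_fun measurableSet_Ioi h3, integral_zero, zero_add,
    ← intervalIntegral.integral_of_le hpq,
    -- The integrand on `(p, q]` is the derivative of `exp (-e) Γ (a + e)`. Its value at `q` cancels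
    -- the contribution of the tail, and its value at `p` is zero.
    intervalIntegral.integral_eq_sub_of_hasDerivAt (f := fun e => Real.exp (-e) • Γ (a + e)),
    integral_smul_const, integral_exp_neg_Ioi, hΓp]
  · simp [hq]
  · intro e _
    have hd : HasDerivAt (fun e => Γ (a + e)) (γ (a + e)) e := by
      simpa [Function.comp_def] using (hΓ (a + e)).scomp e ((hasDerivAt_id e).const_add a)
    have he : HasDerivAt (fun e : ℝ => Real.exp (-e)) (-Real.exp (-e)) e := by
      simpa using (hasDerivAt_id e).neg.exp
    have := he.smul hd
    rwa [neg_smul, ← sub_eq_add_neg, ← smul_sub] at this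
  · exact hc2.intervalIntegrable _ _

/-! ### Compensated jump systems: mean and variance of one increment -/

namespace BranchingWalk

variable {d : ℕ}

theorem total_nonneg (φ : Config d) : 0 ≤ total φ := Finset.sum_nonneg fun _ _ => Nat.cast_nonneg _

/-- For every ball, the jumps made at the rings of its clock and their compensator. -/
structure JumpKernel (Φ : Measure (Config d)) where
  jump : Ball d → ℝ → Config d → ℂ
  drift : Ball d → ℝ → ℂ
  rate : Ball d → ℝ → ℂ
  continuous_jump : ∀ v φ, Continuous fun r => jump v r φ
  continuous_rate : ∀ v, Continuous (rate v)
  hasDerivAt_drift : ∀ v r, HasDerivAt (drift v) (rate v r) r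
  integral_jump : ∀ v r, ∫ φ, jump v r φ ∂Φ = rate v r
  exists_bound : ∀ t, ∃ K, 0 ≤ K ∧ ∀ v, ∀ r ∈ Set.Icc 0 t,
    (∀ φ, ‖jump v r φ‖ ≤ K * total φ) ∧ ‖drift v r‖ ≤ K

namespace JumpKernel

variable {Φ : Measure (Config d)} (J : JumpKernel Φ)

/-- The jump of a ball at a ring in `(s, t]`. -/
def jumpOn (v : Ball d) (s t : ℝ) (p : ℝ × Config d) : ℂ :=
  if s < p.1 ∧ p.1 ≤ t then J.jump v p.1 p.2 else 0

/-- The compensated increment over `(s, t]` due to a ring at time `p.1`, preceded by a ring at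
time `a`. -/
def increment (v : Ball d) (s t a : ℝ) (p : ℝ × Config d) : ℂ :=
  J.jumpOn v s t p - (J.drift v (clamp s t p.1) - J.drift v (clamp s t a))

theorem continuous_drift (v : Ball d) : Continuous (J.drift v) :=
  continuous_iff_continuousAt.2 fun r => (J.hasDerivAt_drift v r).continuousAt

theorem measurable_jumpOn (v : Ball d) (s t : ℝ) : Measurable (J.jumpOn v s t) := by
  refine measurable_from_prod_countable_left fun φ => ?_
  exact Measurable.ite (measurableSet_Ioc (a := s) (b := t)) (J.continuous_jump v φ).measurable
    measurable_const

theorem measurable_increment (v : Ball d) (s t : ℝ) :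
    Measurable (Function.uncurry (J.increment v s t)) := by
  have h := (J.continuous_drift v).comp (continuous_clamp s t)
  exact ((J.measurable_jumpOn v s t).comp measurable_snd).sub
    ((h.measurable.comp (measurable_fst.comp measurable_snd)).sub (h.measurable.comp measurable_fst))

theorem exists_norm_le {s t : ℝ} (hs : 0 ≤ s) (hst : s ≤ t) : ∃ K, 0 ≤ K ∧ ∀ v p,
    ‖J.jumpOn v s t p‖ ≤ K * total p.2 ∧
    ∀ a, ‖J.drift v (clamp s t p.1) - J.drift v (clamp s t a)‖ ≤ 2 * K := by
  obtain ⟨K, hK, h⟩ := J.exists_bound t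
  refine ⟨K, hK, fun v p => ⟨?_, fun a => ?_⟩⟩
  · rw [jumpOn]
    split_ifs with hp
    · exact (h v p.1 ⟨hs.trans hp.1.le, hp.2⟩).1 _
    · simpa using mul_nonneg hK (total_nonneg _)
  · have hc : ∀ r, ‖J.drift v (clamp s t r)‖ ≤ K := fun r =>
      (h v _ ⟨hs.trans (clamp_mem hst r).1, (clamp_mem hst r).2⟩).2
    exact (norm_sub_le _ _).trans (by linarith [hc p.1, hc a])

theorem memLp_total (hΦ : Integrable (fun φ => total φ ^ 2) Φ) : MemLp (fun φ => total φ) 2 Φ :=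
  (memLp_two_iff_integrable_sq (measurable_of_countable _).aestronglyMeasurable).2 hΦ

variable (hΦ : Integrable (fun φ => total φ ^ 2) Φ)
include hΦ

theorem memLp_jumpOn (v : Ball d) {s t : ℝ} (hs : 0 ≤ s) (hst : s ≤ t) (a : ℝ) :
    MemLp (fun y : ℝ × Config d => J.jumpOn v s t (a + y.1, y.2)) 2 (markLaw Φ) := by
  obtain ⟨K, -, h⟩ := J.exists_norm_le hs hst
  have hm : Measurable fun y : ℝ × Config d => (a + y.1, y.2) :=
    (measurable_fst.const_add a).prodMk measurable_snd
  have ht : MemLp (fun y : ℝ × Config d => K * total y.2) 2 (markLaw Φ) :=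
    ((memLp_total hΦ).comp_snd (μ := expMeasure 1)).const_mul K
  exact ht.mono ((J.measurable_jumpOn v s t).comp hm).aestronglyMeasurable
    (.of_forall fun y => ((h v (a + y.1, y.2)).1).trans (Real.le_norm_self _))

variable [IsProbabilityMeasure Φ]

omit hΦ in
theorem memLp_drift (v : Ball d) {s t : ℝ} (hs : 0 ≤ s) (hst : s ≤ t) (a : ℝ) :
    MemLp (fun y : ℝ × Config d => J.drift v (clamp s t (a + y.1)) - J.drift v (clamp s t a)) 2
      (markLaw Φ) := by
  obtain ⟨K, -, h⟩ := J.exists_norm_le hs hst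
  have hd := (J.continuous_drift v).comp (continuous_clamp s t)
  refine MemLp.of_bound (Measurable.aestronglyMeasurable ?_) (2 * K)
    (.of_forall fun y => (h v (a + y.1, y.2)).2 a)
  exact (hd.measurable.comp (measurable_fst.const_add a)).sub measurable_const

/-- Averaging the jump over the draw leaves its rate, whose antiderivative is the drift; the waiting
time is then handled by `integral_jump_sub_drift`. -/
theorem integral_increment (v : Ball d) {s t : ℝ} (hs : 0 ≤ s) (hst : s ≤ t) (a : ℝ) :
    ∫ y, J.increment v s t a (a + y.1, y.2) ∂markLaw Φ = 0 := by
  have hY := (J.memLp_jumpOn hΦ v hs hst a).integrable one_le_two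
  have hZ := (J.memLp_drift v hs hst a).integrable one_le_two
  simp only [increment]
  rw [markLaw] at *
  rw [integral_prod _ (hY.sub' hZ), ← integral_jump_sub_drift (a := a) (J.continuous_rate v)
    (Γ := fun r => J.drift v r - J.drift v (clamp s t a))
    (fun r => (J.hasDerivAt_drift v r).sub_const _) hst (sub_self _)]
  refine integral_congr_ae ?_
  filter_upwards [hY.prod_right_ae, hZ.prod_right_ae] with e h1 h2
  rw [integral_sub h1 h2, integral_const]
  simp only [probReal_univ, one_smul]
  congr 1
  simp only [jumpOn]
  split_ifs
  · exact J.integral_jump v _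
  · simp

/-- With `Y` the jump and `Z` the drift, `‖Y - Z‖² = ‖Y‖² - (2⟨Y, Z⟩ - ‖Z‖²)`. The bracket averages
to a compensated jump in its own right, with drift `‖Z‖²` and rate `2⟨Z, rate⟩`, so it has mean
zero. -/
theorem integral_norm_increment_sq (v : Ball d) {s t : ℝ} (hs : 0 ≤ s) (hst : s ≤ t) (a : ℝ) :
    ∫ y, ‖J.increment v s t a (a + y.1, y.2)‖ ^ 2 ∂markLaw Φ =
      ∫ y, ‖J.jumpOn v s t (a + y.1, y.2)‖ ^ 2 ∂markLaw Φ := by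
  have hY := J.memLp_jumpOn hΦ v hs hst a
  have hZ := J.memLp_drift v hs hst a
  have hYZ : Integrable (fun y : ℝ × Config d => 2 * inner ℝ (J.jumpOn v s t (a + y.1, y.2))
      (J.drift v (clamp s t (a + y.1)) - J.drift v (clamp s t a))) (markLaw Φ) :=
    (integrable_inner_of_memLp hY hZ).const_mul 2
  have hZ2 := hZ.integrable_norm_pow two_ne_zero
  have hY2 := hY.integrable_norm_pow two_ne_zero
  have hzero : ∫ y : ℝ × Config d, (2 * inner ℝ (J.jumpOn v s t (a + y.1, y.2))
      (J.drift v (clamp s t (a + y.1)) - J.drift v (clamp s t a)) -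
      ‖J.drift v (clamp s t (a + y.1)) - J.drift v (clamp s t a)‖ ^ 2) ∂markLaw Φ = 0 := by
    have hY1 := hY.integrable one_le_two
    rw [markLaw] at *
    rw [integral_prod _ (hYZ.sub' hZ2)]
    have hd : Continuous fun r => J.drift v r - J.drift v (clamp s t a) :=
      (J.continuous_drift v).sub continuous_const
    rw [← integral_jump_sub_drift (a := a)
      (γ := fun r => 2 * inner ℝ (J.drift v r - J.drift v (clamp s t a)) (J.rate v r))
      (Γ := fun r => ‖J.drift v r - J.drift v (clamp s t a)‖ ^ 2)
      ((hd.inner (J.continuous_rate v)).const_mul 2)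
      (fun r => ((J.hasDerivAt_drift v r).sub_const _).norm_sq) hst (by simp)]
    refine integral_congr_ae ?_
    filter_upwards [hY1.prod_right_ae, hYZ.prod_right_ae, hZ2.prod_right_ae] with e h0 h1 h2
    rw [integral_sub h1 h2, integral_const, integral_const_mul]
    simp only [probReal_univ, one_smul]
    congr 1
    simp_rw [real_inner_comm]
    rw [integral_inner h0]
    simp only [jumpOn]
    split_ifs with h
    · rw [J.integral_jump v _, clamp_of_mem h.1.le h.2]
    · simp
  have hexp : ∀ y : ℝ × Config d, ‖J.increment v s t a (a + y.1, y.2)‖ ^ 2 =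
      ‖J.jumpOn v s t (a + y.1, y.2)‖ ^ 2 - (2 * inner ℝ (J.jumpOn v s t (a + y.1, y.2))
      (J.drift v (clamp s t (a + y.1)) - J.drift v (clamp s t a)) -
      ‖J.drift v (clamp s t (a + y.1)) - J.drift v (clamp s t a)‖ ^ 2) := fun y => by
    rw [increment, @norm_sub_sq_real]
    ring
  simp_rw [hexp]
  rw [integral_sub hY2 (hYZ.sub' hZ2), hzero, sub_zero]

theorem lintegral_enorm_increment_sq (v : Ball d) {s t : ℝ} (hs : 0 ≤ s) (hst : s ≤ t) (a : ℝ) :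
    ∫⁻ y, ‖J.increment v s t a (a + y.1, y.2)‖ₑ ^ 2 ∂markLaw Φ =
      ∫⁻ y, ‖J.jumpOn v s t (a + y.1, y.2)‖ₑ ^ 2 ∂markLaw Φ := by
  have hY := J.memLp_jumpOn hΦ v hs hst a
  have hYZ : MemLp (fun y : ℝ × Config d => J.increment v s t a (a + y.1, y.2)) 2 (markLaw Φ) :=
    hY.sub (J.memLp_drift v hs hst a)
  have h : ∀ f : ℝ × Config d → ℂ, MemLp f 2 (markLaw Φ) →
      ∫⁻ y, ‖f y‖ₑ ^ 2 ∂markLaw Φ = ENNReal.ofReal (∫ y, ‖f y‖ ^ 2 ∂markLaw Φ) := fun f hf => by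
    rw [ofReal_integral_eq_lintegral_ofReal (hf.integrable_norm_pow two_ne_zero)
      (.of_forall fun y => by positivity)]
    refine lintegral_congr fun y => ?_
    rw [ENNReal.ofReal_pow (norm_nonneg _), ofReal_norm]
  rw [h _ hY, h _ hYZ, J.integral_norm_increment_sq hΦ v hs hst a]

end JumpKernel

end BranchingWalk

/-! ### Finiteness of the population and of the set of active rings -/

namespace BranchingWalk

variable {d : ℕ}

theorem tsum_mul_ofReal (φ : Config d) {g : Site d → ℝ} (hg : ∀ y, 0 ≤ g y) :
    ∑' y, (φ y : ℝ≥0∞) * ENNReal.ofReal (g y) = ENNReal.ofReal (φ.sum fun y n => g y * n) := by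
  rw [tsum_eq_sum (s := φ.support) (fun y hy => by simp [Finsupp.notMem_support_iff.1 hy]),
    Finsupp.sum, ENNReal.ofReal_sum_of_nonneg fun y _ => mul_nonneg (hg y) (Nat.cast_nonneg _)]
  refine Finset.sum_congr rfl fun y _ => ?_
  rw [ENNReal.ofReal_mul (hg y), ENNReal.ofReal_natCast, mul_comm]

section

variable {Φ : Measure (Config d)}

theorem meanTotal_nonneg : 0 ≤ meanTotal Φ := integral_nonneg total_nonneg

variable [IsProbabilityMeasure Φ]

theorem integrable_total (hΦ : Integrable (fun φ => total φ ^ 2) Φ) :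
    Integrable (fun φ => total φ) Φ :=
  (JumpKernel.memLp_total hΦ).integrable one_le_two

theorem lintegral_total (hΦ : Integrable (fun φ => total φ ^ 2) Φ) :
    ∫⁻ φ, ENNReal.ofReal (total φ) ∂Φ = ENNReal.ofReal (meanTotal Φ) :=
  (ofReal_integral_eq_lintegral_ofReal (integrable_total hΦ) (.of_forall total_nonneg)).symm

theorem tsum_presence_le (hΦ : Integrable (fun φ => total φ ^ 2) Φ) (t : ℝ) :
    ∑' v : Ball d, presence Φ v t ≤ ENNReal.ofReal (Real.exp (meanTotal Φ * t)) := by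
  have h := tsum_weight_presence_le Φ (W := fun _ => 1) (meanTotal_nonneg (Φ := Φ)) (fun ℓ _ => ?_) t
  · simpa using h
  · have h1 : ∀ φ : Config d, ∑' y, (φ y : ℝ≥0∞) * 1 = ENNReal.ofReal (total φ) := fun φ => by
      have := tsum_mul_ofReal φ (g := fun _ => 1) fun _ => zero_le_one
      simpa [total] using this
    simp_rw [h1]
    rw [lintegral_total hΦ, mul_one]

/-- The rings up to time `t` of the clocks of the balls that are ever born, births included. -/
def activeRings (Φ : Measure (Config d)) [IsProbabilityMeasure Φ] (t : ℝ) (x : Sample d) :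
    Set (Ball d × ℕ) :=
  {i | (canonical Φ).IsBorn i.1 x ∧ (canonical Φ).ringTime i.1 i.2 x ≤ t}

theorem measurableSet_activeRings (i : Ball d × ℕ) (t : ℝ) :
    MeasurableSet {x | i ∈ activeRings Φ t x} :=
  (measurableSet_isBorn Φ i.1).inter
    (measurableSet_le ((canonical Φ).measurable_ringTime _ _) measurable_const)

/-- The index `k = 0` is the birth and contributes the probability of presence. The genuine rings
occur at rate one while the ball is present and contribute at most the integral of that probability.
-/
theorem tsum_activeRings_lt_top (hΦ : Integrable (fun φ => total φ ^ 2) Φ) (t : ℝ) :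
    ∑' i, sampleLaw Φ {x | i ∈ activeRings Φ t x} < ∞ := by
  rw [ENNReal.tsum_prod']
  have hsplit : ∀ v : Ball d, ∑' k, sampleLaw Φ {x | (v, k) ∈ activeRings Φ t x} ≤
      presence Φ v t + ∫⁻ r in Set.Iic t, presence Φ v r := by
    intro v
    rw [tsum_eq_zero_add' ENNReal.summable]
    refine add_le_add (le_of_eq ?_) ?_
    · simp only [presence, activeRings, Driving.ringTime_zero, Set.mem_ofPred_eq]
    · have hf : Measurable fun p : ℝ × Config d => (Set.Iic t).indicator (1 : ℝ → ℝ≥0∞) p.1 :=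
        (measurable_one.indicator measurableSet_Iic).comp measurable_fst
      have := tsum_setLIntegral_ring_le Φ v hf
      rw [← lintegral_indicator measurableSet_Iic]
      refine le_trans (le_of_eq (tsum_congr fun k => ?_)) (this.trans (le_of_eq ?_))
      · have hS : MeasurableSet {x | (canonical Φ).ringTime v (k + 1) x ≤ t} :=
          measurableSet_le ((canonical Φ).measurable_ringTime v _) measurable_const
        have h1 := lintegral_indicator_one
          (μ := (sampleLaw Φ).restrict {x | (canonical Φ).IsBorn v x}) hS
        rw [Measure.restrict_apply hS, Set.inter_comm] at h1
        exact h1.symm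
      · refine lintegral_congr fun r => ?_
        by_cases h : r ≤ t <;> simp [h]
  refine (ENNReal.tsum_le_tsum hsplit).trans_lt ?_
  rw [ENNReal.tsum_add, ← lintegral_tsum fun v => (measurable_presence Φ v).aemeasurable]
  refine ENNReal.add_lt_top.2 ⟨(tsum_presence_le hΦ t).trans_lt ENNReal.ofReal_lt_top, ?_⟩
  calc ∫⁻ r in Set.Iic t, ∑' v, presence Φ v r
      ≤ ∫⁻ r in Set.Icc 0 t, ENNReal.ofReal (Real.exp (meanTotal Φ * t)) := by
        rw [← lintegral_indicator measurableSet_Iic, ← lintegral_indicator measurableSet_Icc]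
        refine lintegral_mono fun r => ?_
        by_cases h1 : r ≤ t
        · rcases lt_or_ge r 0 with h0 | h0
          · simp [presence_of_neg Φ _ h0, Set.indicator_apply]
          · rw [Set.indicator_of_mem (Set.mem_Iic.2 h1),
              Set.indicator_of_mem (Set.mem_Icc.2 ⟨h0, h1⟩)]
            exact (ENNReal.tsum_le_tsum fun v => presence_mono Φ v h1).trans (tsum_presence_le hΦ t)
        · simp [h1]
    _ < ∞ := by
        rw [setLIntegral_const]
        exact ENNReal.mul_lt_top ENNReal.ofReal_lt_top (by simp)

theorem ae_finite_activeRings (hΦ : Integrable (fun φ => total φ ^ 2) Φ) :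
    ∀ᵐ x ∂sampleLaw Φ, ∀ t, (activeRings Φ t x).Finite := by
  have h : ∀ n : ℕ, ∀ᵐ x ∂sampleLaw Φ, (activeRings Φ n x).Finite := by
    intro n
    have hm := fun i => (measurable_one (α := ℝ≥0∞)).indicator
      (measurableSet_activeRings (Φ := Φ) i n)
    have hlt : ∫⁻ x, ∑' i, {x | i ∈ activeRings Φ n x}.indicator 1 x ∂sampleLaw Φ < ∞ := by
      rw [lintegral_tsum fun i => (hm i).aemeasurable]
      simp_rw [lintegral_indicator_one (measurableSet_activeRings _ _)]
      exact tsum_activeRings_lt_top hΦ n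
    filter_upwards [ae_lt_top (Measurable.tsum hm) hlt.ne] with x hx
    refine (ENNReal.finite_const_le_of_tsum_ne_top hx.ne one_ne_zero).subset fun i hi => ?_
    rw [Set.mem_ofPred_eq, Set.indicator_of_mem (s := {x | i ∈ activeRings Φ n x}) hi, Pi.one_apply]
  filter_upwards [ae_all_iff.2 h] with x hx t
  obtain ⟨n, hn⟩ := exists_nat_ge t
  exact (hx n).subset fun i hi => ⟨hi.1, hi.2.trans hn⟩

end

/-! ### Orthogonality of the ring increments -/

namespace JumpKernel

variable {Φ : Measure (Config d)} (J : JumpKernel Φ)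

theorem increment_eq_zero {v : Ball d} {s t a : ℝ} (hst : s ≤ t) {p : ℝ × Config d}
    (h : t < a ∧ t < p.1 ∨ a ≤ s ∧ p.1 ≤ s) : J.increment v s t a p = 0 := by
  rcases h with h | h
  · rw [increment, jumpOn, if_neg (fun h' => absurd h.2 (not_lt.2 h'.2)), clamp_of_ge hst h.1.le,
      clamp_of_ge hst h.2.le]
    simp
  · rw [increment, jumpOn, if_neg (fun h' => absurd h.2 (not_le.2 h'.1)), clamp_of_le hst h.1,
      clamp_of_le hst h.2]
    simp

theorem norm_increment_le {K : ℝ} {s t : ℝ} (h : ∀ v p,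
    ‖J.jumpOn v s t p‖ ≤ K * total p.2 ∧
    ∀ a, ‖J.drift v (clamp s t p.1) - J.drift v (clamp s t a)‖ ≤ 2 * K) (v : Ball d) (a : ℝ)
    (p : ℝ × Config d) : ‖J.increment v s t a p‖ ≤ K * (total p.2 + 2) := by
  rw [increment]
  refine (norm_sub_le _ _).trans ?_
  linarith [(h v p).1, (h v p).2 a]

variable [IsProbabilityMeasure Φ]

/-- The compensated increment over `(s, t]` due to a ring of the clock of a ball. -/
def ringIncrement (i : Ball d × ℕ) (s t : ℝ) : Sample d → ℂ :=
  {x | (canonical Φ).IsBorn i.1 x}.indicator fun x => J.increment i.1 s t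
    ((canonical Φ).ringTime i.1 i.2 x) ((canonical Φ).ringTime i.1 (i.2 + 1) x, (x i).2)

theorem measurable_ringIncrement (i : Ball d × ℕ) (s t : ℝ) :
    Measurable (J.ringIncrement i s t) :=
  ((J.measurable_increment i.1 s t).comp
    (((canonical Φ).measurable_ringTime i.1 i.2).prodMk (measurable_ring_mark Φ i.1 i.2))).indicator
    (measurableSet_isBorn Φ i.1)

theorem ringIncrement_of_isBorn {i : Ball d × ℕ} {x : Sample d} (hb : (canonical Φ).IsBorn i.1 x)
    (s t : ℝ) : J.ringIncrement i s t x = J.increment i.1 s t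
      ((canonical Φ).ringTime i.1 i.2 x) ((canonical Φ).ringTime i.1 (i.2 + 1) x, (x i).2) :=
  Set.indicator_of_mem (s := {x | (canonical Φ).IsBorn i.1 x}) hb _

theorem ringIncrement_of_not_isBorn {i : Ball d × ℕ} {x : Sample d}
    (hb : ¬ (canonical Φ).IsBorn i.1 x) (s t : ℝ) : J.ringIncrement i s t x = 0 :=
  Set.indicator_of_notMem (s := {x | (canonical Φ).IsBorn i.1 x}) hb _

theorem ringIncrement_update {i : Ball d × ℕ} {x : Sample d} (hb : (canonical Φ).IsBorn i.1 x)
    (s t : ℝ) (y : ℝ × Config d) :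
    J.ringIncrement i s t (Function.update x i y) = J.increment i.1 s t
      ((canonical Φ).ringTime i.1 i.2 x) ((canonical Φ).ringTime i.1 i.2 x + y.1, y.2) := by
  obtain ⟨v, k⟩ := i
  rw [J.ringIncrement_of_isBorn ((isBorn_update Φ le_rfl x k y).2 hb)]
  simp only [ringTime_succ_update, ringTime_update Φ le_rfl (fun _ => le_rfl) x y,
    Function.update_self]

theorem ringIncrement_update_of_not_isBorn {i : Ball d × ℕ} {x : Sample d}
    (hb : ¬ (canonical Φ).IsBorn i.1 x) (s t : ℝ) (y : ℝ × Config d) :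
    J.ringIncrement i s t (Function.update x i y) = 0 :=
  J.ringIncrement_of_not_isBorn (fun h => hb ((isBorn_update Φ le_rfl x i.2 y).1 h)) s t

/-- The increment of ring `j` reads the marks of strict ancestors of `j.1` and those of `j.1` up to
index `j.2`. Under the two hypotheses the mark `i` is not among them. -/
theorem ringIncrement_update_of_le {i j : Ball d × ℕ} (h : j.1.length ≤ i.1.length)
    (h' : j.1 = i.1 → j.2 < i.2) (s t : ℝ) (x : Sample d) (y : ℝ × Config d) :
    J.ringIncrement j s t (Function.update x i y) = J.ringIncrement j s t x := by
  obtain ⟨v, k⟩ := i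
  obtain ⟨w, l⟩ := j
  have hne : (w, l) ≠ (v, k) := by
    rintro ⟨⟩
    exact lt_irrefl _ (h' rfl)
  by_cases hb : (canonical Φ).IsBorn w x
  · rw [J.ringIncrement_of_isBorn ((isBorn_update Φ h x k y).2 hb), J.ringIncrement_of_isBorn hb]
    simp only [ringTime_update Φ h (fun e => (h' e).le) x y,
      ringTime_update Φ h (fun e => h' e) x y, Function.update_of_ne hne]
  · rw [J.ringIncrement_of_not_isBorn (fun h' => hb ((isBorn_update Φ h x k y).1 h')),
      J.ringIncrement_of_not_isBorn hb]

theorem ringIncrement_eq_zero {x : Sample d} (hx : PosGaps x) {s t : ℝ} (hst : s ≤ t)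
    {i : Ball d × ℕ} (hi : i ∉ activeRings Φ t x) : J.ringIncrement i s t x = 0 := by
  by_cases hb : (canonical Φ).IsBorn i.1 x
  · rw [J.ringIncrement_of_isBorn hb]
    have h1 : t < (canonical Φ).ringTime i.1 i.2 x := by
      by_contra h
      exact hi ⟨hb, not_lt.1 h⟩
    exact J.increment_eq_zero hst
      (.inl ⟨h1, h1.trans (hx.ringTime_strictMono i.1 (Nat.lt_succ_self _))⟩)
  · exact J.ringIncrement_of_not_isBorn hb s t

variable (hΦ : Integrable (fun φ => total φ ^ 2) Φ)
include hΦ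

theorem memLp_ringIncrement (i : Ball d × ℕ) {s t : ℝ} (hs : 0 ≤ s) (hst : s ≤ t) :
    MemLp (J.ringIncrement i s t) 2 (sampleLaw Φ) := by
  obtain ⟨K, hK, h⟩ := J.exists_norm_le hs hst
  have hp : MeasurePreserving (fun x : Sample d => (x i).2) (sampleLaw Φ) Φ :=
    (measurePreserving_snd (μ := expMeasure 1) (ν := Φ)).comp
      (measurePreserving_eval_infinitePi (fun _ => markLaw Φ) i)
  have ht : MemLp (fun x : Sample d => K * (total (x i).2 + 2)) 2 (sampleLaw Φ) :=
    (((memLp_total hΦ).comp_measurePreserving hp).add (memLp_const 2)).const_mul K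
  refine ht.mono (J.measurable_ringIncrement i s t).aestronglyMeasurable (.of_forall fun x => ?_)
  refine le_trans ?_ (Real.le_norm_self _)
  by_cases hb : (canonical Φ).IsBorn i.1 x
  · rw [J.ringIncrement_of_isBorn hb]
    exact J.norm_increment_le h _ _ _
  · rw [J.ringIncrement_of_not_isBorn hb]
    simpa using mul_nonneg hK (add_nonneg (total_nonneg _) zero_le_two)

/-- An increment is nonzero only if its starting ring is active, which is independent of the draw
that bounds its size. The sum thus factors into a first moment and the expected number of active
rings; it permits exchanging sum and expectation in the martingale identity. -/
theorem tsum_lintegral_enorm_ringIncrement_lt_top {s t : ℝ} (hs : 0 ≤ s) (hst : s ≤ t) :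
    ∑' i, ∫⁻ x, ‖J.ringIncrement i s t x‖ₑ ∂sampleLaw Φ < ∞ := by
  obtain ⟨K, hK, h⟩ := J.exists_norm_le hs hst
  have hle : ∀ i : Ball d × ℕ, ∫⁻ x, ‖J.ringIncrement i s t x‖ₑ ∂sampleLaw Φ ≤
      (∫⁻ φ, ENNReal.ofReal (K * (total φ + 2)) ∂Φ) * sampleLaw Φ {x | i ∈ activeRings Φ t x} := by
    rintro ⟨v, k⟩
    have hf : Measurable (Function.uncurry fun (a : ℝ) (p : ℝ × Config d) =>
        (Set.Iic t).indicator 1 a * ENNReal.ofReal (K * (total p.2 + 2))) :=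
      ((measurable_one.indicator measurableSet_Iic).comp measurable_fst).mul
        ((measurable_of_countable fun φ : Config d => ENNReal.ofReal (K * (total φ + 2))).comp
          (measurable_snd.comp measurable_snd))
    have hS : MeasurableSet {x | (canonical Φ).ringTime v k x ≤ t} :=
      measurableSet_le ((canonical Φ).measurable_ringTime v k) measurable_const
    calc ∫⁻ x, ‖J.ringIncrement (v, k) s t x‖ₑ ∂sampleLaw Φ
        ≤ ∫⁻ x in {x | (canonical Φ).IsBorn v x},
          (Set.Iic t).indicator 1 ((canonical Φ).ringTime v k x) *
            ENNReal.ofReal (K * (total (x (v, k)).2 + 2)) ∂sampleLaw Φ := by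
          rw [← lintegral_indicator (measurableSet_isBorn Φ v)]
          refine lintegral_mono_ae ?_
          filter_upwards [ae_posGaps Φ] with x hx
          by_cases hi : (v, k) ∈ activeRings Φ t x
          · rw [J.ringIncrement_of_isBorn hi.1,
              Set.indicator_of_mem (s := {x | (canonical Φ).IsBorn v x}) hi.1,
              Set.indicator_of_mem (s := Set.Iic t) hi.2, Pi.one_apply, one_mul, ← ofReal_norm]
            exact ENNReal.ofReal_le_ofReal (J.norm_increment_le h _ _ _)
          · rw [J.ringIncrement_eq_zero hx hst hi]
            simp
      _ = _ := by
          rw [setLIntegral_resample Φ v k (f := fun a p =>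
            (Set.Iic t).indicator 1 a * ENNReal.ofReal (K * (total p.2 + 2))) hf]
          simp only [lintegral_const, measure_univ, mul_one]
          simp_rw [lintegral_const_mul _ (measurable_of_countable fun φ : Config d =>
            ENNReal.ofReal (K * (total φ + 2)))]
          have hone : Measurable fun x => (Set.Iic t).indicator (1 : ℝ → ℝ≥0∞)
              ((canonical Φ).ringTime v k x) := (measurable_one.indicator measurableSet_Iic).comp
            ((canonical Φ).measurable_ringTime v k)
          rw [lintegral_mul_const _ hone, mul_comm]
          congr 1
          have h1 := lintegral_indicator_one
            (μ := (sampleLaw Φ).restrict {x | (canonical Φ).IsBorn v x}) hS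
          rw [Measure.restrict_apply hS, Set.inter_comm] at h1
          exact h1
  refine (ENNReal.tsum_le_tsum hle).trans_lt ?_
  rw [ENNReal.tsum_mul_left]
  refine ENNReal.mul_lt_top ?_ (tsum_activeRings_lt_top hΦ t)
  exact (((integrable_total hΦ).add (integrable_const 2)).const_mul K).lintegral_lt_top

/-- When the mark `i` is resampled, the increment of `j` stays fixed while that of `i` averages to
zero. -/
theorem integral_inner_ringIncrement_of_le {i j : Ball d × ℕ} (h : j.1.length ≤ i.1.length)
    (h' : j.1 = i.1 → j.2 < i.2) {s t : ℝ} (hs : 0 ≤ s) (hst : s ≤ t) :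
    ∫ x, inner ℝ (J.ringIncrement i s t x) (J.ringIncrement j s t x) ∂sampleLaw Φ = 0 := by
  rw [integral_resample Φ i (integrable_inner_of_memLp (J.memLp_ringIncrement hΦ i hs hst)
    (J.memLp_ringIncrement hΦ j hs hst))]
  refine (integral_congr_ae (.of_forall fun x => ?_)).trans (integral_zero _ _)
  simp only [J.ringIncrement_update_of_le h h']
  by_cases hb : (canonical Φ).IsBorn i.1 x
  · simp only [J.ringIncrement_update hb]
    simp_rw [real_inner_comm (J.ringIncrement j s t x)]
    rw [integral_inner, J.integral_increment hΦ _ hs hst, inner_zero_right]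
    exact ((J.memLp_jumpOn hΦ i.1 hs hst _).sub (J.memLp_drift i.1 hs hst _)).integrable one_le_two
  · simp only [J.ringIncrement_update_of_not_isBorn hb, inner_zero_left, integral_zero]

theorem integral_inner_ringIncrement {i j : Ball d × ℕ} (hij : i ≠ j) {s t : ℝ} (hs : 0 ≤ s)
    (hst : s ≤ t) :
    ∫ x, inner ℝ (J.ringIncrement i s t x) (J.ringIncrement j s t x) ∂sampleLaw Φ = 0 := by
  -- Two distinct rings are always comparable: by index on a common clock, otherwise by the
  -- generation of the ball, where distinct balls of equal generation may be taken in either order.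
  have key : (j.1.length ≤ i.1.length ∧ (j.1 = i.1 → j.2 < i.2)) ∨
      (i.1.length ≤ j.1.length ∧ (i.1 = j.1 → i.2 < j.2)) := by
    by_cases hv : i.1 = j.1
    · have : i.2 ≠ j.2 := fun h => hij (Prod.ext hv h)
      rcases lt_or_gt_of_ne this with h | h
      · exact .inr ⟨by rw [hv], fun _ => h⟩
      · exact .inl ⟨by rw [hv], fun _ => h⟩
    · rcases le_total i.1.length j.1.length with h | h
      · exact .inr ⟨h, fun e => absurd e hv⟩
      · exact .inl ⟨h, fun e => absurd e.symm hv⟩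
  rcases key with ⟨h, h'⟩ | ⟨h, h'⟩
  · exact J.integral_inner_ringIncrement_of_le hΦ h h' hs hst
  · simp_rw [real_inner_comm (J.ringIncrement j s t _)]
    exact J.integral_inner_ringIncrement_of_le hΦ h h' hs hst

theorem lintegral_enorm_sum_ringIncrement_sq (F : Finset (Ball d × ℕ)) {s t : ℝ} (hs : 0 ≤ s)
    (hst : s ≤ t) :
    ∫⁻ x, ‖∑ i ∈ F, J.ringIncrement i s t x‖ₑ ^ 2 ∂sampleLaw Φ =
      ∑ i ∈ F, ∫⁻ x, ‖J.ringIncrement i s t x‖ₑ ^ 2 ∂sampleLaw Φ := by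
  have h : ∀ f : Sample d → ℂ, MemLp f 2 (sampleLaw Φ) →
      ∫⁻ x, ‖f x‖ₑ ^ 2 ∂sampleLaw Φ = ENNReal.ofReal (∫ x, ‖f x‖ ^ 2 ∂sampleLaw Φ) :=
    fun f hf => by
      rw [ofReal_integral_eq_lintegral_ofReal (hf.integrable_norm_pow two_ne_zero)
        (.of_forall fun y => by positivity)]
      refine lintegral_congr fun y => ?_
      rw [ENNReal.ofReal_pow (norm_nonneg _), ofReal_norm]
  have hL := fun i => J.memLp_ringIncrement hΦ i hs hst
  rw [h _ (memLp_finsetSum F fun i _ => hL i), Finset.sum_congr rfl fun i _ => h _ (hL i),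
    ← ENNReal.ofReal_sum_of_nonneg fun i _ => integral_nonneg fun x => by positivity]
  congr 1
  have hexp : ∀ x, ‖∑ i ∈ F, J.ringIncrement i s t x‖ ^ 2 = ∑ i ∈ F, ∑ j ∈ F,
      inner ℝ (J.ringIncrement i s t x) (J.ringIncrement j s t x) := fun x => by
    rw [← real_inner_self_eq_norm_sq, sum_inner]
    simp_rw [inner_sum]
  simp_rw [hexp]
  rw [integral_finsetSum _ fun i _ => integrable_finsetSum _ fun j _ =>
    integrable_inner_of_memLp (hL i) (hL j)]
  refine Finset.sum_congr rfl fun i hi => ?_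
  rw [integral_finsetSum _ fun j _ => integrable_inner_of_memLp (hL i) (hL j),
    Finset.sum_eq_single i]
  · simp_rw [real_inner_self_eq_norm_sq]
  · exact fun j _ hj => J.integral_inner_ringIncrement hΦ hj.symm hs hst
  · exact fun hi' => absurd hi hi'

/-- The expected quadratic variation over `(s, t]`. -/
def energy (s t : ℝ) : ℝ≥0∞ :=
  ∑' v, ∫⁻ r in Set.Ioc s t, (∫⁻ φ, ‖J.jump v r φ‖ₑ ^ 2 ∂Φ) * presence Φ v r

/-- Resampling the mark of a ring replaces the compensated increment by the bare jump without
changing the second moment, and the jumps of a clock are then summed by their compensator. -/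
theorem tsum_lintegral_enorm_ringIncrement_sq_le {s t : ℝ} (hs : 0 ≤ s) (hst : s ≤ t) :
    ∑' i, ∫⁻ x, ‖J.ringIncrement i s t x‖ₑ ^ 2 ∂sampleLaw Φ ≤ J.energy s t := by
  rw [ENNReal.tsum_prod', energy]
  refine ENNReal.tsum_le_tsum fun v => ?_
  have hf : Measurable fun p => ‖J.jumpOn v s t p‖ₑ ^ 2 := (J.measurable_jumpOn v s t).enorm.pow_const 2
  refine le_trans (le_of_eq (tsum_congr fun k => ?_))
    ((tsum_setLIntegral_ring_le Φ v hf).trans (le_of_eq ?_))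
  · have hI : Measurable (Function.uncurry fun (a : ℝ) (p : ℝ × Config d) =>
        ‖J.increment v s t a p‖ₑ ^ 2) := (J.measurable_increment v s t).enorm.pow_const 2
    have h1 : ∀ x, ‖J.ringIncrement (v, k) s t x‖ₑ ^ 2 =
        {x | (canonical Φ).IsBorn v x}.indicator (fun x => ‖J.increment v s t
          ((canonical Φ).ringTime v k x) ((canonical Φ).ringTime v (k + 1) x, (x (v, k)).2)‖ₑ ^ 2)
          x := fun x => by
      by_cases hb : (canonical Φ).IsBorn v x <;> simp [ringIncrement, hb]
    simp_rw [h1]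
    rw [lintegral_indicator (measurableSet_isBorn Φ v), setLIntegral_resample Φ v k hI,
      setLIntegral_resample Φ v k (f := fun _ p => ‖J.jumpOn v s t p‖ₑ ^ 2)
        (hf.comp measurable_snd)]
    refine lintegral_congr fun x => ?_
    have hm : Measurable fun y : ℝ × Config d => ((canonical Φ).ringTime v k x + y.1, y.2) :=
      (measurable_fst.const_add _).prodMk measurable_snd
    have hfm : Measurable fun y : ℝ × Config d =>
      ‖J.jumpOn v s t ((canonical Φ).ringTime v k x + y.1, y.2)‖ₑ ^ 2 := hf.comp hm
    have hIm : Measurable fun y : ℝ × Config d => ‖J.increment v s t ((canonical Φ).ringTime v k x)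
      ((canonical Φ).ringTime v k x + y.1, y.2)‖ₑ ^ 2 := 
      (hI.of_uncurry_left (x := (canonical Φ).ringTime v k x)).comp hm
    have := J.lintegral_enorm_increment_sq hΦ v hs hst ((canonical Φ).ringTime v k x)
    exact (lintegral_prod _ hIm.aemeasurable).symm.trans
      (this.trans (lintegral_prod _ hfm.aemeasurable))
  · rw [← lintegral_indicator measurableSet_Ioc]
    refine lintegral_congr fun r => ?_
    by_cases h : s < r ∧ r ≤ t
    · rw [Set.indicator_of_mem (Set.mem_Ioc.2 h)]
      simp [jumpOn, h]
    · rw [Set.indicator_of_notMem (by simpa using h)]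
      simp [jumpOn, h]

/-- A sum of compensated increments is bounded in mean square by their quadratic variation. -/
theorem lintegral_enorm_sq_le_energy {s t : ℝ} (hs : 0 ≤ s) (hst : s ≤ t) {Z : Sample d → ℂ}
    (hZ : ∀ᵐ x ∂sampleLaw Φ, HasSum (fun i => J.ringIncrement i s t x) (Z x)) :
    ∫⁻ x, ‖Z x‖ₑ ^ 2 ∂sampleLaw Φ ≤ J.energy s t := by
  -- Fatou's lemma needs a sequence, so a cofinal sequence of finite sets of rings is chosen.
  obtain ⟨F, hF⟩ := (atTop : Filter (Finset (Ball d × ℕ))).exists_seq_tendsto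
  calc ∫⁻ x, ‖Z x‖ₑ ^ 2 ∂sampleLaw Φ
      = ∫⁻ x, liminf (fun n => ‖∑ i ∈ F n, J.ringIncrement i s t x‖ₑ ^ 2) atTop ∂sampleLaw Φ := by
        refine lintegral_congr_ae ?_
        filter_upwards [hZ] with x hx
        exact ((((ENNReal.continuous_pow 2).comp continuous_enorm).tendsto _).comp
          (Tendsto.comp hx hF)).liminf_eq.symm
    _ ≤ liminf (fun n => ∫⁻ x, ‖∑ i ∈ F n, J.ringIncrement i s t x‖ₑ ^ 2 ∂sampleLaw Φ) atTop :=
        lintegral_liminf_le fun n => (Finset.measurable_fun_sum _ fun i _ =>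
          J.measurable_ringIncrement i s t).enorm.pow_const 2
    _ ≤ J.energy s t := by
        refine liminf_le_of_le (by isBoundedDefault) fun b hb => ?_
        obtain ⟨n, hn⟩ := hb.exists
        refine hn.trans ?_
        rw [J.lintegral_enorm_sum_ringIncrement_sq hΦ _ hs hst]
        exact (ENNReal.sum_le_tsum _).trans (J.tsum_lintegral_enorm_ringIncrement_sq_le hΦ hs hst)

/-- The compensated increments after time `s` are orthogonal to the process up to time `s`. -/
theorem setIntegral_ringIncrement (i : Ball d × ℕ) {s : ℝ≥0} {t : ℝ} (hst : s ≤ t)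
    {A : Set (Sample d)} (hA : MeasurableSet[(canonical Φ).filtration s] A) :
    ∫ x in A, J.ringIncrement i s t x ∂sampleLaw Φ = 0 := by
  have hs : (0 : ℝ) ≤ s := s.2
  obtain ⟨v, k⟩ := i
  have hAm : MeasurableSet A := (canonical Φ).filtration.le s A hA
  rw [Driving.filtration, Filtration.natural_eq_comap] at hA
  obtain ⟨B, -, rfl⟩ := hA
  rw [← integral_indicator hAm, integral_resample Φ (v, k)
    (((J.memLp_ringIncrement hΦ (v, k) hs hst).integrable one_le_two).indicator hAm)]
  refine (integral_congr_ae ?_).trans (integral_zero _ _)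
  filter_upwards [ae_posGaps Φ] with x hx
  by_cases hb : (canonical Φ).IsBorn v x
  swap
  · refine (integral_congr_ae (.of_forall fun y => ?_)).trans (integral_zero _ _)
    by_cases hA' : Function.update x (v, k) y ∈ ((fun ω (j : Set.Iic s) =>
        (canonical Φ).process j ω) ⁻¹' B)
    · rw [Set.indicator_of_mem hA', J.ringIncrement_update_of_not_isBorn hb]
    · exact Set.indicator_of_notMem hA' _
  set a := (canonical Φ).ringTime v k x with ha
  have ha0 : 0 ≤ a := hx.ringTime_nonneg v k
  -- A reference mark whose ring comes after `s`, because `a ≥ 0`; its draw plays no role. The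
  -- indicator of `A` can be frozen at this mark: if the true ring comes after `s`, the process up
  -- to `s` is the same for both marks, and otherwise the increment is zero.
  set y₀ : ℝ × Config d := (s + 1, 0) with hy₀
  have hx₀ : PosGaps (Function.update x (v, k) y₀) := hx.update _ (by simp only [hy₀]; linarith)
  have hgap₀ : s < (canonical Φ).ringTime v (k + 1) (Function.update x (v, k) y₀) := by
    rw [ringTime_succ_update]; simp only [hy₀]; linarith
  set A : Set (Sample d) := (fun ω (j : Set.Iic s) => (canonical Φ).process j ω) ⁻¹' B with hAdef
  have hcongr : ∀ᵐ y ∂markLaw Φ, A.indicator (J.ringIncrement (v, k) s t)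
      (Function.update x (v, k) y) =
      A.indicator (fun _ => (1 : ℂ)) (Function.update x (v, k) y₀) *
        J.increment v s t a (a + y.1, y.2) := by
    filter_upwards [ae_pos_markLaw Φ] with y hy
    have hval : J.ringIncrement (v, k) s t (Function.update x (v, k) y) =
        J.increment v s t a (a + y.1, y.2) := J.ringIncrement_update hb _ _ _
    by_cases hgap : (s : ℝ) < a + y.1
    · have hmem : Function.update x (v, k) y ∈ A ↔ Function.update x (v, k) y₀ ∈ A := by
        have : (fun j : Set.Iic s => (canonical Φ).process j (Function.update x (v, k) y)) =
            fun j : Set.Iic s => (canonical Φ).process j (Function.update x (v, k) y₀) := by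
          funext j
          have hj : ((j : ℝ≥0) : ℝ) ≤ s := NNReal.coe_le_coe.2 j.2
          refine process_eq_of_agree (hx.update _ hy) hx₀ (v := v) (k := k)
            (fun i hi => by rw [Function.update_of_ne hi, Function.update_of_ne hi])
            (hj.trans_lt ?_) (hj.trans_lt hgap₀)
          rwa [ringTime_succ_update]
        simp only [hAdef, Set.mem_preimage]
        rw [this]
      by_cases hA' : Function.update x (v, k) y₀ ∈ A
      · rw [Set.indicator_of_mem (hmem.2 hA'), Set.indicator_of_mem hA', hval, one_mul]
      · rw [Set.indicator_of_notMem (fun h => hA' (hmem.1 h)), Set.indicator_of_notMem hA',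
          zero_mul]
    · have h0 : J.increment v s t a (a + y.1, y.2) = 0 :=
        J.increment_eq_zero hst (.inr ⟨by linarith [not_lt.1 hgap], not_lt.1 hgap⟩)
      rw [h0, mul_zero]
      exact Set.indicator_apply_eq_zero.2 fun _ => hval.trans h0
  rw [integral_congr_ae hcongr, integral_const_mul, J.integral_increment hΦ v hs hst, mul_zero]

theorem setIntegral_eq_zero {s : ℝ≥0} {t : ℝ} (hst : s ≤ t)
    {Z : Sample d → ℂ} (hZ : ∀ᵐ x ∂sampleLaw Φ, HasSum (fun i => J.ringIncrement i s t x) (Z x)) :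
    ∀ A, MeasurableSet[(canonical Φ).filtration s] A → ∫ x in A, Z x ∂sampleLaw Φ = 0 := by
  intro A hA
  have hs : (0 : ℝ) ≤ s := s.2
  rw [integral_congr_ae (ae_restrict_of_ae (hZ.mono fun x hx => hx.tsum_eq.symm)), integral_tsum]
  · simp_rw [J.setIntegral_ringIncrement hΦ _ hst hA, tsum_zero]
  · exact fun i => (J.measurable_ringIncrement i s t).aestronglyMeasurable
  · refine ne_top_of_le_ne_top (J.tsum_lintegral_enorm_ringIncrement_lt_top hΦ hs hst).ne ?_
    exact ENNReal.tsum_le_tsum fun i => lintegral_mono' Measure.restrict_le_self le_rfl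

end JumpKernel

end BranchingWalk

/-! ### The Fourier transform as a compensated jump system -/

namespace BranchingWalk

variable {d : ℕ}

theorem character_add (u : EuclideanSpace ℝ (Fin d)) (x y : Site d) :
    character u (x + y) = character u x * character u y := by
  rw [character, character, character, ← Complex.exp_add, ← mul_add]
  congr 2
  norm_cast
  rw [← Finset.sum_add_distrib]
  exact Finset.sum_congr rfl fun i _ => by simp [mul_add]

theorem character_zero_right (u : EuclideanSpace ℝ (Fin d)) : character u 0 = 1 := by
  simp [character]

theorem character_zero_left (x : Site d) : character 0 x = 1 := by
  simp [character]

theorem norm_character (u : EuclideanSpace ℝ (Fin d)) (x : Site d) : ‖character u x‖ = 1 := by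
  rw [character, mul_comm, Complex.norm_exp_ofReal_mul_I]

/-- The Fourier transform of a finite configuration. -/
def configHat (u : EuclideanSpace ℝ (Fin d)) (φ : Config d) : ℂ :=
  φ.sum fun y n => (n : ℂ) * character u y

theorem norm_configHat_le (u : EuclideanSpace ℝ (Fin d)) (φ : Config d) :
    ‖configHat u φ‖ ≤ total φ := by
  refine (norm_sum_le _ _).trans (le_of_eq (Finset.sum_congr rfl fun y _ => ?_))
  rw [norm_mul, norm_character, mul_one, Complex.norm_natCast]

theorem configHat_zero (φ : Config d) : configHat 0 φ = (total φ : ℂ) := by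
  simp [configHat, total, Finsupp.sum, character_zero_left]

section

variable {Φ : Measure (Config d)}

theorem integrable_configHat (hT : Integrable (fun φ => total φ) Φ)
    (u : EuclideanSpace ℝ (Fin d)) : Integrable (configHat u) Φ :=
  hT.mono' (measurable_of_countable _).aestronglyMeasurable
    (.of_forall fun φ => norm_configHat_le u φ)

theorem integral_configHat (hT : Integrable (fun φ => total φ) Φ)
    (u : EuclideanSpace ℝ (Fin d)) : ∫ φ, configHat u φ ∂Φ = intensityHat Φ u := by
  have hsum : ∀ φ : Config d, configHat u φ = ∑' y, character u y * (φ y : ℂ) := fun φ => by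
    rw [tsum_eq_sum (s := φ.support) (fun y hy => by simp [Finsupp.notMem_support_iff.1 hy])]
    exact Finset.sum_congr rfl fun y _ => mul_comm _ _
  simp_rw [hsum]
  rw [integral_tsum, intensityHat]
  · refine tsum_congr fun y => ?_
    rw [integral_const_mul, intensity, ← integral_complex_ofReal]
    simp
  · exact fun y => (measurable_of_countable _).aestronglyMeasurable
  · rw [← lintegral_tsum fun y => (measurable_of_countable _).aemeasurable]
    refine ne_top_of_le_ne_top hT.lintegral_lt_top.ne (lintegral_mono fun φ => le_of_eq ?_)
    have := tsum_mul_ofReal φ (g := fun _ => 1) fun _ => zero_le_one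
    simp only [ENNReal.ofReal_one, mul_one, one_mul] at this
    rw [total, ← this]
    refine tsum_congr fun y => ?_
    rw [enorm_mul, ← ofReal_norm, norm_character, ← ofReal_norm, Complex.norm_natCast]
    simp

theorem intensityHat_zero (hT : Integrable (fun φ => total φ) Φ) :
    intensityHat Φ 0 = (meanTotal Φ : ℂ) := by
  rw [← integral_configHat hT, meanTotal, ← integral_complex_ofReal]
  simp_rw [configHat_zero]

theorem re_intensityHat_le (hT : Integrable (fun φ => total φ) Φ)
    (u : EuclideanSpace ℝ (Fin d)) : (intensityHat Φ u).re ≤ meanTotal Φ := by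
  refine (Complex.re_le_norm _).trans ?_
  rw [← integral_configHat hT]
  exact (norm_integral_le_integral_norm _).trans
    (integral_mono (integrable_configHat hT u).norm hT fun φ => norm_configHat_le u φ)

/-- The factor `exp (-μ̂(u) r)`. -/
def damping (Φ : Measure (Config d)) (u : EuclideanSpace ℝ (Fin d)) (r : ℝ) : ℂ :=
  Complex.exp (-(intensityHat Φ u) * (r : ℂ))

theorem norm_damping (u : EuclideanSpace ℝ (Fin d)) (r : ℝ) :
    ‖damping Φ u r‖ = Real.exp (-(intensityHat Φ u).re * r) := by
  rw [damping, Complex.norm_exp]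
  simp

theorem hasDerivAt_damping (u : EuclideanSpace ℝ (Fin d)) (r : ℝ) :
    HasDerivAt (damping Φ u) (-(intensityHat Φ u) * damping Φ u r) r := by
  have h : HasDerivAt (fun r : ℝ => -(intensityHat Φ u) * (r : ℂ)) (-(intensityHat Φ u)) r := by
    simpa using (hasDerivAt_id r).ofReal_comp.const_mul (-(intensityHat Φ u))
  rw [mul_comm]
  exact h.cexp

theorem continuous_damping (u : EuclideanSpace ℝ (Fin d)) : Continuous (damping Φ u) :=
  continuous_iff_continuousAt.2 fun r => (hasDerivAt_damping u r).continuousAt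

/-- The jumps of the Fourier martingale and their compensator. -/
def fourierKernel (hT : Integrable (fun φ => total φ) Φ) (u : EuclideanSpace ℝ (Fin d)) :
    JumpKernel Φ where
  jump v r φ := character u (position v) * damping Φ u r * configHat u φ
  drift v r := -(character u (position v) * damping Φ u r)
  rate v r := character u (position v) * damping Φ u r * intensityHat Φ u
  continuous_jump v φ := (continuous_const.mul (continuous_damping u)).mul continuous_const
  continuous_rate v := (continuous_const.mul (continuous_damping u)).mul continuous_const
  hasDerivAt_drift v r := by
    have := ((hasDerivAt_damping (Φ := Φ) u r).const_mul (character u (position v))).neg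
    rwa [show -(character u (position v) * (-(intensityHat Φ u) * damping Φ u r)) =
      character u (position v) * damping Φ u r * intensityHat Φ u by ring] at this
  integral_jump v r := by rw [integral_const_mul, integral_configHat hT]
  exists_bound t := by
    refine ⟨Real.exp (|(intensityHat Φ u).re| * t), (Real.exp_pos _).le, fun v r hr => ?_⟩
    have h : ‖character u (position v) * damping Φ u r‖ ≤
        Real.exp (|(intensityHat Φ u).re| * t) := by
      rw [norm_mul, norm_character, one_mul, norm_damping]
      refine Real.exp_le_exp.2 ?_
      calc -(intensityHat Φ u).re * r ≤ |(intensityHat Φ u).re| * r :=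
            mul_le_mul_of_nonneg_right (neg_le_abs _) hr.1
        _ ≤ _ := mul_le_mul_of_nonneg_left hr.2 (abs_nonneg _)
    refine ⟨fun φ => ?_, by rwa [norm_neg]⟩
    rw [norm_mul]
    exact mul_le_mul h (norm_configHat_le u φ) (norm_nonneg _) (Real.exp_pos _).le

/-- The difference of two systems of compensated jumps. -/
def JumpKernel.sub (J J' : JumpKernel Φ) (hJ : ∀ v r, Integrable (J.jump v r) Φ)
    (hJ' : ∀ v r, Integrable (J'.jump v r) Φ) : JumpKernel Φ where
  jump v r φ := J.jump v r φ - J'.jump v r φ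
  drift v r := J.drift v r - J'.drift v r
  rate v r := J.rate v r - J'.rate v r
  continuous_jump v φ := (J.continuous_jump v φ).sub (J'.continuous_jump v φ)
  continuous_rate v := (J.continuous_rate v).sub (J'.continuous_rate v)
  hasDerivAt_drift v r := (J.hasDerivAt_drift v r).sub (J'.hasDerivAt_drift v r)
  integral_jump v r := by
    rw [integral_sub (hJ v r) (hJ' v r), J.integral_jump, J'.integral_jump]
  exists_bound t := by
    obtain ⟨K, hK, h⟩ := J.exists_bound t
    obtain ⟨K', hK', h'⟩ := J'.exists_bound t
    refine ⟨K + K', add_nonneg hK hK', fun v r hr => ⟨fun φ => ?_, ?_⟩⟩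
    · rw [add_mul]
      exact (norm_sub_le _ _).trans (add_le_add ((h v r hr).1 φ) ((h' v r hr).1 φ))
    · exact (norm_sub_le _ _).trans (add_le_add (h v r hr).2 (h' v r hr).2)

theorem JumpKernel.ringIncrement_sub [IsProbabilityMeasure Φ] (J J' : JumpKernel Φ)
    (hJ : ∀ v r, Integrable (J.jump v r) Φ) (hJ' : ∀ v r, Integrable (J'.jump v r) Φ)
    (i : Ball d × ℕ) (s t : ℝ) (x : Sample d) :
    (J.sub J' hJ hJ').ringIncrement i s t x =
      J.ringIncrement i s t x - J'.ringIncrement i s t x := by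
  by_cases hb : (canonical Φ).IsBorn i.1 x
  · simp only [ringIncrement_of_isBorn _ hb, increment, jumpOn, JumpKernel.sub]
    split_ifs <;> ring
  · simp only [ringIncrement_of_not_isBorn _ hb, sub_zero]

end

theorem Driving.processHat_eq_sum {Φ : Measure (Config d)} {Ω : Type*} [MeasurableSpace Ω]
    {P : Measure Ω} (D : Driving Φ P) (u : EuclideanSpace ℝ (Fin d)) {t : ℝ≥0} {ω : Ω}
    {S : Finset (Ball d)} (hS : D.population t ω = S) :
    D.processHat u t ω = ∑ v ∈ S, character u (position v) := by
  classical
  have hp : ∀ y, D.process t ω y = (S.filter fun v => position v = y).card := fun y => by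
    rw [Driving.process, hS, ← Set.ncard_coe_finset, Finset.coe_filter]
    rfl
  rw [Driving.processHat, tsum_eq_sum (s := S.image position), Finset.sum_comp]
  · refine Finset.sum_congr rfl fun y _ => ?_
    rw [hp, nsmul_eq_mul, mul_comm]
  · intro y hy
    rw [hp, Finset.filter_eq_empty_iff.2]
    · simp
    · intro v hv h
      exact hy (Finset.mem_image.2 ⟨v, hv, h⟩)

theorem hasSum_ite_lt (φ : Config d) (h : Site d → ℂ) :
    HasSum (fun a : Site d × ℕ => if a.2 < φ a.1 then h a.1 else 0)
      (φ.sum fun y n => (n : ℂ) * h y) := by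
  have hle : ∀ y, φ y ≤ φ.support.sup φ := fun y => by
    by_cases hy : y ∈ φ.support
    · exact Finset.le_sup hy
    · simp [Finsupp.notMem_support_iff.1 hy]
  have : φ.sum (fun y n => (n : ℂ) * h y) =
      ∑ a ∈ φ.support ×ˢ Finset.range (φ.support.sup φ), if a.2 < φ a.1 then h a.1 else 0 := by
    rw [Finset.sum_product, Finsupp.sum]
    refine Finset.sum_congr rfl fun y _ => ?_
    simp only
    rw [← Finset.sum_filter, Finset.sum_const, nsmul_eq_mul]
    congr 2
    have : (Finset.range (φ.support.sup φ)).filter (fun m => m < φ y) = Finset.range (φ y) := by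
      ext m
      simp only [Finset.mem_filter, Finset.mem_range]
      exact ⟨fun h => h.2, fun h => ⟨h.trans_le (hle y), h⟩⟩
    rw [this, Finset.card_range]
  rw [this]
  refine hasSum_sum_of_ne_finset_zero fun a ha => if_neg fun hlt => ha ?_
  rw [Finset.mem_product]
  exact ⟨Finsupp.mem_support_iff.2 (Nat.ne_zero_of_lt hlt), Finset.mem_range.2 (hlt.trans_le (hle _))⟩

/-! ### Decomposition of the Fourier martingale into ring increments -/

section

variable {Φ : Measure (Config d)} [IsProbabilityMeasure Φ]

theorem finite_population_of_finite_activeRings {x : Sample d} {t : ℝ≥0}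
    (h : (activeRings Φ t x).Finite) : ((canonical Φ).population t x).Finite := by
  refine (h.image Prod.fst).subset fun v hv => ⟨(v, 0), ⟨hv.1, ?_⟩, rfl⟩
  simpa [Driving.ringTime_zero] using hv.2

/-- Every ball except the first is produced by exactly one ring of one parent, so the terms of the
balls born in `(s, t]` can be regrouped by parent and ring. Multiplicativity of the character turns
the children of one ring into its jump. -/
theorem sum_jumpOn_fourierKernel (hT : Integrable (fun φ => total φ) Φ)
    (u : EuclideanSpace ℝ (Fin d)) {x : Sample d} (hx : PosGaps x) {s t : ℝ≥0}
    {S : Finset (Ball d)} (hS : (canonical Φ).population t x = S) {N : ℕ}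
    (hN : ∀ v ∈ S, (t : ℝ) < (canonical Φ).ringTime v N x) :
    ∑ v ∈ S, ∑ k ∈ Finset.range N, (fourierKernel hT u).jumpOn v s t
        ((canonical Φ).ringTime v (k + 1) x, (x (v, k)).2) =
      ∑ w ∈ S, if (s : ℝ) < (canonical Φ).birth w x then
        character u (position w) * damping Φ u ((canonical Φ).birth w x) else 0 := by
  classical
  have hmem : ∀ w, w ∈ S ↔ (canonical Φ).IsBorn w x ∧ (canonical Φ).birth w x ≤ t := fun w => by
    rw [← Finset.mem_coe, ← hS]
    rfl
  set f : Ball d → ℂ := fun w => if w ∈ S then (if (s : ℝ) < (canonical Φ).birth w x then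
    character u (position w) * damping Φ u ((canonical Φ).birth w x) else 0) else 0 with hf
  have hf0 : ∀ w, w ∉ S → f w = 0 := fun w hw => if_neg hw
  -- The initial ball has no parent; being born at time `0`, it is never born in `(s, t]`.
  have hnil : f [] = 0 := by
    have : ¬ (s : ℝ) < (canonical Φ).birth [] x := not_lt.2 s.2
    simp [hf, this]
  have hfs : Summable f := summable_of_ne_finset_zero hf0
  have hinj : Function.Injective fun p : (Ball d × ℕ) × (Site d × ℕ) => (p.1.2, p.2) :: p.1.1 := by
    rintro ⟨⟨v, k⟩, a⟩ ⟨⟨w, l⟩, b⟩ h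
    simp only [List.cons.injEq, Prod.mk.injEq] at h
    simp [h.1.1, h.1.2, h.2]
  have hgs : Summable fun p : (Ball d × ℕ) × (Site d × ℕ) => f ((p.1.2, p.2) :: p.1.1) :=
    hfs.comp_injective hinj
  have hinj' : Function.Injective fun p : Ball d × (ℕ × Site d × ℕ) => p.2 :: p.1 := by
    rintro ⟨v, a⟩ ⟨w, b⟩ h
    simp only [List.cons.injEq] at h
    simp [h.1, h.2]
  have hinner : ∀ v k, ∑' a : Site d × ℕ, f ((k, a) :: v) =
      if v ∈ S then (fourierKernel hT u).jumpOn v s t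
        ((canonical Φ).ringTime v (k + 1) x, (x (v, k)).2) else 0 := by
    intro v k
    split_ifs with hv
    · rw [JumpKernel.jumpOn]
      split_ifs with hst
      · have := (hasSum_ite_lt (x (v, k)).2 fun y => character u (position v + y) *
          damping Φ u ((canonical Φ).ringTime v (k + 1) x)).tsum_eq
        rw [show (fourierKernel hT u).jump v ((canonical Φ).ringTime v (k + 1) x) (x (v, k)).2 =
          (x (v, k)).2.sum fun y n => (n : ℂ) * (character u (position v + y) *
          damping Φ u ((canonical Φ).ringTime v (k + 1) x)) from ?_, ← this]
        · refine tsum_congr fun a => ?_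
          have hiff : (k, a) :: v ∈ S ↔ a.2 < (x (v, k)).2 a.1 := by
            rw [hmem]
            exact ⟨fun h => h.1.2, fun h => ⟨⟨((hmem v).1 hv).1, h⟩, hst.2⟩⟩
          simp only [hf, hiff]
          congr 1
          exact if_pos hst.1
        · simp only [fourierKernel, configHat, Finsupp.sum, Finset.mul_sum, character_add]
          exact Finset.sum_congr rfl fun y _ => by ring
      · refine (tsum_congr fun a => ?_).trans tsum_zero
        by_cases hw : (k, a) :: v ∈ S
        · have h2 := ((hmem _).1 hw).2
          simp only [hf, hw, if_true]
          exact if_neg fun h1 => hst ⟨h1, h2⟩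
        · exact hf0 _ hw
    · refine (tsum_congr fun a => hf0 _ fun hw => hv ?_).trans tsum_zero
      rw [hmem] at hw ⊢
      exact ⟨hw.1.1, (hx.birth_le_ringTime v _).trans hw.2⟩
  have hS' : ∑ w ∈ S, (if (s : ℝ) < (canonical Φ).birth w x then
        character u (position w) * damping Φ u ((canonical Φ).birth w x) else 0) = ∑' w, f w := by
    rw [tsum_eq_sum (s := S) hf0]
    exact Finset.sum_congr rfl fun w hw => (if_pos hw).symm
  rw [hS', tsum_list f (hfs.comp_injective hinj'), hnil, zero_add,
    ← (Equiv.prodAssoc (Ball d) ℕ (Site d × ℕ)).tsum_eq]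
  change _ = ∑' p : (Ball d × ℕ) × (Site d × ℕ), f ((p.1.2, p.2) :: p.1.1)
  rw [hgs.tsum_prod, tsum_eq_sum (s := S ×ˢ Finset.range N), Finset.sum_product]
  · refine Finset.sum_congr rfl fun v hv => Finset.sum_congr rfl fun k _ => ?_
    rw [hinner, if_pos hv]
  · rintro ⟨v, k⟩ hvk
    simp only
    rw [hinner]
    split_ifs with hv
    · have hk : N ≤ k := by
        by_contra h
        exact hvk (Finset.mem_product.2 ⟨hv, Finset.mem_range.2 (not_le.1 h)⟩)
      refine if_neg fun h => absurd ((hN v hv).trans_le ?_) (not_lt.2 h.2)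
      exact (hx.ringTime_strictMono v).monotone (hk.trans (Nat.le_succ _))
    · rfl

/-- The increments of the Fourier martingale are sums of compensated increments. -/
theorem hasSum_ringIncrement_fourierKernel (hT : Integrable (fun φ => total φ) Φ)
    (u : EuclideanSpace ℝ (Fin d)) {x : Sample d} (hx : PosGaps x) {s t : ℝ≥0} (hst : s ≤ t)
    (hfin : (activeRings Φ t x).Finite) :
    HasSum (fun i => (fourierKernel hT u).ringIncrement i s t x)
      ((canonical Φ).fourierMartingale u t x - (canonical Φ).fourierMartingale u s x) := by
  classical
  have hst' : (s : ℝ) ≤ t := NNReal.coe_le_coe.2 hst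
  obtain ⟨S, hS⟩ := (finite_population_of_finite_activeRings hfin).exists_finset_coe
  have hmem : ∀ w, w ∈ S ↔ (canonical Φ).IsBorn w x ∧ (canonical Φ).birth w x ≤ t := fun w => by
    rw [← Finset.mem_coe, hS]
    rfl
  -- Beyond index `N` no ring of any ball is active, so every clock can be cut off at the same
  -- number of rings.
  set N := (hfin.toFinset.sup Prod.snd) + 1 with hNdef
  have hk : ∀ i ∈ activeRings Φ t x, i.2 < N := fun i hi =>
    Nat.lt_succ_of_le (Finset.le_sup (f := Prod.snd) (hfin.mem_toFinset.2 hi))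
  have hN : ∀ v ∈ S, (t : ℝ) < (canonical Φ).ringTime v N x := by
    intro v hv
    by_contra h
    exact lt_irrefl _ (hk (v, N) ⟨((hmem v).1 hv).1, not_lt.1 h⟩)
  have hpops : (canonical Φ).population s x =
      (S.filter fun v => (canonical Φ).birth v x ≤ s : Finset (Ball d)) := by
    ext v
    simp only [Finset.coe_filter, Set.mem_ofPred_eq, hmem]
    exact ⟨fun h => ⟨⟨h.1, h.2.trans hst'⟩, h.2⟩, fun h => ⟨h.1.1, h.2⟩⟩
  have hval : (canonical Φ).fourierMartingale u t x - (canonical Φ).fourierMartingale u s x =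
      ∑ i ∈ S ×ˢ Finset.range N, (fourierKernel hT u).ringIncrement i s t x := by
    have h1 : ∀ v ∈ S, ∀ k, (fourierKernel hT u).ringIncrement (v, k) s t x =
        (fourierKernel hT u).jumpOn v s t ((canonical Φ).ringTime v (k + 1) x, (x (v, k)).2) -
        ((fourierKernel hT u).drift v (clamp s t ((canonical Φ).ringTime v (k + 1) x)) -
          (fourierKernel hT u).drift v (clamp s t ((canonical Φ).ringTime v k x))) :=
      fun v hv k => JumpKernel.ringIncrement_of_isBorn _ ((hmem v).1 hv).1 _ _
    -- The drifts telescope along the clock of `v`, from its birth to a ring after `t`, where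
    -- clamping returns `t`.
    have h2 : ∀ v ∈ S, ∑ k ∈ Finset.range N, (fourierKernel hT u).ringIncrement (v, k) s t x =
        ∑ k ∈ Finset.range N, (fourierKernel hT u).jumpOn v s t
          ((canonical Φ).ringTime v (k + 1) x, (x (v, k)).2) -
        ((fourierKernel hT u).drift v t -
          (fourierKernel hT u).drift v (clamp s t ((canonical Φ).birth v x))) := by
      intro v hv
      rw [Finset.sum_congr rfl fun k _ => h1 v hv k, Finset.sum_sub_distrib,
        Finset.sum_range_sub (fun k => (fourierKernel hT u).drift v
          (clamp s t ((canonical Φ).ringTime v k x))), clamp_of_ge hst' (hN v hv).le,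
        Driving.ringTime_zero]
    rw [Finset.sum_product, Finset.sum_congr rfl h2, Finset.sum_sub_distrib,
      sum_jumpOn_fourierKernel hT u hx hS.symm hN, ← Finset.sum_sub_distrib,
      Driving.fourierMartingale, Driving.fourierMartingale, Driving.processHat_eq_sum _ u hS.symm,
      Driving.processHat_eq_sum _ u hpops, Finset.mul_sum, Finset.mul_sum, Finset.sum_filter,
      ← Finset.sum_sub_distrib]
    refine Finset.sum_congr rfl fun v hv => ?_
    change damping Φ u t * _ - (if _ then damping Φ u s * _ else 0) = _
    simp only [fourierKernel]
    -- A ball born after `s` enters at its birth and is damped from there; an older one is damped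
    -- from `s` on.
    rcases lt_or_ge (s : ℝ) ((canonical Φ).birth v x) with h | h
    · rw [if_neg (not_le.2 h), if_pos h, clamp_of_mem h.le ((hmem v).1 hv).2]
      ring
    · rw [if_pos h, if_neg (not_lt.2 h), clamp_of_le hst' h]
      ring
  rw [hval]
  refine hasSum_sum_of_ne_finset_zero fun i hi => ?_
  refine JumpKernel.ringIncrement_eq_zero _ hx hst' fun hia => hi ?_
  rw [Finset.mem_product, hmem, Finset.mem_range]
  exact ⟨⟨hia.1, (hx.birth_le_ringTime _ _).trans hia.2⟩, hk i hia⟩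

theorem fourierMartingale_zero_time (u : EuclideanSpace ℝ (Fin d)) {x : Sample d}
    (hx : PosGaps x) : (canonical Φ).fourierMartingale u 0 x = 1 := by
  have : (canonical Φ).population 0 x = (({[]} : Finset (Ball d)) : Set (Ball d)) := by
    ext v
    rw [Finset.coe_singleton, Set.mem_singleton_iff]
    constructor
    · intro h
      rcases v with _ | ⟨a, v⟩
      · rfl
      · exact absurd (hx.birth_cons_pos (Φ := Φ) a v) (not_lt.2 h.2)
    · rintro rfl
      exact ⟨trivial, le_rfl⟩
  rw [Driving.fourierMartingale, Driving.processHat_eq_sum _ u this]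
  simp [position, character_zero_right]

theorem ae_hasSum_ringIncrement (hΦ : Integrable (fun φ => total φ ^ 2) Φ)
    (u : EuclideanSpace ℝ (Fin d)) {s t : ℝ≥0} (hst : s ≤ t) :
    ∀ᵐ x ∂sampleLaw Φ,
      HasSum (fun i => (fourierKernel (integrable_total hΦ) u).ringIncrement i s t x)
        ((canonical Φ).fourierMartingale u t x - (canonical Φ).fourierMartingale u s x) := by
  filter_upwards [ae_posGaps Φ, ae_finite_activeRings hΦ] with x hx hfin
  exact hasSum_ringIncrement_fourierKernel _ u hx hst (hfin t)

end

end BranchingWalk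

theorem Complex.norm_exp_sub_exp_le {z w : ℂ} {c : ℝ} (hz : z.re ≤ c) (hw : w.re ≤ c) :
    ‖Complex.exp z - Complex.exp w‖ ≤ Real.exp c * ‖z - w‖ := by
  refine (convex_halfSpace_re_le c).norm_image_sub_le_of_norm_hasDerivWithin_le
    (f := Complex.exp) (f' := Complex.exp) (fun x _ => (Complex.hasDerivAt_exp x).hasDerivWithinAt)
    (fun x hx => ?_) hw hz
  rw [Complex.norm_exp]
  exact Real.exp_le_exp.2 hx

theorem lintegral_exp_Ioc_le {K δ : ℝ} (hK : 0 ≤ K) (hδ : 0 < δ) (s t : ℝ) :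
    ∫⁻ r in Set.Ioc s t, ENNReal.ofReal (K * Real.exp (-δ * r)) ≤
      ENNReal.ofReal (K * (Real.exp (-δ * s) / δ)) := by
  refine (lintegral_mono_set Set.Ioc_subset_Ioi_self).trans (le_of_eq ?_)
  rw [← ofReal_integral_eq_lintegral_ofReal
    ((integrableOn_exp_mul_Ioi (neg_lt_zero.2 hδ) s).const_mul K)
    (.of_forall fun r => by positivity), integral_const_mul,
    integral_exp_mul_Ioi (neg_lt_zero.2 hδ), neg_div_neg_eq]

/-! ### Energy estimates -/

namespace BranchingWalk

variable {d : ℕ}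

theorem siteNorm_eq (x : Site d) : siteNorm x = ‖WithLp.toLp 2 fun i => (x i : ℝ)‖ := by
  simp [siteNorm, EuclideanSpace.norm_eq]

theorem siteNorm_nonneg (x : Site d) : 0 ≤ siteNorm x := Real.sqrt_nonneg _

theorem siteNorm_add_le (x y : Site d) : siteNorm (x + y) ≤ siteNorm x + siteNorm y := by
  simp only [siteNorm_eq]
  refine le_trans (le_of_eq ?_) (norm_add_le _ _)
  congr 1
  ext i
  simp

theorem siteNorm_position_le (v : Ball d) : siteNorm (position v) ≤ pathLength v := by
  induction v with
  | nil => simp [position, pathLength, siteNorm]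
  | cons a v ih => exact (siteNorm_add_le _ _).trans (add_le_add ih le_rfl)

theorem norm_character_sub_one_le (u : EuclideanSpace ℝ (Fin d)) (x : Site d) :
    ‖character u x - 1‖ ≤ ‖u‖ * siteNorm x := by
  have h : ∑ i, u i * (x i : ℝ) = inner ℝ (WithLp.toLp 2 fun i => (x i : ℝ)) u := by
    simp [PiLp.inner_apply]
  rw [character]
  refine (Real.norm_exp_I_mul_ofReal_sub_one_le).trans ?_
  rw [h, siteNorm_eq, mul_comm]
  exact norm_inner_le_norm _ _

theorem norm_configHat_sub_total_le (u : EuclideanSpace ℝ (Fin d)) (φ : Config d) :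
    ‖configHat u φ - total φ‖ ≤ ‖u‖ * displacement 1 φ := by
  have : configHat u φ - total φ = ∑ y ∈ φ.support, (φ y : ℂ) * (character u y - 1) := by
    simp [configHat, total, Finsupp.sum, mul_sub]
  rw [this, displacement, Finsupp.sum, Finset.mul_sum]
  refine (norm_sum_le _ _).trans (Finset.sum_le_sum fun y _ => ?_)
  rw [norm_mul, Complex.norm_natCast, pow_one, ← mul_assoc, mul_comm]
  exact mul_le_mul_of_nonneg_right (norm_character_sub_one_le u y) (Nat.cast_nonneg _)

theorem displacement_nonneg (r : ℕ) (φ : Config d) : 0 ≤ displacement r φ :=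
  Finset.sum_nonneg fun _ _ => mul_nonneg (pow_nonneg (siteNorm_nonneg _) _) (Nat.cast_nonneg _)

section

variable {Φ : Measure (Config d)}

/-- The constant in the comparison of the Fourier martingales at two frequencies. -/
def compareConst (Φ : Measure (Config d)) (δ : ℝ) : ℝ :=
  (∫ φ, (displacement 1 φ + total φ) ^ 2 ∂Φ) * (1 + 8 * (∫ φ, displacement 1 φ ∂Φ) / δ) ^ 2 *
    (1 + 4 * (2 * (∫ φ, displacement 1 φ ∂Φ) + ∫ φ, displacement 2 φ ∂Φ) / δ) ^ 2 * (2 / δ)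

theorem compareConst_nonneg {δ : ℝ} (hδ : 0 ≤ δ) : 0 ≤ compareConst Φ δ := by
  have : 0 ≤ ∫ φ, (displacement 1 φ + total φ) ^ 2 ∂Φ := integral_nonneg fun φ => sq_nonneg _
  unfold compareConst
  positivity

theorem compareConst_anti {δ δ' : ℝ} (hδ : 0 < δ) (h : δ ≤ δ') :
    compareConst Φ δ' ≤ compareConst Φ δ := by
  have h0 : 0 ≤ ∫ φ, (displacement 1 φ + total φ) ^ 2 ∂Φ := integral_nonneg fun φ => sq_nonneg _
  have h1 : 0 ≤ ∫ φ, displacement 1 φ ∂Φ := integral_nonneg fun φ => displacement_nonneg 1 φ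
  have h2 : 0 ≤ ∫ φ, displacement 2 φ ∂Φ := integral_nonneg fun φ => displacement_nonneg 2 φ
  have hδ' := hδ.trans_le h
  unfold compareConst
  gcongr

/-- The two jumps differ in three factors: the transform of the draw, the character of the position
and the damping. Each difference is of first order in `u`, with slopes given by the displacement of
the draw, the path length, and the mean displacement times `r`. -/
theorem norm_jump_sub_le (hT : Integrable (fun φ => total φ) Φ)
    (h1 : Integrable (fun φ => displacement 1 φ) Φ) (u : EuclideanSpace ℝ (Fin d)) (v : Ball d)
    {r : ℝ} (hr : 0 ≤ r) (φ : Config d) :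
    ‖(fourierKernel hT u).jump v r φ - (fourierKernel hT 0).jump v r φ‖ ≤
      ‖u‖ * Real.exp (-(intensityHat Φ u).re * r) * (displacement 1 φ + total φ *
        (pathLength v + (∫ φ, displacement 1 φ ∂Φ) * r)) := by
  set a := ∫ φ, displacement 1 φ ∂Φ
  have hTo : Integrable (fun φ => (total φ : ℂ)) Φ := hT.ofReal
  have hμ : ‖intensityHat Φ u - meanTotal Φ‖ ≤ ‖u‖ * a := by
    rw [← integral_configHat hT, meanTotal, ← integral_complex_ofReal,
      ← integral_sub (integrable_configHat hT u) hTo, ← integral_const_mul]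
    exact (norm_integral_le_integral_norm _).trans (integral_mono_of_nonneg
      (.of_forall fun _ => norm_nonneg _) (h1.const_mul _)
      (.of_forall fun φ => norm_configHat_sub_total_le u φ))
  have hdamp : ‖damping Φ u r - damping Φ 0 r‖ ≤
      Real.exp (-(intensityHat Φ u).re * r) * (‖u‖ * a * r) := by
    rw [damping, damping]
    -- Since `Re μ̂(u) ≤ λ = μ̂(0)`, the larger of the two exponents is the one at `u`.
    refine (Complex.norm_exp_sub_exp_le (c := -(intensityHat Φ u).re * r) (by simp) ?_).trans ?_
    · rw [intensityHat_zero hT]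
      have := re_intensityHat_le hT u
      simp only [Complex.mul_re, Complex.neg_re, Complex.ofReal_re, Complex.neg_im,
        Complex.ofReal_im, mul_zero, sub_zero]
      nlinarith
    · rw [intensityHat_zero hT, ← sub_mul, norm_mul, Complex.norm_of_nonneg hr]
      gcongr
      rwa [← norm_neg, neg_sub_neg, neg_sub]
  have hdec : (fourierKernel hT u).jump v r φ - (fourierKernel hT 0).jump v r φ =
      character u (position v) * damping Φ u r * (configHat u φ - total φ) +
      (total φ : ℂ) * ((character u (position v) - 1) * damping Φ u r) +
      (total φ : ℂ) * (damping Φ u r - damping Φ 0 r) := by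
    simp only [fourierKernel, character_zero_left, configHat_zero]
    ring
  have hchar : ‖character u (position v) - 1‖ ≤ ‖u‖ * pathLength v :=
    (norm_character_sub_one_le u _).trans
      (mul_le_mul_of_nonneg_left (siteNorm_position_le v) (norm_nonneg _))
  rw [hdec]
  refine (norm_add₃_le).trans ?_
  simp only [norm_mul, norm_character, one_mul, norm_damping,
    Complex.norm_of_nonneg (total_nonneg φ)]
  calc _ ≤ Real.exp (-(intensityHat Φ u).re * r) * (‖u‖ * displacement 1 φ) +
        total φ * (‖u‖ * pathLength v * Real.exp (-(intensityHat Φ u).re * r)) +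
        total φ * (Real.exp (-(intensityHat Φ u).re * r) * (‖u‖ * a * r)) := by
        have := total_nonneg φ
        gcongr
        exact norm_configHat_sub_total_le u φ
    _ = _ := by ring

/-- Expanding the square gives the factor `λ` plus terms of lower order in `α + ℓ`. A large offset
`α` absorbs these into an arbitrarily small increase `ε` of the growth rate. -/
theorem lintegral_weight_le (hT : Integrable (fun φ => total φ) Φ)
    (h1 : Integrable (fun φ => displacement 1 φ) Φ)
    (h2 : Integrable (fun φ => displacement 2 φ) Φ) {α ε : ℝ} (hα : 1 ≤ α)
    (hε : 2 * (∫ φ, displacement 1 φ ∂Φ) + ∫ φ, displacement 2 φ ∂Φ ≤ ε * α) (hε0 : 0 ≤ ε)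
    {ℓ : ℝ} (hℓ : 0 ≤ ℓ) :
    ∫⁻ φ, ∑' y, (φ y : ℝ≥0∞) * ENNReal.ofReal ((α + (ℓ + siteNorm y)) ^ 2) ∂Φ ≤
      ENNReal.ofReal (meanTotal Φ + ε) * ENNReal.ofReal ((α + ℓ) ^ 2) := by
  have hsum : ∀ φ : Config d, ∑' y, (φ y : ℝ≥0∞) * ENNReal.ofReal ((α + (ℓ + siteNorm y)) ^ 2) =
      ENNReal.ofReal ((α + ℓ) ^ 2 * total φ + 2 * (α + ℓ) * displacement 1 φ + displacement 2 φ) :=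
    fun φ => by
      rw [tsum_mul_ofReal φ fun y => sq_nonneg _]
      congr 1
      simp only [total, displacement, Finsupp.sum, Finset.mul_sum, ← Finset.sum_add_distrib]
      exact Finset.sum_congr rfl fun y _ => by ring
  simp_rw [hsum]
  have h12 : Integrable (fun φ : Config d =>
      (α + ℓ) ^ 2 * total φ + 2 * (α + ℓ) * displacement 1 φ) Φ :=
    (hT.const_mul _).add (h1.const_mul _)
  have hi : Integrable (fun φ : Config d =>
      (α + ℓ) ^ 2 * total φ + 2 * (α + ℓ) * displacement 1 φ + displacement 2 φ) Φ :=
    h12.add h2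
  have hval : ∫ φ : Config d,
      (α + ℓ) ^ 2 * total φ + 2 * (α + ℓ) * displacement 1 φ + displacement 2 φ ∂Φ =
      (α + ℓ) ^ 2 * meanTotal Φ + 2 * (α + ℓ) * (∫ φ, displacement 1 φ ∂Φ) +
        ∫ φ, displacement 2 φ ∂Φ := by
    rw [integral_add h12 h2,
      integral_add (hT.const_mul _) (h1.const_mul _), integral_const_mul, integral_const_mul,
      meanTotal]
  rw [← ofReal_integral_eq_lintegral_ofReal hi (.of_forall fun φ => ?_), hval,
    ← ENNReal.ofReal_mul (add_nonneg meanTotal_nonneg hε0)]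
  · refine ENNReal.ofReal_le_ofReal ?_
    have hd1 : 0 ≤ ∫ φ, displacement 1 φ ∂Φ := integral_nonneg fun φ => displacement_nonneg 1 φ
    have hd2 : 0 ≤ ∫ φ, displacement 2 φ ∂Φ := integral_nonneg fun φ => displacement_nonneg 2 φ
    have hαl : 1 ≤ α + ℓ := by linarith
    have e1 : 2 * (α + ℓ) * (∫ φ, displacement 1 φ ∂Φ) + ∫ φ, displacement 2 φ ∂Φ ≤
        (α + ℓ) * (ε * α) := by
      nlinarith
    have e2 : (α + ℓ) * (ε * α) ≤ ε * (α + ℓ) ^ 2 := by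
      have : 0 ≤ ε * (α + ℓ) := by positivity
      nlinarith
    linarith
  · have := total_nonneg φ
    have := displacement_nonneg 1 φ
    have := displacement_nonneg 2 φ
    have : 0 ≤ α + ℓ := by linarith
    positivity

variable [IsProbabilityMeasure Φ]

theorem JumpKernel.energy_le (J : JumpKernel Φ) {W : ℝ → ℝ≥0∞} {Λ : ℝ} (hΛ : 0 ≤ Λ)
    (hW : ∀ ℓ, 0 ≤ ℓ → ∫⁻ φ, ∑' y, (φ y : ℝ≥0∞) * W (ℓ + siteNorm y) ∂Φ ≤ ENNReal.ofReal Λ * W ℓ)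
    {c : ℝ → ℝ≥0∞} (hc : Measurable c) {s t : ℝ}
    (hJ : ∀ v, ∀ r ∈ Set.Ioc s t, ∫⁻ φ, ‖J.jump v r φ‖ₑ ^ 2 ∂Φ ≤ c r * W (pathLength v)) :
    J.energy s t ≤ ∫⁻ r in Set.Ioc s t, c r * (W 0 * ENNReal.ofReal (Real.exp (Λ * r))) := by
  calc J.energy s t
      ≤ ∑' v, ∫⁻ r in Set.Ioc s t, c r * (W (pathLength v) * presence Φ v r) := by
        refine ENNReal.tsum_le_tsum fun v => ?_
        refine lintegral_mono_ae ((ae_restrict_iff' measurableSet_Ioc).2 (.of_forall fun r hr => ?_))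
        rw [← mul_assoc]
        gcongr
        exact hJ v r hr
    _ = ∫⁻ r in Set.Ioc s t, c r * ∑' v, W (pathLength v) * presence Φ v r := by
        rw [← lintegral_tsum fun v => Measurable.aemeasurable
          (Measurable.fun_mul hc ((measurable_presence Φ v).const_mul _))]
        simp_rw [ENNReal.tsum_mul_left]
    _ ≤ _ := by
        refine lintegral_mono fun r => ?_
        gcongr
        exact tsum_weight_presence_le Φ hΛ hW r

/-- The squared jumps decay like `exp (-2ρr)` while the balls multiply like `exp (λr)`; the net
exponent is negative exactly when `ρ > λ/2`. -/
theorem energy_fourierKernel_le (hΦ : Integrable (fun φ => total φ ^ 2) Φ)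
    (u : EuclideanSpace ℝ (Fin d)) (hu : meanTotal Φ / 2 < (intensityHat Φ u).re) (s t : ℝ) :
    (fourierKernel (integrable_total hΦ) u).energy s t ≤
      ENNReal.ofReal ((∫ φ, total φ ^ 2 ∂Φ) *
        (Real.exp (-(2 * (intensityHat Φ u).re - meanTotal Φ) * s) /
          (2 * (intensityHat Φ u).re - meanTotal Φ))) := by
  set ρ := (intensityHat Φ u).re with hρ
  have hA : 0 ≤ ∫ φ, total φ ^ 2 ∂Φ := integral_nonneg fun φ => sq_nonneg _
  have hc : Measurable fun r => ENNReal.ofReal ((∫ φ, total φ ^ 2 ∂Φ) * Real.exp (-(2 * ρ) * r)) :=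
    ((Real.measurable_exp.comp (measurable_const_mul _)).const_mul _).ennreal_ofReal
  refine (JumpKernel.energy_le _ (W := fun _ => 1) (meanTotal_nonneg (Φ := Φ)) (fun ℓ _ => ?_)
    hc fun v r _ => ?_).trans ?_
  · have h1 : ∀ φ : Config d, ∑' y, (φ y : ℝ≥0∞) * 1 = ENNReal.ofReal (total φ) := fun φ => by
      have := tsum_mul_ofReal φ (g := fun _ => 1) fun _ => zero_le_one
      simpa [total] using this
    simp_rw [h1]
    rw [lintegral_total hΦ, mul_one]
  · rw [mul_one, mul_comm, ENNReal.ofReal_mul (Real.exp_pos _).le,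
      ofReal_integral_eq_lintegral_ofReal hΦ (.of_forall fun φ => sq_nonneg _),
      ← lintegral_const_mul _ (measurable_of_countable _)]
    refine lintegral_mono fun φ => ?_
    rw [← ofReal_norm, ← ENNReal.ofReal_pow (norm_nonneg _), ← ENNReal.ofReal_mul (Real.exp_pos _).le]
    refine ENNReal.ofReal_le_ofReal ?_
    simp only [fourierKernel]
    rw [norm_mul, norm_mul, norm_character, one_mul, norm_damping, mul_pow, ← Real.exp_nat_mul]
    refine mul_le_mul (le_of_eq ?_) (pow_le_pow_left₀ (norm_nonneg _) (norm_configHat_le u φ) 2)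
      (by positivity) (by positivity)
    congr 1
    push_cast
    ring
  · refine le_trans (le_of_eq ?_) (lintegral_exp_Ioc_le hA (by linarith) s t)
    refine lintegral_congr fun r => ?_
    rw [one_mul, ← ENNReal.ofReal_mul (by positivity), mul_assoc, ← Real.exp_add]
    congr 3
    ring

/-- Of the exponential margin `δ`, one quarter pays for the growth of the quadratic weight and one
quarter for the factor `(1 + a r)²`. The remaining decay `exp (-δr/2)` integrates to `2/δ`. -/
theorem energy_sub_fourierKernel_le (hΦ : Integrable (fun φ => total φ ^ 2) Φ)
    (h1 : Integrable (fun φ => displacement 1 φ ^ 2) Φ)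
    (h2 : Integrable (fun φ => displacement 2 φ) Φ)
    (u : EuclideanSpace ℝ (Fin d)) (hu : meanTotal Φ / 2 < (intensityHat Φ u).re) (t : ℝ)
    (hJ : ∀ v r, Integrable ((fourierKernel (integrable_total hΦ) u).jump v r) Φ)
    (hJ' : ∀ v r, Integrable ((fourierKernel (integrable_total hΦ) 0).jump v r) Φ) :
    ((fourierKernel (integrable_total hΦ) u).sub (fourierKernel (integrable_total hΦ) 0)
      hJ hJ').energy 0 t ≤
      ENNReal.ofReal (compareConst Φ (2 * (intensityHat Φ u).re - meanTotal Φ) * ‖u‖ ^ 2) := by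
  have hT := integrable_total hΦ
  have hL1 : MemLp (fun φ : Config d => displacement 1 φ) 2 Φ :=
    (memLp_two_iff_integrable_sq (measurable_of_countable _).aestronglyMeasurable).2 h1
  have hi1 := hL1.integrable one_le_two
  have hiB : Integrable (fun φ : Config d => (displacement 1 φ + total φ) ^ 2) Φ :=
    (hL1.add (JumpKernel.memLp_total hΦ)).integrable_sq
  set ρ := (intensityHat Φ u).re with hρ
  set δ := 2 * ρ - meanTotal Φ with hδdef
  have hδ : 0 < δ := by linarith
  set a := ∫ φ, displacement 1 φ ∂Φ with ha
  set b := ∫ φ, displacement 2 φ ∂Φ with hb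
  set B := ∫ φ, (displacement 1 φ + total φ) ^ 2 ∂Φ with hB
  have ha0 : 0 ≤ a := integral_nonneg fun φ => displacement_nonneg 1 φ
  have hb0 : 0 ≤ b := integral_nonneg fun φ => displacement_nonneg 2 φ
  have hB0 : 0 ≤ B := integral_nonneg fun φ => sq_nonneg _
  -- Chosen so that the offset absorbs the lower-order terms with `ε = δ/4`.
  set α := 1 + 4 * (2 * a + b) / δ with hα
  have hα1 : 1 ≤ α := le_add_of_nonneg_right (by positivity)
  have hε : 2 * a + b ≤ δ / 4 * α := by
    rw [hα]
    have : δ / 4 * (1 + 4 * (2 * a + b) / δ) = δ / 4 + (2 * a + b) := by field_simp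
    linarith
  -- Chosen so that `1 + a r ≤ κ (1 + δ r / 8) ≤ κ exp (δ r / 8)`; squaring costs `δ/4` in the
  -- exponent.
  set κ := 1 + 8 * a / δ with hκ
  have hκ0 : 0 ≤ κ := by positivity
  set K := ‖u‖ ^ 2 * κ ^ 2 * B with hK
  have hc : Measurable fun r => ENNReal.ofReal (K * Real.exp (-(2 * ρ - δ / 4) * r)) :=
    ((Real.measurable_exp.comp (measurable_const_mul _)).const_mul _).ennreal_ofReal
  refine (JumpKernel.energy_le _ (W := fun ℓ => ENNReal.ofReal ((α + ℓ) ^ 2))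
    (add_nonneg (meanTotal_nonneg (Φ := Φ)) (by positivity : 0 ≤ δ / 4))
    (fun ℓ hℓ => lintegral_weight_le hT hi1 h2 hα1 hε (by positivity) hℓ)
    hc fun v r hr => ?_).trans ?_
  · have hr0 : 0 ≤ r := hr.1.le
    have hℓ := pathLength_nonneg v
    have hgrow : 1 + a * r ≤ κ * Real.exp (δ * r / 8) := by
      have e1 : 1 + δ * r / 8 ≤ Real.exp (δ * r / 8) := by
        rw [add_comm]; exact Real.add_one_le_exp _
      have e2 : κ * (1 + δ * r / 8) = 1 + a * r + (8 * a / δ + δ * r / 8) := by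
        rw [hκ]; field_simp; ring
      have e3 : 0 ≤ 8 * a / δ + δ * r / 8 := by positivity
      nlinarith [mul_le_mul_of_nonneg_left e1 hκ0]
    have hpt : ∀ φ : Config d, ‖(fourierKernel hT u).jump v r φ - (fourierKernel hT 0).jump v r φ‖ ^ 2
        ≤ ‖u‖ ^ 2 * κ ^ 2 * Real.exp (-(2 * ρ - δ / 4) * r) * (α + pathLength v) ^ 2 *
          (displacement 1 φ + total φ) ^ 2 := by
      intro φ
      have hd := displacement_nonneg 1 φ
      have ht := total_nonneg φ
      have hle : displacement 1 φ + total φ * (pathLength v + a * r) ≤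
          (displacement 1 φ + total φ) * ((α + pathLength v) * (κ * Real.exp (δ * r / 8))) := by
        have e0 : 0 ≤ a * r := by positivity
        have e1 : pathLength v + a * r ≤ (α + pathLength v) * (1 + a * r) := by nlinarith
        have e2 : 1 ≤ (α + pathLength v) * (1 + a * r) := by nlinarith
        have e3 : (α + pathLength v) * (1 + a * r) ≤
            (α + pathLength v) * (κ * Real.exp (δ * r / 8)) :=
          mul_le_mul_of_nonneg_left hgrow (by linarith)
        nlinarith [mul_le_mul_of_nonneg_left (e1.trans e3) ht,
          mul_le_mul_of_nonneg_left (e2.trans e3) hd]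
      refine (pow_le_pow_left₀ (norm_nonneg _) ((norm_jump_sub_le hT hi1 u v hr0 φ).trans
        (mul_le_mul_of_nonneg_left hle (by positivity))) 2).trans (le_of_eq ?_)
      have e : Real.exp (-(2 * ρ - δ / 4) * r) =
          Real.exp (-ρ * r) ^ 2 * Real.exp (δ * r / 8) ^ 2 := by
        rw [← Real.exp_nat_mul, ← Real.exp_nat_mul, ← Real.exp_add]
        congr 1
        push_cast
        ring
      rw [e]
      ring
    have hconst : 0 ≤ ‖u‖ ^ 2 * κ ^ 2 * Real.exp (-(2 * ρ - δ / 4) * r) * (α + pathLength v) ^ 2 := by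
      positivity
    calc _ ≤ ∫⁻ φ, ENNReal.ofReal (‖u‖ ^ 2 * κ ^ 2 * Real.exp (-(2 * ρ - δ / 4) * r) *
            (α + pathLength v) ^ 2 * (displacement 1 φ + total φ) ^ 2) ∂Φ := by
          refine lintegral_mono fun φ => ?_
          rw [← ofReal_norm, ← ENNReal.ofReal_pow (norm_nonneg _)]
          exact ENNReal.ofReal_le_ofReal (hpt φ)
      _ = _ := by
          rw [← ofReal_integral_eq_lintegral_ofReal (hiB.const_mul _)
            (.of_forall fun φ => mul_nonneg hconst (sq_nonneg _)), integral_const_mul,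
            ← ENNReal.ofReal_mul (by positivity)]
          congr 1
          rw [hK]
          ring
  · have hK0 : 0 ≤ K * α ^ 2 := by positivity
    refine le_trans (le_of_eq ?_) ((lintegral_exp_Ioc_le hK0 (half_pos hδ) 0 t).trans (le_of_eq ?_))
    · refine lintegral_congr fun r => ?_
      rw [← ENNReal.ofReal_mul (by positivity), ← ENNReal.ofReal_mul (by positivity)]
      congr 1
      have : Real.exp (-(δ / 2) * r) =
          Real.exp (-(2 * ρ - δ / 4) * r) * Real.exp ((meanTotal Φ + δ / 4) * r) := by
        rw [← Real.exp_add]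
        congr 1
        rw [hδdef]
        ring
      rw [this]
      ring
    · congr 1
      rw [compareConst, hK, ← ha, ← hb, ← hB, ← hα, ← hκ, mul_zero, Real.exp_zero]
      field_simp

end

end BranchingWalk

/-! ### Almost sure convergence of right-continuous martingales -/

namespace MeasureTheory

variable {Ω : Type*} [mΩ : MeasurableSpace Ω] {P : Measure Ω}

theorem Martingale.norm_submartingale {ι E : Type*} [Preorder ι] [NormedAddCommGroup E]
    [NormedSpace ℝ E] [CompleteSpace E] {ℱ : Filtration ι mΩ} {f : ι → Ω → E}
    (hf : Martingale f ℱ P) : Submartingale (fun i ω => ‖f i ω‖) ℱ P := by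
  refine ⟨fun i => (hf.stronglyMeasurable i).norm, fun i j hij => ?_, fun i => (hf.integrable i).norm⟩
  filter_upwards [hf.condExp_ae_eq hij, norm_condExp_le (m := ℱ i) (μ := P) (f j)] with ω h1 h2
  rwa [h1] at h2

theorem Martingale.mul_measure_exists_le [IsFiniteMeasure P] {E : Type*} [NormedAddCommGroup E]
    [NormedSpace ℝ E] [CompleteSpace E] {𝒢 : Filtration ℕ mΩ} {f : ℕ → Ω → E}
    (hf : Martingale f 𝒢 P) (ε : ℝ≥0) (n : ℕ) :
    ε * P {ω | ∃ k ≤ n, (ε : ℝ) ≤ ‖f k ω‖} ≤ ∫⁻ ω, ‖f n ω‖ₑ ∂P := by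
  have h := maximal_ineq hf.norm_submartingale (fun _ _ => norm_nonneg _) (ε := ε) n
  have hset : {ω | ∃ k ≤ n, (ε : ℝ) ≤ ‖f k ω‖} = {ω | (ε : ℝ) ≤
      (Finset.range (n + 1)).sup' Finset.nonempty_range_add_one fun k => ‖f k ω‖} := by
    ext ω
    simp [Finset.le_sup'_iff]
  rw [hset]
  refine h.trans ?_
  rw [ofReal_integral_eq_lintegral_ofReal (hf.integrable n).norm.integrableOn
    (.of_forall fun _ => norm_nonneg _)]
  simp_rw [ofReal_norm]
  exact lintegral_mono' Measure.restrict_le_self le_rfl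

variable [IsProbabilityMeasure P] {ℱ : Filtration ℝ≥0 mΩ} {M : ℝ≥0 → Ω → ℂ}

/-- The martingale after time `s`, along a grid of mesh `2⁻ᵐ`. -/
theorem Martingale.grid (hM : Martingale M ℱ P) (s : ℝ≥0) (m : ℕ) :
    ∃ 𝒢 : Filtration ℕ mΩ, Martingale (fun (k : ℕ) ω => M (s + k / 2 ^ m) ω - M s ω) 𝒢 P := by
  have hmono : Monotone fun k : ℕ => s + (k : ℝ≥0) / 2 ^ m := fun k l hkl => by
    dsimp only
    gcongr
  refine ⟨⟨fun k => ℱ (s + k / 2 ^ m), fun k l hkl => ℱ.mono (hmono hkl), fun k => ℱ.le _⟩, ?_, ?_⟩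
  · exact fun k => (hM.stronglyMeasurable _).sub
      ((hM.stronglyMeasurable s).mono (ℱ.mono le_self_add))
  · intro k l hkl
    have hs : StronglyMeasurable[ℱ (s + k / 2 ^ m)] (M s) :=
      (hM.stronglyMeasurable s).mono (ℱ.mono le_self_add)
    have h1 := condExp_sub (hM.integrable (s + l / 2 ^ m)) (hM.integrable s) (ℱ (s + k / 2 ^ m))
    rw [condExp_of_stronglyMeasurable (ℱ.le _) hs (hM.integrable s)] at h1
    filter_upwards [h1, hM.condExp_ae_eq (hmono hkl)] with ω h2 h3
    refine h2.trans ?_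
    rw [Pi.sub_apply, h3]

/-- Doob's inequality on each finite grid has the bound `b s`, independent of horizon and mesh. The
exceptional events increase with both, because dyadic grids are nested, so the bound survives the
union. -/
theorem Martingale.mul_measure_exists_dyadic_le (hM : Martingale M ℱ P) {b : ℝ≥0 → ℝ≥0∞}
    (hb : ∀ s t, s ≤ t → eLpNorm (M t - M s) 2 P ≤ b s) (s ε : ℝ≥0) :
    ε * P {ω | ∃ m k : ℕ, (ε : ℝ) ≤ ‖M (s + k / 2 ^ m) ω - M s ω‖} ≤ b s := by
  have h1 : ∀ m n : ℕ, ε * P {ω | ∃ k ≤ n, (ε : ℝ) ≤ ‖M (s + k / 2 ^ m) ω - M s ω‖} ≤ b s := by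
    intro m n
    obtain ⟨𝒢, h𝒢⟩ := hM.grid s m
    refine (h𝒢.mul_measure_exists_le ε n).trans ?_
    rw [← eLpNorm_one_eq_lintegral_enorm]
    exact (eLpNorm_le_eLpNorm_of_exponent_le one_le_two
      (h𝒢.integrable n).aestronglyMeasurable).trans (hb _ _ le_self_add)
  have h2 : ∀ m : ℕ, ε * P {ω | ∃ k : ℕ, (ε : ℝ) ≤ ‖M (s + k / 2 ^ m) ω - M s ω‖} ≤ b s := by
    intro m
    have hU : {ω | ∃ k : ℕ, (ε : ℝ) ≤ ‖M (s + k / 2 ^ m) ω - M s ω‖} =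
        ⋃ n : ℕ, {ω | ∃ k ≤ n, (ε : ℝ) ≤ ‖M (s + k / 2 ^ m) ω - M s ω‖} := by
      ext ω
      simp only [Set.mem_ofPred_eq, Set.mem_iUnion]
      exact ⟨fun ⟨k, hk⟩ => ⟨k, k, le_rfl, hk⟩, fun ⟨_, k, _, hk⟩ => ⟨k, hk⟩⟩
    have hmono : Monotone fun n : ℕ => {ω | ∃ k ≤ n, (ε : ℝ) ≤ ‖M (s + k / 2 ^ m) ω - M s ω‖} :=
      fun n n' hn ω ⟨k, hk, h⟩ => ⟨k, hk.trans hn, h⟩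
    rw [hU, hmono.measure_iUnion, ENNReal.mul_iSup]
    exact iSup_le fun n => h1 m n
  have hU : {ω | ∃ m k : ℕ, (ε : ℝ) ≤ ‖M (s + k / 2 ^ m) ω - M s ω‖} =
      ⋃ m : ℕ, {ω | ∃ k : ℕ, (ε : ℝ) ≤ ‖M (s + k / 2 ^ m) ω - M s ω‖} := by
    ext ω
    simp
  have hmono : Monotone fun m : ℕ => {ω | ∃ k : ℕ, (ε : ℝ) ≤ ‖M (s + k / 2 ^ m) ω - M s ω‖} := by
    refine monotone_nat_of_le_succ fun m ω ⟨k, h⟩ => ⟨2 * k, ?_⟩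
    have : ((2 * k : ℕ) : ℝ≥0) / 2 ^ (m + 1) = k / 2 ^ m := by
      push_cast
      rw [pow_succ, mul_comm ((2 : ℝ≥0) ^ m), mul_div_mul_left _ _ two_ne_zero]
    rwa [this]
  rw [hU, hmono.measure_iUnion, ENNReal.mul_iSup]
  exact iSup_le h2

/-- Rounding up keeps the grid points at or above `t`, as right continuity requires. -/
theorem exists_dyadic_tendsto {s t : ℝ≥0} (hst : s ≤ t) :
    ∃ k : ℕ → ℕ, Tendsto (fun m => s + (k m : ℝ≥0) / 2 ^ m) atTop (𝓝[≥] t) := by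
  have hle : ∀ m : ℕ, t ≤ s + (⌈(t - s) * 2 ^ m⌉₊ : ℝ≥0) / 2 ^ m := fun m => by
    rw [← tsub_le_iff_left, le_div_iff₀ (by positivity)]
    exact Nat.le_ceil _
  have hge : ∀ m : ℕ, s + (⌈(t - s) * 2 ^ m⌉₊ : ℝ≥0) / 2 ^ m ≤ t + (1 / 2) ^ m := fun m => by
    calc s + (⌈(t - s) * 2 ^ m⌉₊ : ℝ≥0) / 2 ^ m ≤ s + ((t - s) * 2 ^ m + 1) / 2 ^ m := by
          gcongr
          exact (Nat.ceil_lt_add_one zero_le).le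
      _ = t + (1 / 2) ^ m := by
          rw [add_div, mul_div_cancel_right₀ _ (by positivity), ← add_assoc,
            add_tsub_cancel_of_le hst, one_div_pow]
  have hlim : Tendsto (fun m : ℕ => t + (1 / 2 : ℝ≥0) ^ m) atTop (𝓝 t) := by
    simpa using (NNReal.tendsto_pow_atTop_nhds_zero_of_lt_one
      (NNReal.half_lt_self one_ne_zero)).const_add t
  exact ⟨fun m => ⌈(t - s) * 2 ^ m⌉₊, tendsto_nhdsWithin_iff.2
    ⟨tendsto_of_tendsto_of_tendsto_of_le_of_le tendsto_const_nhds hlim hle hge, .of_forall hle⟩⟩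

/-- A right-continuous martingale whose increments vanish in mean square converges. -/
theorem Martingale.ae_exists_tendsto_of_eLpNorm (hM : Martingale M ℱ P) {b : ℝ≥0 → ℝ≥0∞}
    (hb : ∀ s t, s ≤ t → eLpNorm (M t - M s) 2 P ≤ b s) (hb0 : Tendsto b atTop (𝓝 0))
    (hc : ∀ᵐ ω ∂P, ∀ t, ContinuousWithinAt (fun s => M s ω) (Set.Ici t) t) :
    ∀ᵐ ω ∂P, ∃ l, Tendsto (fun t => M t ω) atTop (𝓝 l) := by
  have hbad : ∀ j : ℕ, ∀ᵐ ω ∂P, ∃ s : ℝ≥0, ∀ m k : ℕ,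
      ‖M (s + k / 2 ^ m) ω - M s ω‖ < ((1 / (j + 1) : ℝ≥0) : ℝ) := by
    intro j
    set ε : ℝ≥0 := 1 / (j + 1) with hε
    have hε0 : (ε : ℝ≥0∞) ≠ 0 := by
      rw [ENNReal.coe_ne_zero, hε]
      positivity
    -- This event lies in the exceptional event of every single `s`, so letting `s → ∞` in the bound
    -- `b s` makes it null.
    have h0 : P {ω | ∀ s : ℝ≥0, ∃ m k : ℕ, (ε : ℝ) ≤ ‖M (s + k / 2 ^ m) ω - M s ω‖} = 0 := by
      have hle : ∀ s : ℝ≥0, ε * P {ω | ∀ s : ℝ≥0, ∃ m k : ℕ,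
          (ε : ℝ) ≤ ‖M (s + k / 2 ^ m) ω - M s ω‖} ≤ b s := fun s =>
        le_trans (mul_le_mul_right (measure_mono fun ω (h : ∀ s : ℝ≥0, ∃ m k : ℕ, _) => h s) _)
          (hM.mul_measure_exists_dyadic_le hb s ε)
      have h2 := ge_of_tendsto' hb0 hle
      rcases mul_eq_zero.1 (nonpos_iff_eq_zero.1 h2) with h | h
      · exact absurd h hε0
      · exact h
    filter_upwards [measure_eq_zero_iff_ae_notMem.1 h0] with ω hω
    simp only [not_forall, not_exists, not_le] at hω
    exact hω
  filter_upwards [ae_all_iff.2 hbad, hc] with ω h1 h2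
  refine cauchySeq_tendsto_of_complete (Metric.cauchySeq_iff'.2 fun ε hε => ?_)
  obtain ⟨j, hj⟩ := exists_nat_one_div_lt hε
  obtain ⟨s, hs⟩ := h1 j
  refine ⟨s, fun t ht => ?_⟩
  obtain ⟨k, hk⟩ := exists_dyadic_tendsto (show s ≤ t from ht)
  have hlim : Tendsto (fun m => ‖M (s + k m / 2 ^ m) ω - M s ω‖) atTop (𝓝 ‖M t ω - M s ω‖) :=
    (((h2 t).tendsto.comp hk).sub_const _).norm
  rw [dist_eq_norm]
  refine (le_of_tendsto' hlim fun m => (hs m (k m)).le).trans_lt ?_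
  push_cast
  exact hj

end MeasureTheory

namespace BranchingWalk

variable {d : ℕ}

theorem Driving.measurable_processHat {Φ : Measure (Config d)} {Ω : Type*} [MeasurableSpace Ω]
    {P : Measure Ω} (D : Driving Φ P) (u : EuclideanSpace ℝ (Fin d)) (t : ℝ≥0) :
    Measurable[D.filtration t] (D.processHat u t) := by
  have h : Measurable[D.filtration t] (D.process t) :=
    (Filtration.stronglyAdapted_natural
      (fun t => (D.measurable_process t).stronglyMeasurable) t).measurable
  have hy : ∀ y, Measurable[D.filtration t] fun ω => character u y * (D.process t ω y : ℂ) :=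
    fun y => (measurable_of_countable fun n : ℕ => character u y * (n : ℂ)).comp
      ((measurable_pi_apply (X := fun _ : Site d => ℕ) y).comp h)
  exact @Measurable.tsum Ω ℂ (Site d) (D.filtration t) _ _ _ _ _ _ _ _ _ _ _ _ hy

end BranchingWalk

/-! ### Transfer from the canonical space to an arbitrary realisation -/

namespace BranchingWalk

variable {d : ℕ} {Φ : Measure (Config d)} {Ω : Type*} [MeasurableSpace Ω] {P : Measure Ω}

namespace Driving

/-- The values of all waiting times and all draws. -/
def sample (D : Driving Φ P) (ω : Ω) : Sample d :=
  fun i => (D.gap i.1 i.2 ω, D.offspring i.1 i.2 ω)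

theorem measurable_fourierMartingale (D : Driving Φ P) (u : EuclideanSpace ℝ (Fin d)) (t : ℝ≥0) :
    Measurable[D.filtration t] (D.fourierMartingale u t) :=
  (D.measurable_processHat u t).const_mul _

theorem measurable_fourierMartingale_sub (D : Driving Φ P) (u u' : EuclideanSpace ℝ (Fin d)) (s t : ℝ≥0) :
    Measurable fun ω => D.fourierMartingale u t ω - D.fourierMartingale u' s ω :=
  ((D.measurable_fourierMartingale u t).mono (D.filtration.le t) le_rfl).sub
    ((D.measurable_fourierMartingale u' s).mono (D.filtration.le s) le_rfl)

/-- Only finitely many balls are born by time `t + 1`, so none is born just after `t`, and `M_u`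
varies there only through the continuous damping. -/
theorem continuousWithinAt_fourierMartingale (D : Driving Φ P) (u : EuclideanSpace ℝ (Fin d))
    {ω : Ω} (h : ∀ t, (D.population t ω).Finite) (t : ℝ≥0) :
    ContinuousWithinAt (fun s => D.fourierMartingale u s ω) (Set.Ici t) t := by
  have hev : ∀ᶠ s in 𝓝[≥] t, D.population s ω = D.population t ω := by
    have hlt : ∀ᶠ s in 𝓝[≥] t, s < t + 1 :=
      eventually_nhdsWithin_of_eventually_nhds (gt_mem_nhds (lt_add_one t))
    have hb : ∀ᶠ s : ℝ≥0 in 𝓝[≥] t, ∀ v ∈ D.population (t + 1) ω,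
        (t : ℝ) < D.birth v ω → (s : ℝ) < D.birth v ω := by
      refine (eventually_all_finite (h (t + 1))).2 fun v _ => ?_
      by_cases hv : (t : ℝ) < D.birth v ω
      · filter_upwards [eventually_nhdsWithin_of_eventually_nhds
          ((NNReal.continuous_coe.tendsto t).eventually (gt_mem_nhds hv))] with s hs _ using hs
      · exact .of_forall fun s h => absurd h hv
    filter_upwards [hlt, hb, self_mem_nhdsWithin] with s h1 h2 h3
    ext v
    refine ⟨fun hv => ⟨hv.1, ?_⟩, fun hv => ⟨hv.1, hv.2.trans (NNReal.coe_le_coe.2 h3)⟩⟩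
    by_contra hlt
    exact absurd hv.2 (not_le.2 (h2 v ⟨hv.1, hv.2.trans (NNReal.coe_le_coe.2 h1.le)⟩
      (not_le.1 hlt)))
  have hc : Continuous fun s : ℝ≥0 => damping Φ u s * D.processHat u t ω :=
    ((continuous_damping u).comp NNReal.continuous_coe).mul continuous_const
  refine hc.continuousWithinAt.congr_of_eventuallyEq ?_ rfl
  filter_upwards [hev] with s hs
  simp only [fourierMartingale, processHat, process, hs, damping]

variable [IsProbabilityMeasure Φ] (D : Driving Φ P)

theorem measurePreserving_sample : MeasurePreserving D.sample P (sampleLaw Φ) := by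
  have hm : ∀ i : Ball d × ℕ, Measurable fun ω => (D.gap i.1 i.2 ω, D.offspring i.1 i.2 ω) :=
    fun i => (D.measurable_gap _ _).prodMk (D.measurable_offspring _ _)
  refine ⟨measurable_pi_lambda _ hm, (D.indep.map_fun_eq_infinitePi_map hm).trans ?_⟩
  simp only [D.law]
  rfl

theorem birth_sample (v : Ball d) (ω : Ω) :
    (canonical Φ).birth v (D.sample ω) = D.birth v ω := by
  induction v with
  | nil => rfl
  | cons a v ih =>
    simp only [birth, ih]
    rfl

theorem isBorn_sample (v : Ball d) (ω : Ω) :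
    (canonical Φ).IsBorn v (D.sample ω) ↔ D.IsBorn v ω := by
  induction v with
  | nil => rfl
  | cons a v ih =>
    simp only [IsBorn, ih]
    rfl

theorem population_sample (t : ℝ≥0) (ω : Ω) :
    (canonical Φ).population t (D.sample ω) = D.population t ω := by
  simp only [population, birth_sample, isBorn_sample]

theorem process_sample (t : ℝ≥0) (ω : Ω) :
    (canonical Φ).process t (D.sample ω) = D.process t ω := by
  funext y
  simp only [process, population_sample]

theorem fourierMartingale_sample (u : EuclideanSpace ℝ (Fin d)) (t : ℝ≥0) (ω : Ω) :
    (canonical Φ).fourierMartingale u t (D.sample ω) = D.fourierMartingale u t ω := by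
  simp only [fourierMartingale, processHat, process_sample]

/-- Both filtrations are generated by the process, which factors through `sample`; the martingale
identity can thus be tested on the canonical space. -/
theorem exists_preimage_sample {s : ℝ≥0} {A : Set Ω} (hA : MeasurableSet[D.filtration s] A) :
    ∃ B, MeasurableSet[(canonical Φ).filtration s] B ∧ D.sample ⁻¹' B = A := by
  rw [filtration, Filtration.natural_eq_comap] at hA ⊢
  obtain ⟨B, hB, rfl⟩ := hA
  refine ⟨_, ⟨B, hB, rfl⟩, ?_⟩
  ext ω
  simp only [Set.mem_preimage, process_sample]

theorem ae_finite_population (hΦ : Integrable (fun φ => total φ ^ 2) Φ) :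
    ∀ᵐ ω ∂P, ∀ t : ℝ≥0, (D.population t ω).Finite := by
  filter_upwards [D.measurePreserving_sample.quasiMeasurePreserving.ae (ae_finite_activeRings hΦ)]
    with ω h t
  rw [← population_sample]
  exact finite_population_of_finite_activeRings (h t)

theorem ae_fourierMartingale_zero_time (u : EuclideanSpace ℝ (Fin d)) :
    ∀ᵐ ω ∂P, D.fourierMartingale u 0 ω = 1 := by
  filter_upwards [D.measurePreserving_sample.quasiMeasurePreserving.ae (ae_posGaps Φ)] with ω h
  rw [← fourierMartingale_sample]
  exact fourierMartingale_zero_time u h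

theorem lintegral_sample_enorm_sq (u u' : EuclideanSpace ℝ (Fin d)) (s t : ℝ≥0) :
    ∫⁻ ω, ‖D.fourierMartingale u t ω - D.fourierMartingale u' s ω‖ₑ ^ 2 ∂P =
      ∫⁻ x, ‖(canonical Φ).fourierMartingale u t x -
        (canonical Φ).fourierMartingale u' s x‖ₑ ^ 2 ∂sampleLaw Φ := by
  rw [← D.measurePreserving_sample.lintegral_comp
    (((canonical Φ).measurable_fourierMartingale_sub u u' s t).enorm.pow_const 2)]
  simp only [fourierMartingale_sample]

theorem lintegral_fourierMartingale_sub_sq_le (hΦ : Integrable (fun φ => total φ ^ 2) Φ)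
    (u : EuclideanSpace ℝ (Fin d)) (hu : meanTotal Φ / 2 < (intensityHat Φ u).re) {s t : ℝ≥0}
    (hst : s ≤ t) :
    ∫⁻ ω, ‖D.fourierMartingale u t ω - D.fourierMartingale u s ω‖ₑ ^ 2 ∂P ≤
      ENNReal.ofReal ((∫ φ, total φ ^ 2 ∂Φ) *
        (Real.exp (-(2 * (intensityHat Φ u).re - meanTotal Φ) * s) /
          (2 * (intensityHat Φ u).re - meanTotal Φ))) := by
  rw [D.lintegral_sample_enorm_sq]
  exact ((fourierKernel (integrable_total hΦ) u).lintegral_enorm_sq_le_energy hΦ s.2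
    (NNReal.coe_le_coe.2 hst) (ae_hasSum_ringIncrement hΦ u hst)).trans
    (energy_fourierKernel_le hΦ u hu s t)

theorem setIntegral_fourierMartingale_sub (hΦ : Integrable (fun φ => total φ ^ 2) Φ)
    (u : EuclideanSpace ℝ (Fin d)) {s t : ℝ≥0} (hst : s ≤ t) {A : Set Ω}
    (hA : MeasurableSet[D.filtration s] A) :
    ∫ ω in A, (D.fourierMartingale u t ω - D.fourierMartingale u s ω) ∂P = 0 := by
  obtain ⟨B, hB, rfl⟩ := D.exists_preimage_sample hA
  have h := (fourierKernel (integrable_total hΦ) u).setIntegral_eq_zero hΦ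
    (NNReal.coe_le_coe.2 hst) (ae_hasSum_ringIncrement hΦ u hst) B hB
  have hmap : ∀ Z : Sample d → ℂ, Measurable Z →
      ∫ x in B, Z x ∂sampleLaw Φ = ∫ ω in D.sample ⁻¹' B, Z (D.sample ω) ∂P := fun Z hZ => by
    rw [← D.measurePreserving_sample.map_eq, setIntegral_map ((canonical Φ).filtration.le s B hB)
      hZ.aestronglyMeasurable D.measurePreserving_sample.measurable.aemeasurable]
  rw [hmap _ ((canonical Φ).measurable_fourierMartingale_sub u u s t)] at h
  simpa only [fourierMartingale_sample] using h

theorem lintegral_fourierMartingale_sub_zero_sq_le (hΦ : Integrable (fun φ => total φ ^ 2) Φ)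
    (h1 : Integrable (fun φ => displacement 1 φ ^ 2) Φ)
    (h2 : Integrable (fun φ => displacement 2 φ) Φ)
    (u : EuclideanSpace ℝ (Fin d)) (hu : meanTotal Φ / 2 < (intensityHat Φ u).re) (t : ℝ≥0) :
    ∫⁻ ω, ‖D.fourierMartingale u t ω - D.fourierMartingale 0 t ω‖ₑ ^ 2 ∂P ≤
      ENNReal.ofReal (compareConst Φ (2 * (intensityHat Φ u).re - meanTotal Φ) * ‖u‖ ^ 2) := by
  have hJ : ∀ u v r, Integrable ((fourierKernel (integrable_total hΦ) u).jump v r) Φ :=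
    fun u v r => (integrable_configHat (integrable_total hΦ) u).const_mul _
  rw [D.lintegral_sample_enorm_sq]
  refine (JumpKernel.lintegral_enorm_sq_le_energy (JumpKernel.sub _ _ (hJ u) (hJ 0)) hΦ
    le_rfl t.2 ?_).trans (energy_sub_fourierKernel_le hΦ h1 h2 u hu t (hJ u) (hJ 0))
  -- Both martingales equal `1` at time `0`, so the difference of their increments from `0` to `t`
  -- is the difference of their values at `t`.
  filter_upwards [ae_posGaps Φ, ae_hasSum_ringIncrement hΦ u (zero_le (a := t)),
    ae_hasSum_ringIncrement hΦ 0 (zero_le (a := t))] with x hx hs1 hs2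
  simp only [JumpKernel.ringIncrement_sub]
  have h := hs1.sub hs2
  simp only [fourierMartingale_zero_time _ hx, NNReal.coe_zero, sub_sub_sub_cancel_right] at h
  exact h

end Driving

end BranchingWalk

/-! ### The limit in mean square -/

namespace MeasureTheory

variable {Ω : Type*} [mΩ : MeasurableSpace Ω] {P : Measure Ω}

theorem Martingale.exists_memLp_tendsto [IsProbabilityMeasure P] {ℱ : Filtration ℝ≥0 mΩ}
    {M : ℝ≥0 → Ω → ℂ} (hM : Martingale M ℱ P) (hM2 : ∀ t, MemLp (M t) 2 P) {b : ℝ≥0 → ℝ≥0∞}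
    (hb : ∀ s t, s ≤ t → eLpNorm (M t - M s) 2 P ≤ b s) (hb0 : Tendsto b atTop (𝓝 0))
    (hc : ∀ᵐ ω ∂P, ∀ t, ContinuousWithinAt (fun s => M s ω) (Set.Ici t) t) :
    ∃ Mlim : Ω → ℂ, MemLp Mlim 2 P ∧ (∀ᵐ ω ∂P, Tendsto (fun t => M t ω) atTop (𝓝 (Mlim ω))) ∧
      ∀ t, eLpNorm (M t - Mlim) 2 P ≤ b t := by
  have hnat : Tendsto (fun n : ℕ => (n : ℝ≥0)) atTop atTop := tendsto_natCast_atTop_atTop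
  have hlim := hM.ae_exists_tendsto_of_eLpNorm hb hb0 hc
  obtain ⟨Mlim, hmeas, hMlim⟩ := exists_stronglyMeasurable_limit_of_tendsto_ae
    (f := fun n : ℕ => M n) (fun n => (hM2 n).aestronglyMeasurable)
    (hlim.mono fun ω ⟨l, hl⟩ => ⟨l, hl.comp hnat⟩)
  have hle : ∀ t, eLpNorm (M t - Mlim) 2 P ≤ b t := by
    intro t
    -- Fatou's lemma along integer times gives the rate of convergence and, by finiteness of `b` at
    -- some time, square integrability of the limit.
    refine (Lp.eLpNorm_lim_le_liminf_eLpNorm (f := fun n : ℕ => M t - M n)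
      (fun n => ((hM2 t).sub (hM2 n)).aestronglyMeasurable) _
      (hMlim.mono fun ω h => h.const_sub (M t ω))).trans ?_
    refine liminf_le_of_le (by isBoundedDefault) fun a ha => ?_
    obtain ⟨n, h1, h2⟩ := (ha.and (hnat.eventually_ge_atTop t)).exists
    rw [eLpNorm_sub_comm] at h1
    exact h1.trans (hb _ _ h2)
  refine ⟨Mlim, ?_, ?_, hle⟩
  · obtain ⟨t, ht⟩ := (hb0.eventually (gt_mem_nhds ENNReal.zero_lt_top)).exists
    have h : MemLp (M t - Mlim) 2 P :=
      ⟨(hM2 t).aestronglyMeasurable.sub hmeas.aestronglyMeasurable, (hle t).trans_lt ht⟩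
    simpa using (hM2 t).sub h
  · filter_upwards [hlim, hMlim] with ω ⟨l, hl⟩ h
    rwa [tendsto_nhds_unique h (hl.comp hnat)]

theorem eLpNorm_two_eq {f : Ω → ℂ} : eLpNorm f 2 P = (∫⁻ ω, ‖f ω‖ₑ ^ 2 ∂P) ^ (1 / 2 : ℝ) := by
  simp [eLpNorm_eq_lintegral_rpow_enorm_toReal]

theorem integral_norm_sq_le_of_lintegral_le {f : Ω → ℂ} (hf : AEStronglyMeasurable f P) {c : ℝ}
    (hc : 0 ≤ c) (h : ∫⁻ ω, ‖f ω‖ₑ ^ 2 ∂P ≤ ENNReal.ofReal c) : ∫ ω, ‖f ω‖ ^ 2 ∂P ≤ c := by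
  rw [integral_eq_lintegral_of_nonneg_ae (.of_forall fun ω => sq_nonneg _) (hf.norm.pow 2)]
  refine ENNReal.toReal_le_of_le_ofReal hc (le_trans (le_of_eq ?_) h)
  refine lintegral_congr fun ω => ?_
  rw [ENNReal.ofReal_pow (norm_nonneg _), ofReal_norm]

end MeasureTheory

/-! ### The Fourier martingale: boundedness, martingale property, limit -/

namespace BranchingWalk

variable {d : ℕ} {Φ : Measure (Config d)} [IsProbabilityMeasure Φ] {Ω : Type*} [MeasurableSpace Ω]
  {P : Measure Ω} [IsProbabilityMeasure P]

/-- The bound on the `L²` norm of the increments of the Fourier martingale after time `s`. -/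
def incrementBound (Φ : Measure (Config d)) (u : EuclideanSpace ℝ (Fin d)) (s : ℝ≥0) : ℝ≥0∞ :=
  ENNReal.ofReal ((∫ φ, total φ ^ 2 ∂Φ) *
    (Real.exp (-(2 * (intensityHat Φ u).re - meanTotal Φ) * s) /
      (2 * (intensityHat Φ u).re - meanTotal Φ))) ^ (1 / 2 : ℝ)

omit [IsProbabilityMeasure Φ] in
theorem tendsto_incrementBound {u : EuclideanSpace ℝ (Fin d)}
    (hu : meanTotal Φ / 2 < (intensityHat Φ u).re) :
    Tendsto (incrementBound Φ u) atTop (𝓝 0) := by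
  have hδ : -(2 * (intensityHat Φ u).re - meanTotal Φ) < 0 := by linarith
  have h1 : Tendsto (fun s : ℝ≥0 => -(2 * (intensityHat Φ u).re - meanTotal Φ) * (s : ℝ))
      atTop atBot :=
    (NNReal.tendsto_coe_atTop.2 tendsto_id).const_mul_atTop_of_neg hδ
  have h2 := (((Real.tendsto_exp_atBot.comp h1).div_const
    (2 * (intensityHat Φ u).re - meanTotal Φ)).const_mul (∫ φ, total φ ^ 2 ∂Φ))
  have h3 := (ENNReal.continuous_rpow_const (y := (1 / 2 : ℝ))).tendsto _ |>.comp
    (ENNReal.tendsto_ofReal h2)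
  rw [zero_div, mul_zero, ENNReal.ofReal_zero, ENNReal.zero_rpow_of_pos (by norm_num)] at h3
  exact h3

namespace Driving

variable (D : Driving Φ P) (hΦ : Integrable (fun φ => total φ ^ 2) Φ)
  {u : EuclideanSpace ℝ (Fin d)} (hu : meanTotal Φ / 2 < (intensityHat Φ u).re)

include hΦ hu

omit [IsProbabilityMeasure P] in
theorem eLpNorm_fourierMartingale_sub_le {s t : ℝ≥0} (hst : s ≤ t) :
    eLpNorm (D.fourierMartingale u t - D.fourierMartingale u s) 2 P ≤ incrementBound Φ u s := by
  rw [eLpNorm_two_eq]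
  exact ENNReal.rpow_le_rpow (D.lintegral_fourierMartingale_sub_sq_le hΦ u hu hst) (by norm_num)

theorem eLpNorm_fourierMartingale_le (t : ℝ≥0) :
    eLpNorm (D.fourierMartingale u t) 2 P ≤ incrementBound Φ u 0 + 1 := by
  have hm : ∀ t, AEStronglyMeasurable (D.fourierMartingale u t) P := fun t =>
    ((D.measurable_fourierMartingale u t).mono (D.filtration.le t) le_rfl).aestronglyMeasurable
  have h0 : eLpNorm (D.fourierMartingale u 0) 2 P = 1 := by
    rw [eLpNorm_congr_ae (D.ae_fourierMartingale_zero_time u),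
      eLpNorm_const _ two_ne_zero (NeZero.ne P)]
    simp
  have h := eLpNorm_add_le ((hm t).sub (hm 0)) (hm 0) (p := 2) one_le_two
  rw [sub_add_cancel, h0] at h
  exact h.trans (add_le_add_left
    (D.eLpNorm_fourierMartingale_sub_le hΦ hu zero_le) _)

theorem memLp_fourierMartingale (t : ℝ≥0) : MemLp (D.fourierMartingale u t) 2 P := by
  refine ⟨((D.measurable_fourierMartingale u t).mono (D.filtration.le t)
    le_rfl).aestronglyMeasurable, (D.eLpNorm_fourierMartingale_le hΦ hu t).trans_lt ?_⟩
  exact ENNReal.add_lt_top.2 ⟨ENNReal.rpow_lt_top_of_nonneg (by norm_num) ENNReal.ofReal_ne_top,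
    ENNReal.one_lt_top⟩

theorem martingale_fourierMartingale : Martingale (D.fourierMartingale u) D.filtration P := by
  have hint : ∀ t, Integrable (D.fourierMartingale u t) P := fun t =>
    (D.memLp_fourierMartingale hΦ hu t).integrable one_le_two
  refine ⟨fun t => (D.measurable_fourierMartingale u t).stronglyMeasurable, fun s t hst => ?_⟩
  refine (ae_eq_condExp_of_forall_setIntegral_eq (D.filtration.le s) (hint t)
    (fun _ _ _ => (hint s).integrableOn) (fun A hA _ => ?_)
    (D.measurable_fourierMartingale u s).stronglyMeasurable.aestronglyMeasurable).symm
  have h := D.setIntegral_fourierMartingale_sub hΦ u hst hA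
  rw [integral_sub (hint t).integrableOn (hint s).integrableOn, sub_eq_zero] at h
  exact h.symm

theorem exists_limit_fourierMartingale : ∃ Mlim : Ω → ℂ, MemLp Mlim 2 P ∧
    (∀ᵐ ω ∂P, Tendsto (fun t : ℝ≥0 => D.fourierMartingale u t ω) atTop (𝓝 (Mlim ω))) ∧
    ∀ t, eLpNorm (D.fourierMartingale u t - Mlim) 2 P ≤ incrementBound Φ u t :=
  (D.martingale_fourierMartingale hΦ hu).exists_memLp_tendsto (D.memLp_fourierMartingale hΦ hu)
    (fun _ _ => D.eLpNorm_fourierMartingale_sub_le hΦ hu) (tendsto_incrementBound hu)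
    ((D.ae_finite_population hΦ).mono fun _ h => D.continuousWithinAt_fourierMartingale u h)

end Driving

end BranchingWalk

end

open BranchingWalk in
theorem proposition2p2 {d : ℕ} (Φ : Measure (Config d)) [IsProbabilityMeasure Φ]
    (hΦ : Integrable (fun φ => total φ ^ 2) Φ) :
    ∃ C : EuclideanSpace ℝ (Fin d) → ℝ,
      (∀ c : ℝ, 0 < c → ∃ K : ℝ, ∀ u ∈ torus d,
        c ≤ (intensityHat Φ u).re - meanTotal Φ / 2 → |C u| ≤ K) ∧
      ∀ (Ω : Type*) [MeasurableSpace Ω] (P : Measure Ω) [IsProbabilityMeasure P]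
        (D : Driving Φ P),
        (∀ᵐ ω ∂P, ∀ t : ℝ≥0, (D.population t ω).Finite) ∧
        ∀ u ∈ torus d, meanTotal Φ / 2 < (intensityHat Φ u).re →
          Martingale (D.fourierMartingale u) D.filtration P ∧
          (∃ K : ℝ≥0, ∀ t : ℝ≥0, MemLp (D.fourierMartingale u t) 2 P ∧
            eLpNorm (D.fourierMartingale u t) 2 P ≤ K) ∧
          (∃ Mlim : Ω → ℂ, MemLp Mlim 2 P ∧
            (∀ᵐ ω ∂P, Tendsto (fun t : ℝ≥0 => D.fourierMartingale u t ω) atTop (𝓝 (Mlim ω))) ∧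
            Tendsto (fun t : ℝ≥0 => eLpNorm (D.fourierMartingale u t - Mlim) 2 P)
              atTop (𝓝 0) ∧
            ∀ t : ℝ≥0, ∫ ω, ‖D.fourierMartingale u t ω - Mlim ω‖ ^ 2 ∂P ≤
              C u * (∫ φ, total φ ^ 2 ∂Φ) *
                Real.exp (-(2 * (intensityHat Φ u).re - meanTotal Φ) * t)) ∧
          (Integrable (fun φ => displacement 1 φ ^ 2) Φ →
            Integrable (fun φ => displacement 2 φ) Φ →
            ∀ t : ℝ≥0, ∫ ω, ‖D.fourierMartingale u t ω - D.fourierMartingale 0 t ω‖ ^ 2 ∂P ≤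
              C u * ‖u‖ ^ 2) := by
  have hA : 0 ≤ ∫ φ, total φ ^ 2 ∂Φ := integral_nonneg fun φ => sq_nonneg _
  -- One constant serves both estimates: `1/δ` for the rate of convergence and `compareConst` for
  -- the comparison with `u = 0`. Both are nonnegative and decrease in `δ`, so their values at `δ =
  -- 2c` bound them where `Re μ̂(u) - λ/2 ≥ c`.
  refine ⟨fun u => 1 / (2 * (intensityHat Φ u).re - meanTotal Φ) +
    compareConst Φ (2 * (intensityHat Φ u).re - meanTotal Φ), fun c hc =>
    ⟨1 / (2 * c) + compareConst Φ (2 * c), fun u _ hu => ?_⟩, ?_⟩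
  · have hδ : 2 * c ≤ 2 * (intensityHat Φ u).re - meanTotal Φ := by linarith
    have hδ0 : 0 < 2 * (intensityHat Φ u).re - meanTotal Φ := by linarith
    have h0 := compareConst_nonneg (Φ := Φ) hδ0.le
    rw [abs_of_nonneg (by positivity)]
    exact add_le_add (one_div_le_one_div_of_le (by positivity) hδ)
      (compareConst_anti (by positivity) hδ)
  intro Ω _ P _ D
  refine ⟨D.ae_finite_population hΦ, fun u _ hu => ?_⟩
  have hδ : 0 < 2 * (intensityHat Φ u).re - meanTotal Φ := by linarith
  have h0 := compareConst_nonneg (Φ := Φ) hδ.le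
  refine ⟨D.martingale_fourierMartingale hΦ hu,
    ⟨(incrementBound Φ u 0 + 1).toNNReal, fun t => ⟨D.memLp_fourierMartingale hΦ hu t, ?_⟩⟩, ?_, ?_⟩
  · rw [ENNReal.coe_toNNReal]
    · exact D.eLpNorm_fourierMartingale_le hΦ hu t
    · exact ENNReal.add_ne_top.2 ⟨ENNReal.rpow_ne_top_of_nonneg (by norm_num) ENNReal.ofReal_ne_top,
        ENNReal.one_ne_top⟩
  · obtain ⟨Mlim, hm, hlim, hle⟩ := D.exists_limit_fourierMartingale hΦ hu
    refine ⟨Mlim, hm, hlim, tendsto_of_tendsto_of_tendsto_of_le_of_le tendsto_const_nhds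
      (tendsto_incrementBound hu) (fun _ => zero_le) hle, fun t => ?_⟩
    refine (integral_norm_sq_le_of_lintegral_le
      ((D.memLp_fourierMartingale hΦ hu t).sub hm).aestronglyMeasurable
      (c := (∫ φ, total φ ^ 2 ∂Φ) *
        (Real.exp (-(2 * (intensityHat Φ u).re - meanTotal Φ) * t) /
          (2 * (intensityHat Φ u).re - meanTotal Φ))) (by positivity) ?_).trans ?_
    · have h := hle t
      rw [eLpNorm_two_eq, incrementBound] at h
      exact (ENNReal.rpow_le_rpow_iff (by norm_num)).1 h
    · rw [div_eq_mul_one_div, mul_comm (Real.exp _), ← mul_assoc,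
        mul_comm (∫ φ, total φ ^ 2 ∂Φ)]
      gcongr
      exact le_add_of_nonneg_right h0
  · intro h1 h2 t
    refine (integral_norm_sq_le_of_lintegral_le ?_ (by positivity)
      (D.lintegral_fourierMartingale_sub_zero_sq_le hΦ h1 h2 u hu t)).trans ?_
    · exact (D.measurable_fourierMartingale_sub u 0 t t).aestronglyMeasurable
    · gcongr
      exact le_add_of_nonneg_left (by positivity)
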